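/- Let $p$ be a prime and $N\ge 2$. Let $U$ be the group of upper triangular unipotent matrices, $U^-$ its transpose, and $T$ the diagonal torus of $\mathrm{GL}_{N+1}$. **Notation.** Let $k_1,\dots,k_s\ge 1$ have sum $N+1$, and let $w=w(k_1,\dots,k_s)$ be the block anti-diagonal matrix with the blocks $I_{k_1},\dots,I_{k_s}$ from top right to bottom left, represented with determinant one by giving $I_{k_t}$ the sign $(-1)^{k_{t+1}+\dots+k_s}$. Put $U_w=U\cap w^{-1}U^-w$, $\kappa_l=k_1+\dots+k_l$, $I_l=\{(i,j):1\le i\le\kappa_l\le j\le\kappa_{l+1}-1\}$ and $I_w=\bigcup_{l=1}^{s-1}I_l$. For $a\in\mathbb Q_p$ let $\mu(a)=0$ if $a\in\mathbb Z_p$ and $\mu(a)=-v_p(a)$ otherwise. Put $c=ap^{\mu(a)}$, and let $d=0$ if $\mu(a)=0$ and $d=c^{-1}$ otherwise. For a simple root $\alpha_i$ let $\phi_{\alpha_i}$ be the embedding of $\mathrm{SL}_2$ in the rows and columns $i,i+1$. Put $b_{\alpha_i}(a)=\phi_{\alpha_i}\begin{pmatrix}0&-1\\1&a\end{pmatrix}$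 if $a\in\mathbb Z_p$, and $b_{\alpha_i}(a)=\phi_{\alpha_i}\begin{pmatrix}c^{-1}&0\\p^{\mu(a)}&c\end{pmatrix}$ otherwise. Use the reduced expression $w=s_{i_1}\cdots s_{i_{l(w)}}$ defined inductively over the number of blocks by $$w(k_1,\dots,k_s)=\bigl(I_{k_1}\oplus w(k_2,\dots,k_s)\bigr)\,(s_{k_1}\cdots s_N)\cdots(s_1\cdots s_{N-k_1+1}).$$ Then $t\mapsto\gamma_t=s_{i_1}\cdots s_{i_{t-1}}(\alpha_{i_t})$ runs once through the roots $\alpha_{i,j}=\alpha_i+\dots+\alpha_j$ with $(i,j)\in I_w$. For a family $\underline a=(a_{i,j})_{(i,j)\in I_w}$ in $\mathbb Q_p$ put $b_w(\underline a)=\prod_t b_{\alpha_{i_t}}(a_{\gamma_t})$, where $a_{\gamma_t}=a_{i,j}$ if $\gamma_t=\alpha_{i,j}$, and write $m_{i,j},c_{i,j},d_{i,j}$ for $\mu,c,d$ of $a_{i,j}$. A Bruhat decomposition for $w$ is a product $LCR$ with $L\in U(\mathbb Q_p)$, $C\in T(\mathbb Q_p)w$ and $R\in U_w(\mathbb Q_p)$.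 For $r\in\mathbb Z_{\ge0}^N$ let $\mathfrak n=\mathrm{diag}(p^{-r_1},p^{r_1-r_2},\dots,p^{r_{N-1}-r_N},p^{r_N})\cdot w$ and $C(\mathfrak n)=U(\mathbb Q_p)\mathfrak nU(\mathbb Q_p)\cap\mathrm{GL}_{N+1}(\mathbb Z_p)$. Let $\mathcal M_w(r)$ be the set of families $\underline m=(m_{i,j})_{(i,j)\in I_w}$ of non-negative integers with $\sum_{i\le l\le j}m_{i,j}=r_l$ for $1\le l\le N$. Put $Y(\underline m)=\{\underline a:\mu(a_{i,j})=m_{i,j}\text{ for all }(i,j)\in I_w\}$. For $(i,j)\in I_l$ put $C_{i,j}=p^{\sum_{a=1}^i m_{a,j}+\sum_{a=j+1}^{\kappa_{l+1}-1}m_{i,a}}$, and let $C_w(\underline m)$ be the set of integer families $\underline c=(c_{i,j})_{(i,j)\in I_w}$ with $0\le c_{i,j}<C_{i,j}$ and $(c_{i,j},p^{m_{i,j}})=1$. For two blocks, write $w_{k,q}=w(k,q)$. **Theorem.** Let $w=w(k,\,n+1-k,\,f,\dots)$ have more than two blocks, with top block of size $k$, top two blocks of combined size $n+1$, and third block of size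 $f$. Put $M=N-n$. Then $$w=w'\cdot(I_M\oplus w_{k,n+1-k}),$$ where $w'$ is obtained from $w$ by replacing the top two blocks by one block of size $n+1$. The set $I_w$ is the disjoint union of $I_{w'}$ and $I_{w_{k,n+1-k}}$. For every family $\underline a$ on $I_w$, the matrices $b_{w'}(\underline a|_{I_{w'}})$, $b_{w_{k,n+1-k}}(\underline a|_{I_{w_{k,n+1-k}}})$ and $b_w(\underline a)$ have Bruhat decompositions $L'C'R'$, $LCR$ and $\mathfrak L\mathfrak C\mathfrak R$ for $w'$, $w_{k,n+1-k}$ and $w$ respectively, and these satisfy the following. * Left factor: $\mathfrak L_{i,i+1}=L'_{i,i+1}+L_{i,i+1}\,p^{\sum_{j=n+1}^{N}(m_{i+1,j}-m_{i,j})}$ for $1\le i\le n$, and $\mathfrak L_{i,i+1}=L'_{i,i+1}$ for $n+1\le i\le N$. * Central factor: $\mathfrak C=C'\cdot(I_M\oplus C)$. * Right factor: $\mathfrak R_{i,i+1}=R'_{i,i+1}$ for $1\le i<M$; $$\mathfrak R_{M,M+1}=\sum_{j=1}^{k+1}c_{j,n+f}\,d_{j,k}\,p^{\sum_{l=1}^{j-1}(m_{l,k}-m_{l,n+f})-m_{j,n+f}},\qquad\text{where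 } d_{k+1,k}:=1;$$ and $\mathfrak R_{M+d,M+e}=R_{d,e}$ for $1\le d,e\le n+1$. Moreover, for every family $\underline m$ of non-negative integers on $I_w$, with restrictions $\underline m_1$ to $I_{w'}$ and $\underline m_2$ to $I_{w_{k,n+1-k}}$, $$C_w(\underline m)=C_{w'}(\underline m_1)\times C_{w_{k,n+1-k}}(\underline m_2).$$ For every $r$ and $\underline m\in\mathcal M_w(r)$, the families $(c_{i,j}p^{-m_{i,j}})$ with $\underline c\in C_w(\underline m)$ lie in $Y(\underline m)$ and form a system of representatives for the right action of $U_w(\mathbb Z_p)$ on $Y(\underline m)$. Here $\underline a,\underline a'$ are in the same orbit if and only if $U(\mathbb Z_p)b_w(\underline a')=U(\mathbb Z_p)b_w(\underline a)u$ for some $u\in U_w(\mathbb Z_p)$. Finally, for every $r$, the elements $b_w\bigl((c_{i,j}p^{-m_{i,j}})\bigr)$ with $\underline m\in\mathcal M_w(r)$ and $\underline c\in C_w(\underline m)$ lie in $C(\mathfrak n)$, and each orbit of $U_w(\mathbb Z_p)$ on $U(\mathbb Z_p)\backslash C(\mathfrak n)$ is represented by exactly one such pair $(\underline m,\underline c)$.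 -/

import Mathlib

noncomputable section

namespace Kloosterman

/-! Conventions. Matrix entries, simple roots `α_i` and positive roots
`α_{i,j} = α_i + ⋯ + α_j` carry indices starting from `1`.  A family `(x_{i,j})` indexed by a set
`I` of pairs is a function on `ℕ × ℕ`; where such families are counted (in the sets `MSet`, `YSet`,
`CSet` below) they are required to vanish off `I`.

An admissible Weyl element is given by the list `[k_1, …, k_r]` of its block sizes, from the top
block to the bottom block; it has `I_{k_1}` in the upper right corner and `I_{k_r}` in the lower
left corner. -/

/-- Square matrices of size `N + 1` over `ℚ_p`. -/
abbrev Mat (p : ℕ) [Fact p.Prime] (N : ℕ) : Type := Matrix (Fin (N + 1)) (Fin (N + 1)) ℚ_[p]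

/-- The entry `A_{i,j}`, with indices `1 ≤ i, j ≤ N + 1` (and the value `0` for other indices). -/
def entry {p : ℕ} [Fact p.Prime] {N : ℕ} (A : Mat p N) (i j : ℕ) : ℚ_[p] :=
  if h : (1 ≤ i ∧ i ≤ N + 1) ∧ (1 ≤ j ∧ j ≤ N + 1) then
    A ⟨i - 1, by omega⟩ ⟨j - 1, by omega⟩
  else 0

/-- The block diagonal matrix `I_{N - n} ⊕ A` of size `N + 1`, for `A` of size `n + 1`. -/
def idSum {p : ℕ} [Fact p.Prime] (N : ℕ) {n : ℕ} (A : Mat p n) : Mat p N :=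
  Matrix.of fun i j =>
    if N - n ≤ (i : ℕ) ∧ N - n ≤ (j : ℕ) then
      entry A ((i : ℕ) + 1 - (N - n)) ((j : ℕ) + 1 - (N - n))
    else if i = j then 1 else 0

/-! ### Admissible Weyl elements -/

/-- Entries (with indices starting from `0`) of the determinant one representative of the
admissible Weyl element with the given blocks: the block `I_{k_t}` comes with the sign
`(-1) ^ (k_{t+1} + ⋯ + k_r)`. -/
def weylEntry : List ℕ → ℕ → ℕ → ℤ
  | [], _, _ => 0
  | k :: bs, i, j =>
      if i < k then (if j = i + bs.sum then (-1) ^ bs.sum else 0) else weylEntry bs (i - k) j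

/-- The admissible Weyl element with blocks `bs`, represented by a matrix of determinant one. -/
def weyl (p : ℕ) [Fact p.Prime] (N : ℕ) (bs : List ℕ) : Mat p N :=
  Matrix.of fun i j => ((weylEntry bs i j : ℤ) : ℚ_[p])

/-- The indices of the simple reflections in the reduced expression of an admissible Weyl element,
defined inductively over the number of blocks by
`w(k_1, …, k_r) = (I_{k_1} ⊕ w(k_2, …, k_r)) (s_{k_1} ⋯ s_N) ⋯ (s_1 ⋯ s_{N - k_1 + 1})`. -/
def redWord : List ℕ → List ℕ
  | [] => []
  | k :: bs =>
      (redWord bs).map (fun i => i + k) ++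
        (List.range k).flatMap (fun t => (List.range bs.sum).map (fun u => k - t + u))

/-- `κ_l = k_1 + ⋯ + k_l`. -/
def kappa (bs : List ℕ) (l : ℕ) : ℕ := (bs.take l).sum

/-- `I_l = {(i, j) : 1 ≤ i ≤ κ_l ≤ j ≤ κ_{l+1} - 1}`. -/
def indexBlock (bs : List ℕ) (l : ℕ) : Set (ℕ × ℕ) :=
  {x | 1 ≤ x.1 ∧ x.1 ≤ kappa bs l ∧ kappa bs l ≤ x.2 ∧ x.2 + 1 ≤ kappa bs (l + 1)}

/-- `I_w`, the union of the `I_l` with `1 ≤ l ≤ r - 1`. -/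
def indexSet (bs : List ℕ) : Set (ℕ × ℕ) :=
  ⋃ l ∈ Set.Ico 1 bs.length, indexBlock bs l

/-! ### The map `b` -/

section Single

variable {p : ℕ} [Fact p.Prime]

/-- `μ(a) = 0` if `a ∈ ℤ_p` and `μ(a) = -v_p(a)` otherwise. -/
def mu (a : ℚ_[p]) : ℕ := if ‖a‖ ≤ 1 then 0 else (-a.valuation).toNat

/-- The `c` with `a = c p ^ (-m)`, where `m = μ(a)`. -/
def cPart (a : ℚ_[p]) : ℚ_[p] := a * (p : ℚ_[p]) ^ mu a

/-- The formal inverse of `c`: it is `0` if `μ(a) = 0`, and `c⁻¹` otherwise. -/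
def dPart (a : ℚ_[p]) : ℚ_[p] := if mu a = 0 then 0 else (cPart a)⁻¹

/-- The embedding `φ_{α_i}` of `2 × 2` matrices in the rows and columns `i`, `i + 1`. -/
def phi (N i : ℕ) (A : Matrix (Fin 2) (Fin 2) ℚ_[p]) : Mat p N :=
  Matrix.of fun r s =>
    if (r : ℕ) + 1 = i ∧ (s : ℕ) + 1 = i then A 0 0
    else if (r : ℕ) + 1 = i ∧ (s : ℕ) = i then A 0 1
    else if (r : ℕ) = i ∧ (s : ℕ) + 1 = i then A 1 0
    else if (r : ℕ) = i ∧ (s : ℕ) = i then A 1 1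
    else if r = s then 1 else 0

/-- `b_{α_i}(a)`. -/
def bSimple (N i : ℕ) (a : ℚ_[p]) : Mat p N :=
  phi N i (if ‖a‖ ≤ 1 then !![0, -1; 1, a]
    else !![(cPart a)⁻¹, 0; (p : ℚ_[p]) ^ mu a, cPart a])

/-- The product `∏ b_{α_{i_t}}(a_{γ_t})` along a word `i_1, i_2, …`, where
`γ_t = σ s_{i_1} ⋯ s_{i_{t-1}} (α_{i_t})`. Permutations act on the roots `α_{i,j} = e_i - e_{j+1}`
through the indices of the `e_i`. -/
def bAlong (N : ℕ) (a : ℕ × ℕ → ℚ_[p]) : List ℕ → Equiv.Perm ℕ → Mat p N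
  | [], _ => 1
  | i :: is, σ =>
      bSimple N i (a (σ i, σ (i + 1) - 1)) * bAlong N a is (σ * Equiv.swap i (i + 1))

/-- `b(a)` for the reduced expression of the admissible Weyl element with blocks `bs`; the factor
belonging to `γ_t = α_{i,j}` has the argument `a_{i,j}`. -/
def bMap (N : ℕ) (bs : List ℕ) (a : ℕ × ℕ → ℚ_[p]) : Mat p N :=
  bAlong N a (redWord bs) 1

end Single

/-! ### Unipotent groups and Bruhat decomposition -/

/-- `U(ℚ_p)`: upper triangular matrices with ones on the diagonal. -/
def U (p : ℕ) [Fact p.Prime] (N : ℕ) : Set (Mat p N) :=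
  {u | (∀ i, u i i = 1) ∧ ∀ i j, j < i → u i j = 0}

/-- `U⁻(ℚ_p)`: lower triangular matrices with ones on the diagonal. -/
def UOpp (p : ℕ) [Fact p.Prime] (N : ℕ) : Set (Mat p N) :=
  {u | (∀ i, u i i = 1) ∧ ∀ i j, i < j → u i j = 0}

/-- `U_w(ℚ_p)`, where `U_w = U ∩ w⁻¹ U⁻ w`. -/
def Uw (p : ℕ) [Fact p.Prime] (N : ℕ) (bs : List ℕ) : Set (Mat p N) :=
  {u | u ∈ U p N ∧ weyl p N bs * u * (weyl p N bs)⁻¹ ∈ UOpp p N}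

/-- Matrices with entries in `ℤ_p`. -/
def Integral (p : ℕ) [Fact p.Prime] (N : ℕ) : Set (Mat p N) :=
  {u | ∀ i j, ‖u i j‖ ≤ 1}

/-- `GL_{N+1}(ℤ_p)`, as a set of matrices over `ℚ_p`. -/
def GLZp (p : ℕ) [Fact p.Prime] (N : ℕ) : Set (Mat p N) :=
  Set.range fun h : GL (Fin (N + 1)) ℤ_[p] =>
    (h : Matrix (Fin (N + 1)) (Fin (N + 1)) ℤ_[p]).map fun x => (x : ℚ_[p])

/-- `L C R` is the Bruhat decomposition of `g` in the cell of `w`: `g = L C R` with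
`L ∈ U(ℚ_p)`, `C ∈ T(ℚ_p) w` and `R ∈ U_w(ℚ_p)`. -/
structure IsBruhat {p : ℕ} [Fact p.Prime] {N : ℕ} (bs : List ℕ) (g L C R : Mat p N) : Prop where
  left_mem : L ∈ U p N
  central_mem : ∃ t : Fin (N + 1) → ℚ_[p], (∀ i, t i ≠ 0) ∧ C = Matrix.diagonal t * weyl p N bs
  right_mem : R ∈ Uw p N bs
  eq_mul : g = L * C * R

/-! ### Kloosterman sets and systems of representatives -/

/-- The exponent vector `(r_1, …, r_N)`, extended by `r_0 = r_{N+1} = 0`. -/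
def expo (N : ℕ) (r : ℕ → ℕ) (l : ℕ) : ℤ := if 1 ≤ l ∧ l ≤ N then (r l : ℤ) else 0

/-- The modulus `diag(p^{-r_1}, p^{r_1 - r_2}, …, p^{r_{N-1} - r_N}, p^{r_N})`. -/
def modulus (p : ℕ) [Fact p.Prime] (N : ℕ) (r : ℕ → ℕ) : Mat p N :=
  Matrix.diagonal fun i => (p : ℚ_[p]) ^ (expo N r (i : ℕ) - expo N r ((i : ℕ) + 1))

/-- `C(𝔫) = U(ℚ_p) 𝔫 U(ℚ_p) ∩ GL_{N+1}(ℤ_p)`, where `𝔫` is the modulus times `w`. -/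
def cell (p : ℕ) [Fact p.Prime] (N : ℕ) (bs : List ℕ) (r : ℕ → ℕ) : Set (Mat p N) :=
  {g | (∃ u ∈ U p N, ∃ u' ∈ U p N, g = u * (modulus p N r * weyl p N bs) * u') ∧ g ∈ GLZp p N}

/-- `U(ℤ_p) h` lies in the orbit of `U(ℤ_p) g` under right multiplication by `U_w(ℤ_p)`. -/
def SameOrbit {p : ℕ} [Fact p.Prime] {N : ℕ} (bs : List ℕ) (g h : Mat p N) : Prop :=
  ∃ v ∈ U p N ∩ Integral p N, ∃ u ∈ Uw p N bs ∩ Integral p N, h = v * g * u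

/-- `ℳ_w(r)`: families `(m_{i,j})` on `I_w` with `∑_{i ≤ l ≤ j} m_{i,j} = r_l` for
`1 ≤ l ≤ N`. -/
def MSet (N : ℕ) (bs : List ℕ) (r : ℕ → ℕ) : Set (ℕ × ℕ → ℕ) :=
  {m | (∀ x ∉ indexSet bs, m x = 0) ∧
    ∀ l, 1 ≤ l → l ≤ N → ∑ i ∈ Finset.Icc 1 l, ∑ j ∈ Finset.Icc l N, m (i, j) = r l}

/-- `Y(m)`: families `(a_{i,j})` on `I_w` with `μ(a_{i,j}) = m_{i,j}`. -/
def YSet (p : ℕ) [Fact p.Prime] (bs : List ℕ) (m : ℕ × ℕ → ℕ) : Set (ℕ × ℕ → ℚ_[p]) :=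
  {a | (∀ x ∉ indexSet bs, a x = 0) ∧ ∀ x ∈ indexSet bs, mu (a x) = m x}

/-- For `(i, j) ∈ I_l`, the exponent of `p` in `C_{i,j}`. -/
def cExp (bs : List ℕ) (m : ℕ × ℕ → ℕ) (l : ℕ) (x : ℕ × ℕ) : ℕ :=
  ∑ a ∈ Finset.Icc 1 x.1, m (a, x.2) +
    ∑ a ∈ Finset.Icc (x.2 + 1) (kappa bs (l + 1) - 1), m (x.1, a)

/-- `C_w(m)`: families of integers `(c_{i,j})` on `I_w` with `0 ≤ c_{i,j} < C_{i,j}` and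
`(c_{i,j}, p ^ m_{i,j}) = 1`. -/
def CSet (p : ℕ) (bs : List ℕ) (m : ℕ × ℕ → ℕ) : Set (ℕ × ℕ → ℤ) :=
  {c | (∀ x ∉ indexSet bs, c x = 0) ∧
    ∀ l ∈ Set.Ico 1 bs.length, ∀ x ∈ indexBlock bs l,
      0 ≤ c x ∧ c x < (p : ℤ) ^ cExp bs m l x ∧ IsCoprime (c x) ((p : ℤ) ^ m x)}

/-- The family `a_{i,j} = c_{i,j} p ^ (-m_{i,j})`. -/
def family (p : ℕ) [Fact p.Prime] (m : ℕ × ℕ → ℕ) (c : ℕ × ℕ → ℤ) : ℕ × ℕ → ℚ_[p] :=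
  fun x => (c x : ℚ_[p]) * (p : ℚ_[p]) ^ (-(m x : ℤ))

end Kloosterman

end

open Kloosterman

noncomputable section

namespace Kloosterman

/-! ### Upper unipotent matrices, integral matrices -/

section Unipotent

variable {p : ℕ} [Fact p.Prime] {N : ℕ}

/-! Everything rests on one factorization. Put q = n+1-k and v = w(k,q). Up to exchanging commuting
letters, the reduced word of w is the word of w' followed by the word of v shifted by M. The
permutation of the first word undoes this shift, so the second word carries exactly the root labels
of I_v, and b_w(a) = b_{w'}(a)(I_M ⊕ b_v(a)) (`bMap_merge`). Statements about arbitrary w then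
follow by induction on the number of blocks, with two blocks as the substantial case.

Bruhat decompositions. For two blocks the SL_2 decomposition of each simple factor is pushed through
the reduced word (`bruhat_step`, `bruhat_pair`); the torus part collects the power p^{μ} along the
coroot of each root. In general L'C'R'(I ⊕ LCR) = [L'·C'(I ⊕ L)C'⁻¹]·[C'(I ⊕ C)]·RR
(`bruhat_merge`). Here w' carries the last n+1 coordinates in order to the top, so the conjugate of
I ⊕ L is again upper unipotent, and R' = (A B; 0 1) turns into RR = (A Bg; 0 R) with g = b_v(a). The
formulas for the three factors are read off from this. The corner entry of RR is the last row of B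
times the first column of g, and that row of B is found by merging w' once more with the third
block.

Representatives. An element of the cell that lies in GL(ℤ_p) is determined modulo U(ℤ_p) on the left
by its right factor, even up to U_w(ℤ_p) (`sameOrbit_of_right`). It thus suffices that every class
of U_w(ℚ_p)/U_w(ℤ_p) contains the right factor of exactly one family c p^{-m} with admissible c
(`existsUnique_param`). For two blocks the bottom q rows of b_v(a) are G(1 | Y), where column i of Y
solves G_i Y_i = yvec(a_i), with G_i upper triangular, integral, and with powers of p determined by
the earlier rows on its diagonal (`vecMul_ev_grassMat`). Back substitution reduces Y_i modulo ℤ_p to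
one residue problem per entry a_{i,j}, and its modulus gives exactly the bound C_{i,j}
(`exists_row`, `row_unique`). For more blocks the integrality condition splits into the one for v
and one for w', because g is invertible over ℤ_p (`param_merge_iff`).

Two facts tie this to m and r. Right multiplication by an integral unipotent matrix changes a only
by integers (`bMap_mul_unipotent`), so μ is constant on orbits. The torus exponent at l is the sum
of m_{i,j} over i ≤ l ≤ j, so equality with the modulus is membership in ℳ_w(r)
(`expo_eq_expoSet_iff`). -/

theorem one_mem_U : (1 : Mat p N) ∈ U p N :=
  ⟨fun i => Matrix.one_apply_eq i, fun _ _ h => Matrix.one_apply_ne (ne_of_gt h)⟩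

theorem blockTriangular_of_mem_U {u : Mat p N} (hu : u ∈ U p N) : u.BlockTriangular id :=
  fun i j h => hu.2 i j h

theorem mul_apply_diag {u v : Mat p N} (hu : ∀ i j, j < i → u i j = 0)
    (hv : ∀ i j, j < i → v i j = 0) (i : Fin (N + 1)) : (u * v) i i = u i i * v i i := by
  rw [Matrix.mul_apply]
  apply Finset.sum_eq_single i
  · intro l _ hl
    rcases lt_or_gt_of_ne hl with h | h
    · rw [hu i l h, zero_mul]
    · rw [hv l i h, mul_zero]
  · intro h; exact absurd (Finset.mem_univ i) h

theorem mul_apply_of_lt {u v : Mat p N} (hu : ∀ i j, j < i → u i j = 0)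
    (hv : ∀ i j, j < i → v i j = 0) {i j : Fin (N + 1)} (h : j < i) : (u * v) i j = 0 :=
  Matrix.BlockTriangular.mul (b := id) (M := u) (N := v) (fun i j h => hu i j h)
    (fun i j h => hv i j h) h

theorem mul_mem_U {u v : Mat p N} (hu : u ∈ U p N) (hv : v ∈ U p N) : u * v ∈ U p N := by
  refine ⟨fun i => ?_, fun i j h => mul_apply_of_lt hu.2 hv.2 h⟩
  rw [mul_apply_diag hu.2 hv.2, hu.1, hv.1, one_mul]

theorem det_of_mem_U {u : Mat p N} (hu : u ∈ U p N) : u.det = 1 := by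
  rw [Matrix.det_of_isUpperTriangular (blockTriangular_of_mem_U hu)]
  exact Finset.prod_eq_one fun i _ => hu.1 i

theorem isUnit_det_of_mem_U {u : Mat p N} (hu : u ∈ U p N) : IsUnit u.det := by
  rw [det_of_mem_U hu]; exact isUnit_one

theorem inv_apply_of_lt {u : Mat p N} (h : IsUnit u.det) (hu : ∀ i j, j < i → u i j = 0)
    {i j : Fin (N + 1)} (hij : j < i) : u⁻¹ i j = 0 := by
  have := u.invertibleOfIsUnitDet h
  exact Matrix.blockTriangular_inv_of_blockTriangular (b := id) (fun i j h => hu i j h) hij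

theorem inv_mem_U {u : Mat p N} (hu : u ∈ U p N) : u⁻¹ ∈ U p N := by
  have h2 : ∀ i j, j < i → u⁻¹ i j = 0 :=
    fun i j h => inv_apply_of_lt (isUnit_det_of_mem_U hu) hu.2 h
  refine ⟨fun i => ?_, h2⟩
  have h := mul_apply_diag hu.2 h2 i
  rw [Matrix.mul_nonsing_inv _ (isUnit_det_of_mem_U hu), hu.1, one_mul, Matrix.one_apply_eq] at h
  exact h.symm

theorem transpose_mem_U {u : Mat p N} : u.transpose ∈ U p N ↔ u ∈ UOpp p N :=
  ⟨fun h => ⟨h.1, fun i j hij => h.2 j i hij⟩, fun h => ⟨h.1, fun i j hij => h.2 j i hij⟩⟩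

theorem one_mem_UOpp : (1 : Mat p N) ∈ UOpp p N := by
  rw [← transpose_mem_U, Matrix.transpose_one]; exact one_mem_U

theorem mul_mem_UOpp {u v : Mat p N} (hu : u ∈ UOpp p N) (hv : v ∈ UOpp p N) :
    u * v ∈ UOpp p N := by
  rw [← transpose_mem_U] at *
  rw [Matrix.transpose_mul]; exact mul_mem_U hv hu

theorem inv_mem_UOpp {u : Mat p N} (hu : u ∈ UOpp p N) : u⁻¹ ∈ UOpp p N := by
  rw [← transpose_mem_U] at *
  rw [Matrix.transpose_nonsing_inv]; exact inv_mem_U hu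

theorem mul_inv_cancel_of_mem_U {u : Mat p N} (hu : u ∈ U p N) : u * u⁻¹ = 1 :=
  Matrix.mul_nonsing_inv _ (isUnit_det_of_mem_U hu)

theorem inv_mul_cancel_of_mem_U {u : Mat p N} (hu : u ∈ U p N) : u⁻¹ * u = 1 :=
  Matrix.nonsing_inv_mul _ (isUnit_det_of_mem_U hu)

/-! ### Integral matrices and the group GL(ℤ_p) inside matrices over ℚ_p. -/

theorem one_mem_Integral : (1 : Mat p N) ∈ Integral p N := by
  intro i j
  rw [Matrix.one_apply]
  split_ifs <;> simp

theorem norm_sum_le_one {ι : Type*} (s : Finset ι) (f : ι → ℚ_[p]) (h : ∀ i ∈ s, ‖f i‖ ≤ 1) :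
    ‖∑ i ∈ s, f i‖ ≤ 1 :=
  IsUltrametricDist.norm_sum_le_of_forall_le_of_nonneg zero_le_one h

theorem norm_add_le_one {a b : ℚ_[p]} (ha : ‖a‖ ≤ 1) (hb : ‖b‖ ≤ 1) : ‖a + b‖ ≤ 1 :=
  (IsUltrametricDist.norm_add_le_max a b).trans (max_le ha hb)

theorem norm_mul_le_one {a b : ℚ_[p]} (ha : ‖a‖ ≤ 1) (hb : ‖b‖ ≤ 1) : ‖a * b‖ ≤ 1 := by
  rw [norm_mul]; exact mul_le_one₀ ha (norm_nonneg _) hb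

theorem mul_mem_Integral {u v : Mat p N} (hu : u ∈ Integral p N) (hv : v ∈ Integral p N) :
    u * v ∈ Integral p N := by
  intro i j
  rw [Matrix.mul_apply]
  exact norm_sum_le_one _ _ fun l _ => norm_mul_le_one (hu i l) (hv l j)

/-- Integral matrices with an integral inverse. -/
structure IsIntUnit (g : Mat p N) : Prop where
  integral : g ∈ Integral p N
  inv_integral : g⁻¹ ∈ Integral p N
  isUnit_det : IsUnit g.det

theorem IsIntUnit.of_mul_eq_one {g h : Mat p N} (hg : g ∈ Integral p N) (hh : h ∈ Integral p N)
    (e : g * h = 1) : IsIntUnit g :=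
  ⟨hg, by rw [Matrix.inv_eq_right_inv e]; exact hh, Matrix.isUnit_det_of_right_inverse e⟩

theorem isIntUnit_one : IsIntUnit (1 : Mat p N) :=
  IsIntUnit.of_mul_eq_one one_mem_Integral one_mem_Integral (mul_one 1)

theorem IsIntUnit.mul_inv {g : Mat p N} (hg : IsIntUnit g) : g * g⁻¹ = 1 :=
  Matrix.mul_nonsing_inv _ hg.isUnit_det

theorem IsIntUnit.inv_mul {g : Mat p N} (hg : IsIntUnit g) : g⁻¹ * g = 1 :=
  Matrix.nonsing_inv_mul _ hg.isUnit_det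

theorem IsIntUnit.inv {g : Mat p N} (hg : IsIntUnit g) : IsIntUnit g⁻¹ :=
  IsIntUnit.of_mul_eq_one hg.inv_integral hg.integral hg.inv_mul

theorem IsIntUnit.mul {g h : Mat p N} (hg : IsIntUnit g) (hh : IsIntUnit h) :
    IsIntUnit (g * h) := by
  refine IsIntUnit.of_mul_eq_one (h := h⁻¹ * g⁻¹) (mul_mem_Integral hg.1 hh.1)
    (mul_mem_Integral hh.2 hg.2) ?_
  rw [Matrix.mul_assoc, ← Matrix.mul_assoc h, hh.mul_inv, Matrix.one_mul, hg.mul_inv]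

/-- Lets all later computations stay over ℚ_p. Inverse identities descend to ℤ_p because ℤ_p → ℚ_p
is injective. -/
theorem mem_GLZp_iff {g : Mat p N} : g ∈ GLZp p N ↔ IsIntUnit g := by
  constructor
  · rintro ⟨h, rfl⟩
    refine IsIntUnit.of_mul_eq_one
      (h := ((h⁻¹ : GL (Fin (N + 1)) ℤ_[p]) : Matrix (Fin (N + 1)) (Fin (N + 1)) ℤ_[p]).map
        fun x => (x : ℚ_[p])) (fun i j => ?_) (fun i j => ?_) ?_
    · exact PadicInt.norm_le_one _
    · exact PadicInt.norm_le_one _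
    · have e : (h : Matrix (Fin (N + 1)) (Fin (N + 1)) ℤ_[p]) *
          ((h⁻¹ : GL (Fin (N + 1)) ℤ_[p]) : Matrix (Fin (N + 1)) (Fin (N + 1)) ℤ_[p]) = 1 :=
        h.mul_inv
      have e2 := congrArg (fun A => A.map (PadicInt.Coe.ringHom (p := p))) e
      simp only [Matrix.map_mul] at e2
      rw [Matrix.map_one _ (map_zero _) (map_one _)] at e2
      exact e2
  · intro hg
    let A : Matrix (Fin (N + 1)) (Fin (N + 1)) ℤ_[p] := Matrix.of fun i j => ⟨g i j, hg.1 i j⟩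
    let B : Matrix (Fin (N + 1)) (Fin (N + 1)) ℤ_[p] := Matrix.of fun i j => ⟨g⁻¹ i j, hg.2 i j⟩
    have hinj : Function.Injective (PadicInt.Coe.ringHom (p := p)) := Subtype.val_injective
    have hA : A.map (PadicInt.Coe.ringHom (p := p)) = g := rfl
    have hB : B.map (PadicInt.Coe.ringHom (p := p)) = g⁻¹ := rfl
    have e : A * B = 1 := by
      apply Matrix.map_injective hinj
      change (A * B).map (PadicInt.Coe.ringHom (p := p)) = (1 : Matrix _ _ _).map _
      rw [Matrix.map_mul, hA, hB, hg.mul_inv, Matrix.map_one _ (map_zero _) (map_one _)]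
    have e' : B * A = 1 := mul_eq_one_comm.mp e
    exact ⟨⟨A, B, e, e'⟩, rfl⟩

/-- The determinant is already 1 over ℤ_p, so the inverse is formed there. -/
theorem IsIntUnit.of_mem_U {u : Mat p N} (hu : u ∈ U p N) (hi : u ∈ Integral p N) :
    IsIntUnit u := by
  rw [← mem_GLZp_iff]
  let A : Matrix (Fin (N + 1)) (Fin (N + 1)) ℤ_[p] := Matrix.of fun i j => ⟨u i j, hi i j⟩
  have hA : A.map (PadicInt.Coe.ringHom (p := p)) = u := rfl
  have hinj : Function.Injective (PadicInt.Coe.ringHom (p := p)) := Subtype.val_injective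
  have hd : A.det = 1 := by
    apply hinj
    rw [RingHom.map_det, map_one]
    exact det_of_mem_U hu
  exact ⟨Matrix.nonsingInvUnit A (by rw [hd]; exact isUnit_one), rfl⟩

/-- The diagonal entries of an upper triangular matrix and of its inverse multiply to 1, and here
both have norm at most 1. -/
theorem IsIntUnit.of_upper {g : Mat p N} (hg : IsIntUnit g) (hu : ∀ i j, j < i → g i j = 0)
    (i : Fin (N + 1)) : ‖g i i‖ = 1 := by
  have h2 : ∀ i j, j < i → g⁻¹ i j = 0 := fun i j h => inv_apply_of_lt hg.isUnit_det hu h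
  have h := mul_apply_diag hu h2 i
  rw [hg.mul_inv, Matrix.one_apply_eq] at h
  have h3 : ‖g i i‖ * ‖g⁻¹ i i‖ = 1 := by rw [← norm_mul, ← h, norm_one]
  have h4 := hg.1 i i
  have h5 := hg.2 i i
  nlinarith [norm_nonneg (g i i), norm_nonneg (g⁻¹ i i)]

end Unipotent

/-! ### The Bruhat decomposition is unique -/

section Uniqueness

variable {p : ℕ} [Fact p.Prime] {N : ℕ}

theorem isUnit_det_diagonal {t : Fin (N + 1) → ℚ_[p]} (ht : ∀ i, t i ≠ 0) :
    IsUnit (Matrix.diagonal t).det := by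
  rw [Matrix.det_diagonal, isUnit_iff_ne_zero]
  exact Finset.prod_ne_zero_iff.mpr fun i _ => ht i

/-- Lower and upper triangular matrices meet only in the torus: one side vanishes above the
diagonal, the other below it. -/
theorem eq_one_of_diagonal_conj {t t' : Fin (N + 1) → ℚ_[p]} {A B : Mat p N}
    (hA : A ∈ UOpp p N) (hB : B ∈ U p N) (ht : ∀ i, t i ≠ 0)
    (h : Matrix.diagonal t * A = B * Matrix.diagonal t') : t = t' ∧ A = 1 ∧ B = 1 := by
  have e : ∀ i j, t i * A i j = B i j * t' j := by
    intro i j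
    have := congrFun (congrFun h i) j
    rwa [Matrix.diagonal_mul, Matrix.mul_diagonal] at this
  have htt : t = t' := by
    funext i
    have := e i i
    rwa [hA.1, hB.1, mul_one, one_mul] at this
  subst htt
  refine ⟨rfl, ?_, ?_⟩
  · ext i j
    rcases lt_trichotomy i j with h | h | h
    · rw [hA.2 i j h, Matrix.one_apply_ne h.ne]
    · subst h; rw [hA.1, Matrix.one_apply_eq]
    · have := e i j
      rw [hB.2 i j h, zero_mul] at this
      rw [Matrix.one_apply_ne h.ne']
      exact (mul_eq_zero.mp this).resolve_left (ht i)
  · ext i j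
    rcases lt_trichotomy i j with h | h | h
    · have := e i j
      rw [hA.2 i j h, mul_zero] at this
      rw [Matrix.one_apply_ne h.ne]
      exact (mul_eq_zero.mp this.symm).resolve_right (ht j)
    · subst h; rw [hB.1, Matrix.one_apply_eq]
    · rw [hB.2 i j h, Matrix.one_apply_ne h.ne']

theorem one_mem_Uw {bs : List ℕ} (hw : IsUnit (weyl p N bs).det) : (1 : Mat p N) ∈ Uw p N bs := by
  refine ⟨one_mem_U, ?_⟩
  rw [Matrix.mul_one, Matrix.mul_nonsing_inv _ hw]
  exact one_mem_UOpp

theorem mul_mem_Uw {bs : List ℕ} (hw : IsUnit (weyl p N bs).det) {u v : Mat p N}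
    (hu : u ∈ Uw p N bs) (hv : v ∈ Uw p N bs) : u * v ∈ Uw p N bs := by
  refine ⟨mul_mem_U hu.1 hv.1, ?_⟩
  have := mul_mem_UOpp hu.2 hv.2
  rw [Matrix.mul_assoc, ← Matrix.mul_assoc (weyl p N bs)⁻¹, ← Matrix.mul_assoc (weyl p N bs)⁻¹,
    Matrix.nonsing_inv_mul _ hw, Matrix.one_mul, ← Matrix.mul_assoc, ] at this
  rwa [← Matrix.mul_assoc]

theorem inv_mem_Uw {bs : List ℕ} (hw : IsUnit (weyl p N bs).det) {u : Mat p N}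
    (hu : u ∈ Uw p N bs) : u⁻¹ ∈ Uw p N bs := by
  refine ⟨inv_mem_U hu.1, ?_⟩
  have := inv_mem_UOpp hu.2
  rwa [Matrix.mul_inv_rev, Matrix.mul_inv_rev, Matrix.nonsing_inv_nonsing_inv _ hw,
    ← Matrix.mul_assoc] at this

/-- Restricting the right factor to U_w makes the decomposition unique. Hence formulas need only be
verified for one convenient decomposition. -/
theorem bruhat_unique {bs : List ℕ} (hw : IsUnit (weyl p N bs).det)
    {L L' R R' : Mat p N} {t t' : Fin (N + 1) → ℚ_[p]}
    (hL : L ∈ U p N) (hL' : L' ∈ U p N) (hR : R ∈ Uw p N bs) (hR' : R' ∈ Uw p N bs)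
    (ht : ∀ i, t i ≠ 0)
    (h : L * (Matrix.diagonal t * weyl p N bs) * R =
      L' * (Matrix.diagonal t' * weyl p N bs) * R') :
    L = L' ∧ t = t' ∧ R = R' := by
  have hA := (mul_mem_Uw hw hR (inv_mem_Uw hw hR')).2
  have hB := mul_mem_U (inv_mem_U hL) hL'
  -- Conjugation by w makes the quotient of the right factors lower unipotent, while the quotient of
  -- the left factors is upper unipotent.
  have key : Matrix.diagonal t * (weyl p N bs * (R * R'⁻¹) * (weyl p N bs)⁻¹) =
      (L⁻¹ * L') * Matrix.diagonal t' := by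
    have h1 : L⁻¹ * (L * (Matrix.diagonal t * weyl p N bs) * R) * (R'⁻¹ * (weyl p N bs)⁻¹) =
      L⁻¹ * (L' * (Matrix.diagonal t' * weyl p N bs) * R') * (R'⁻¹ * (weyl p N bs)⁻¹) := by rw [h]
    have h2 : L⁻¹ * (L * (Matrix.diagonal t * weyl p N bs) * R) * (R'⁻¹ * (weyl p N bs)⁻¹)
        = (L⁻¹ * L) * (Matrix.diagonal t * (weyl p N bs * (R * R'⁻¹) * (weyl p N bs)⁻¹)) := by
      simp only [Matrix.mul_assoc]
    have h3 : L⁻¹ * (L' * (Matrix.diagonal t' * weyl p N bs) * R') * (R'⁻¹ * (weyl p N bs)⁻¹)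
        = L⁻¹ * L' * Matrix.diagonal t' * (weyl p N bs * ((R' * R'⁻¹) * (weyl p N bs)⁻¹)) := by
      simp only [Matrix.mul_assoc]
    rw [h2, h3, inv_mul_cancel_of_mem_U hL, mul_inv_cancel_of_mem_U hR'.1, Matrix.one_mul,
      Matrix.one_mul, Matrix.mul_nonsing_inv _ hw, Matrix.mul_one] at h1
    exact h1
  obtain ⟨h1, h2, h3⟩ := eq_one_of_diagonal_conj hA hB ht key
  refine ⟨?_, h1, ?_⟩
  · have : L * (L⁻¹ * L') = L := by rw [h3, Matrix.mul_one]
    rwa [← Matrix.mul_assoc, mul_inv_cancel_of_mem_U hL, Matrix.one_mul, eq_comm] at this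
  · have h4 : R * R'⁻¹ = 1 := by
      have : (weyl p N bs)⁻¹ * (weyl p N bs * (R * R'⁻¹) * (weyl p N bs)⁻¹) * weyl p N bs = 1 := by
        rw [h2, Matrix.mul_one, Matrix.nonsing_inv_mul _ hw]
      rwa [Matrix.mul_assoc (weyl p N bs), ← Matrix.mul_assoc _ (weyl p N bs),
        Matrix.nonsing_inv_mul _ hw, Matrix.one_mul, Matrix.mul_assoc,
        Matrix.nonsing_inv_mul _ hw, Matrix.mul_one] at this
    have : R * R'⁻¹ * R' = R' := by rw [h4, Matrix.one_mul]
    rwa [Matrix.mul_assoc, inv_mul_cancel_of_mem_U hR'.1, Matrix.mul_one] at this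

end Uniqueness

/-! ### Admissible Weyl elements as signed permutations -/

section Weyl

/-- The row (from `0`) of the nonzero entry in column `y` of an admissible Weyl element. -/
def wcol : List ℕ → ℕ → ℕ
  | [], y => y
  | k :: bs, y => if y < bs.sum then k + wcol bs y else y - bs.sum

/-- The sign of the nonzero entry in column `y` of an admissible Weyl element. -/
def wsgn : List ℕ → ℕ → ℤ
  | [], _ => 1
  | _ :: bs, y => if y < bs.sum then wsgn bs y else (-1) ^ bs.sum

theorem wcol_lt : ∀ (bs : List ℕ) (y : ℕ), y < bs.sum → wcol bs y < bs.sum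
  | [], y, h => by simp at h
  | k :: bs, y, h => by
      have := wcol_lt bs y
      simp only [wcol, List.sum_cons] at *
      split_ifs with h1
      · have := this h1; omega
      · omega

theorem wcol_inj : ∀ (bs : List ℕ) (y z : ℕ), y < bs.sum → z < bs.sum →
    wcol bs y = wcol bs z → y = z
  | [], y, z, h, _, _ => by simp at h
  | k :: bs, y, z, hy, hz, e => by
      have h1 := wcol_inj bs y z
      simp only [wcol, List.sum_cons] at *
      split_ifs at e with h2 h3 h3
      · exact h1 h2 h3 (by omega)
      · have := wcol_lt bs y h2; omega
      · have := wcol_lt bs z h3; omega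
      · omega

theorem weylEntry_eq : ∀ (bs : List ℕ) (i y : ℕ), y < bs.sum →
    weylEntry bs i y = if i = wcol bs y then wsgn bs y else 0
  | [], i, y, h => by simp at h
  | k :: bs, i, y, h => by
      have ih := weylEntry_eq bs (i - k) y
      simp only [weylEntry, wcol, wsgn, List.sum_cons] at *
      by_cases h1 : y < bs.sum
      · rw [ih h1]
        have := wcol_lt bs y h1
        simp only [h1, if_true]
        by_cases hi : i < k
        · rw [if_pos hi, if_neg (by omega), if_neg (by omega)]
        · rw [if_neg hi]
          congr 1
          exact propext ⟨fun h => by omega, fun h => by omega⟩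
      · simp only [h1, if_false]
        by_cases hi : i < k
        · rw [if_pos hi]
          congr 1
          exact propext ⟨fun h => by omega, fun h => by omega⟩
        · rw [if_neg hi, if_neg (by omega)]
          -- Column y belongs to the top block, so it lies to the right of every column occupied by
          -- the lower blocks.
          clear ih h
          induction bs generalizing i k with
          | nil => rfl
          | cons k' bs ih =>
            simp only [weylEntry]
            simp only [List.sum_cons] at h1
            split_ifs with h3 h4
            · omega
            · rfl
            · exact ih k' (i - k) (by omega) h3

theorem wsgn_sq : ∀ (bs : List ℕ) (y : ℕ), wsgn bs y * wsgn bs y = 1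
  | [], y => by simp [wsgn]
  | k :: bs, y => by
      simp only [wsgn]
      split_ifs
      · exact wsgn_sq bs y
      · rw [← mul_pow]; norm_num

variable {p : ℕ} [Fact p.Prime] {N : ℕ}

theorem weyl_apply {bs : List ℕ} (hs : bs.sum = N + 1) (x y : Fin (N + 1)) :
    weyl p N bs x y = if (x : ℕ) = wcol bs y then (wsgn bs y : ℚ_[p]) else 0 := by
  simp only [weyl, Matrix.of_apply]
  rw [weylEntry_eq bs x y (by rw [hs]; exact y.2)]
  split_ifs <;> simp

/-- The row of the nonzero entry in a column of an admissible Weyl element. -/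
def wfin {bs : List ℕ} (hs : bs.sum = N + 1) (y : Fin (N + 1)) : Fin (N + 1) :=
  ⟨wcol bs y, (wcol_lt bs y (by rw [hs]; exact y.2)).trans_eq hs⟩

theorem wfin_injective {bs : List ℕ} (hs : bs.sum = N + 1) : Function.Injective (wfin hs) := by
  intro y z h
  exact Fin.ext (wcol_inj bs y z (by rw [hs]; exact y.2) (by rw [hs]; exact z.2)
    (congrArg Fin.val h))

theorem wfin_bijective {bs : List ℕ} (hs : bs.sum = N + 1) : Function.Bijective (wfin hs) :=
  (Finite.injective_iff_bijective).mp (wfin_injective hs)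

/-- Rows are always written as images of columns under w, which avoids the inverse permutation in
all products with w. -/
theorem weyl_apply_wfin {bs : List ℕ} (hs : bs.sum = N + 1) (x y : Fin (N + 1)) :
    weyl p N bs (wfin hs x) y = if x = y then (wsgn bs y : ℚ_[p]) else 0 := by
  rw [weyl_apply hs]
  congr 1
  refine propext ⟨fun h => wfin_injective hs (Fin.ext h), fun h => by rw [h]; rfl⟩

theorem weyl_mul_apply {bs : List ℕ} (hs : bs.sum = N + 1) (A : Mat p N) (x y : Fin (N + 1)) :
    (weyl p N bs * A) (wfin hs x) y = (wsgn bs x : ℚ_[p]) * A x y := by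
  rw [Matrix.mul_apply, Finset.sum_eq_single x]
  · rw [weyl_apply_wfin, if_pos rfl]
  · intro l _ hl
    rw [weyl_apply_wfin, if_neg (Ne.symm hl), zero_mul]
  · intro h; exact absurd (Finset.mem_univ _) h

theorem mul_weyl_transpose_apply {bs : List ℕ} (hs : bs.sum = N + 1) (A : Mat p N)
    (x y : Fin (N + 1)) :
    (A * (weyl p N bs).transpose) x (wfin hs y) = A x y * (wsgn bs y : ℚ_[p]) := by
  rw [Matrix.mul_apply, Finset.sum_eq_single y]
  · rw [Matrix.transpose_apply, weyl_apply_wfin, if_pos rfl]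
  · intro l _ hl
    rw [Matrix.transpose_apply, weyl_apply_wfin, if_neg (Ne.symm hl), mul_zero]
  · intro h; exact absurd (Finset.mem_univ _) h

theorem wsgn_sq_cast (bs : List ℕ) (y : ℕ) :
    (wsgn bs y : ℚ_[p]) * (wsgn bs y : ℚ_[p]) = 1 := by
  rw [← Int.cast_mul, wsgn_sq, Int.cast_one]

theorem weyl_mul_transpose {bs : List ℕ} (hs : bs.sum = N + 1) :
    weyl p N bs * (weyl p N bs).transpose = 1 := by
  ext x y
  obtain ⟨x, rfl⟩ := (wfin_bijective hs).2 x
  obtain ⟨y, rfl⟩ := (wfin_bijective hs).2 y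
  rw [weyl_mul_apply, Matrix.transpose_apply, weyl_apply_wfin, Matrix.one_apply]
  by_cases h : x = y
  · subst h
    rw [if_pos rfl, if_pos rfl, wsgn_sq_cast]
  · rw [if_neg (Ne.symm h), if_neg (fun e => h (wfin_injective hs e)), mul_zero]

theorem isUnit_det_weyl {bs : List ℕ} (hs : bs.sum = N + 1) : IsUnit (weyl p N bs).det :=
  Matrix.isUnit_det_of_right_inverse (weyl_mul_transpose hs)

theorem weyl_inv {bs : List ℕ} (hs : bs.sum = N + 1) :
    (weyl p N bs)⁻¹ = (weyl p N bs).transpose :=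
  Matrix.inv_eq_right_inv (weyl_mul_transpose hs)

theorem weyl_conj_apply {bs : List ℕ} (hs : bs.sum = N + 1) (A : Mat p N) (x y : Fin (N + 1)) :
    (weyl p N bs * A * (weyl p N bs)⁻¹) (wfin hs x) (wfin hs y) =
      (wsgn bs x : ℚ_[p]) * A x y * (wsgn bs y : ℚ_[p]) := by
  rw [weyl_inv hs, mul_weyl_transpose_apply, weyl_mul_apply]

theorem wsgn_ne_zero (bs : List ℕ) (y : ℕ) : (wsgn bs y : ℚ_[p]) ≠ 0 := fun h => by
  have := wsgn_sq_cast (p := p) bs y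
  rw [h, mul_zero] at this
  exact zero_ne_one this

/-- Conjugation by w permutes the entries up to sign, so lower triangularity of the conjugate means
vanishing at the pairs whose order w preserves. -/
theorem mem_Uw_iff {bs : List ℕ} (hs : bs.sum = N + 1) {u : Mat p N} :
    u ∈ Uw p N bs ↔ u ∈ U p N ∧
      ∀ i j : Fin (N + 1), i < j → wcol bs i < wcol bs j → u i j = 0 := by
  constructor
  · rintro ⟨h1, h2⟩
    refine ⟨h1, fun i j hij hw => ?_⟩
    have := h2.2 (wfin hs i) (wfin hs j) hw
    rw [weyl_conj_apply] at this
    exact (mul_eq_zero.mp ((mul_eq_zero.mp this).resolve_right (wsgn_ne_zero _ _))).resolve_left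
      (wsgn_ne_zero _ _)
  · rintro ⟨h1, h2⟩
    refine ⟨h1, fun x => ?_, fun x y hxy => ?_⟩
    · obtain ⟨x, rfl⟩ := (wfin_bijective hs).2 x
      rw [weyl_conj_apply, h1.1, mul_one, wsgn_sq_cast]
    · obtain ⟨x, rfl⟩ := (wfin_bijective hs).2 x
      obtain ⟨y, rfl⟩ := (wfin_bijective hs).2 y
      rw [weyl_conj_apply]
      rcases lt_trichotomy x y with h | h | h
      · rw [h2 x y h hxy, mul_zero, zero_mul]
      · subst h; exact absurd hxy (lt_irrefl _)
      · rw [h1.2 x y h, mul_zero, zero_mul]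

theorem isUnit_det_cell {bs : List ℕ} (hs : bs.sum = N + 1) {t : Fin (N + 1) → ℚ_[p]}
    (ht : ∀ i, t i ≠ 0) : IsUnit (Matrix.diagonal t * weyl p N bs).det := by
  rw [Matrix.det_mul]; exact (isUnit_det_diagonal ht).mul (isUnit_det_weyl hs)

theorem diagonal_inv {t : Fin (N + 1) → ℚ_[p]} (ht : ∀ i, t i ≠ 0) :
    (Matrix.diagonal t)⁻¹ = Matrix.diagonal (fun i => (t i)⁻¹) := by
  apply Matrix.inv_eq_right_inv
  rw [Matrix.diagonal_mul_diagonal, ← Matrix.diagonal_one]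
  congr 1; funext i; exact mul_inv_cancel₀ (ht i)

theorem cell_conj_apply {bs : List ℕ} (hs : bs.sum = N + 1) {t : Fin (N + 1) → ℚ_[p]}
    (ht : ∀ i, t i ≠ 0) (A : Mat p N) (x y : Fin (N + 1)) :
    ((Matrix.diagonal t * weyl p N bs) * A * (Matrix.diagonal t * weyl p N bs)⁻¹)
        (wfin hs x) (wfin hs y) =
      t (wfin hs x) * ((wsgn bs x : ℚ_[p]) * A x y * (wsgn bs y : ℚ_[p])) *
        (t (wfin hs y))⁻¹ := by
  have : (Matrix.diagonal t * weyl p N bs) * A * (Matrix.diagonal t * weyl p N bs)⁻¹ =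
      Matrix.diagonal t * (weyl p N bs * A * (weyl p N bs)⁻¹) *
        Matrix.diagonal (fun i => (t i)⁻¹) := by
    rw [Matrix.mul_inv_rev, diagonal_inv ht]
    simp only [Matrix.mul_assoc]
  rw [this, Matrix.mul_diagonal, Matrix.diagonal_mul, weyl_conj_apply]

/-- The device for moving a unipotent factor from the right of a central factor to its left, where
it is absorbed by the left factor. -/
theorem cell_conj_mem_U {bs : List ℕ} (hs : bs.sum = N + 1) {t : Fin (N + 1) → ℚ_[p]}
    (ht : ∀ i, t i ≠ 0) {A : Mat p N} (hA : A ∈ U p N)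
    (h : ∀ i j : Fin (N + 1), i < j → wcol bs j < wcol bs i → A i j = 0) :
    (Matrix.diagonal t * weyl p N bs) * A * (Matrix.diagonal t * weyl p N bs)⁻¹ ∈ U p N := by
  refine ⟨fun x => ?_, fun x y hxy => ?_⟩
  · obtain ⟨x, rfl⟩ := (wfin_bijective hs).2 x
    rw [cell_conj_apply hs ht, hA.1, mul_one, wsgn_sq_cast, mul_one, mul_inv_cancel₀ (ht _)]
  · obtain ⟨x, rfl⟩ := (wfin_bijective hs).2 x
    obtain ⟨y, rfl⟩ := (wfin_bijective hs).2 y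
    rw [cell_conj_apply hs ht]
    have : A x y = 0 := by
      rcases lt_trichotomy x y with h' | h' | h'
      · exact h x y h' hxy
      · subst h'; exact absurd hxy (lt_irrefl _)
      · exact hA.2 x y h'
    rw [this]; simp

/-- The block (counted from the right) of a column of an admissible Weyl element. -/
def wblk : List ℕ → ℕ → ℕ
  | [], _ => 0
  | _ :: bs, y => if y < bs.sum then wblk bs y + 1 else 0

/-- An admissible w preserves order inside a block and reverses it between blocks. So U ∩ w⁻¹Uw
consists of the block diagonal elements of U, and elements of U_w have trivial diagonal blocks. -/
theorem wblk_eq_iff : ∀ (bs : List ℕ) (i j : ℕ), i < j → j < bs.sum →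
    (wblk bs i = wblk bs j ↔ wcol bs i < wcol bs j)
  | [], i, j, _, h => by simp at h
  | k :: bs, i, j, hij, hj => by
      have ih := wblk_eq_iff bs i j hij
      simp only [wblk, wcol, List.sum_cons] at *
      split_ifs with h1 h2 h2
      · rw [Nat.add_right_cancel_iff, ih h2]; omega
      · simp only [false_iff]; omega
      · omega
      · simp only [true_iff]; omega

/-- Every `u ∈ U` factors as `u = u₊ u₋` with `w u₊ w⁻¹` upper triangular and `u₋ ∈ U_w`. -/
theorem exists_factor_Uw {bs : List ℕ} (hs : bs.sum = N + 1) {u : Mat p N} (hu : u ∈ U p N) :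
    ∃ A R : Mat p N, u = A * R ∧ A ∈ U p N ∧ R ∈ Uw p N bs ∧
      ∀ i j : Fin (N + 1), i < j → wcol bs j < wcol bs i → A i j = 0 := by
  classical
  -- The first factor is the block diagonal part of u.
  let A : Mat p N := Matrix.of fun i j =>
    if wblk bs (i : ℕ) = wblk bs (j : ℕ) then u i j else 0
  have hA : A ∈ U p N := by
    refine ⟨fun i => ?_, fun i j h => ?_⟩
    · simp [A, hu.1]
    · simp [A, hu.2 i j h]
  have hA0 : ∀ i j : Fin (N + 1), wblk bs i ≠ wblk bs j → A i j = 0 := by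
    intro i j h; simp [A, h]
  have := A.invertibleOfIsUnitDet (isUnit_det_of_mem_U hA)
  -- Block diagonal means block triangular for both orders of the blocks, and each of these
  -- properties passes to the inverse.
  have hB0 : ∀ i j : Fin (N + 1), wblk bs i ≠ wblk bs j → A⁻¹ i j = 0 := by
    intro i j h
    rcases lt_or_gt_of_ne h with h | h
    · have : A.BlockTriangular (fun i : Fin (N + 1) => OrderDual.toDual (wblk bs i)) :=
        fun i j h => hA0 i j (ne_of_lt h)
      exact Matrix.blockTriangular_inv_of_blockTriangular this h
    · have : A.BlockTriangular (fun i : Fin (N + 1) => wblk bs i) :=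
        fun i j h => hA0 i j (ne_of_gt h)
      exact Matrix.blockTriangular_inv_of_blockTriangular this h
  refine ⟨A, A⁻¹ * u, ?_, hA, (mem_Uw_iff hs).2 ⟨mul_mem_U (inv_mem_U hA) hu, ?_⟩, ?_⟩
  · rw [← Matrix.mul_assoc, mul_inv_cancel_of_mem_U hA, Matrix.one_mul]
  · intro i j hij hw
    have hb := (wblk_eq_iff bs i j hij (by rw [hs]; exact j.2)).2 hw
    -- Row i of the inverse only meets indices of its own block, and for columns of that block A and
    -- u agree.
    have : (A⁻¹ * u) i j = (A⁻¹ * A) i j := by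
      rw [Matrix.mul_apply, Matrix.mul_apply]
      refine Finset.sum_congr rfl fun l _ => ?_
      by_cases h : wblk bs (i : ℕ) = wblk bs (l : ℕ)
      · congr 1
        simp only [A, Matrix.of_apply]
        rw [if_pos (h.symm.trans hb)]
      · rw [hB0 i l h, zero_mul, zero_mul]
    rw [this, inv_mul_cancel_of_mem_U hA, Matrix.one_apply_ne hij.ne]
  · intro i j hij hw
    apply hA0
    intro h
    have := (wblk_eq_iff bs i j hij (by rw [hs]; exact j.2)).1 h
    omega

end Weyl

/-! ### The embeddings of `2 × 2` matrices -/

section Phi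

variable {p : ℕ} [Fact p.Prime] {N : ℕ}

theorem sum_two {x y : Fin (N + 1)} (hxy : x ≠ y) (f : Fin (N + 1) → ℚ_[p])
    (h : ∀ l, l ≠ x → l ≠ y → f l = 0) : ∑ l, f l = f x + f y := by
  rw [← Finset.sum_pair hxy]
  symm
  apply Finset.sum_subset (Finset.subset_univ _)
  intro l _ hl
  simp only [Finset.mem_insert, Finset.mem_singleton, not_or] at hl
  exact h l hl.1 hl.2

/-- Left multiplication by `φ_{α_i}(A)`. -/
theorem phi_mul_apply {i : ℕ} (h1 : 1 ≤ i) (h2 : i ≤ N) (A : Matrix (Fin 2) (Fin 2) ℚ_[p])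
    (M : Mat p N) (r s : Fin (N + 1)) :
    (phi N i A * M) r s =
      if (r : ℕ) + 1 = i then
        A 0 0 * M ⟨i - 1, by omega⟩ s + A 0 1 * M ⟨i, by omega⟩ s
      else if (r : ℕ) = i then
        A 1 0 * M ⟨i - 1, by omega⟩ s + A 1 1 * M ⟨i, by omega⟩ s
      else M r s := by
  rw [Matrix.mul_apply]
  have hne : (⟨i - 1, by omega⟩ : Fin (N + 1)) ≠ ⟨i, by omega⟩ := by
    intro h; have := congrArg Fin.val h; simp at this; omega
  split_ifs with ha hb
  · rw [sum_two hne]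
    · congr 1
      · simp only [phi, Matrix.of_apply]
        rw [if_pos ⟨ha, by omega⟩]
      · simp only [phi, Matrix.of_apply]
        rw [if_neg (by simp), if_pos ⟨ha, trivial⟩]
    · intro l hl hl'
      have e1 : ¬ (l : ℕ) + 1 = i := fun e => hl (Fin.ext (by simp; omega))
      have e2 : ¬ (l : ℕ) = i := fun e => hl' (Fin.ext e)
      have e3 : ¬ r = l := fun e => e1 (by rw [← e]; exact ha)
      simp only [phi, Matrix.of_apply, e1, e2, e3, and_false, if_false, zero_mul]
  · rw [sum_two hne]
    · congr 1
      · simp only [phi, Matrix.of_apply]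
        rw [if_neg (by simp [ha]), if_neg (by simp [ha]), if_pos ⟨hb, by omega⟩]
      · simp only [phi, Matrix.of_apply]
        rw [if_neg (by simp), if_neg (by simp [ha]), if_neg (by simp), if_pos ⟨hb, trivial⟩]
    · intro l hl hl'
      have e1 : ¬ (l : ℕ) + 1 = i := fun e => hl (Fin.ext (by simp; omega))
      have e2 : ¬ (l : ℕ) = i := fun e => hl' (Fin.ext e)
      have e3 : ¬ r = l := fun e => e2 (by rw [← e]; exact hb)
      simp only [phi, Matrix.of_apply, e1, e2, e3, and_false, if_false, zero_mul]
  · rw [Finset.sum_eq_single r]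
    · simp [phi, ha, hb]
    · intro l _ hl
      simp [phi, ha, hb, Ne.symm hl]
    · intro h; exact absurd (Finset.mem_univ _) h

theorem phi_transpose (i : ℕ) (A : Matrix (Fin 2) (Fin 2) ℚ_[p]) :
    (phi N i A).transpose = phi N i A.transpose := by
  ext r s
  simp only [phi, Matrix.of_apply, Matrix.transpose_apply]
  by_cases h1 : (r : ℕ) + 1 = i <;> by_cases h2 : (s : ℕ) + 1 = i <;>
    by_cases h3 : (r : ℕ) = i <;> by_cases h4 : (s : ℕ) = i <;>
    simp [h1, h2, h3, h4, eq_comm]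

theorem mul_phi_apply {i : ℕ} (h1 : 1 ≤ i) (h2 : i ≤ N) (A : Matrix (Fin 2) (Fin 2) ℚ_[p])
    (M : Mat p N) (r s : Fin (N + 1)) :
    (M * phi N i A) r s =
      if (s : ℕ) + 1 = i then
        M r ⟨i - 1, by omega⟩ * A 0 0 + M r ⟨i, by omega⟩ * A 1 0
      else if (s : ℕ) = i then
        M r ⟨i - 1, by omega⟩ * A 0 1 + M r ⟨i, by omega⟩ * A 1 1
      else M r s := by
  have := phi_mul_apply h1 h2 A.transpose M.transpose s r
  rw [← phi_transpose, ← Matrix.transpose_mul, Matrix.transpose_apply] at this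
  rw [this]
  simp only [Matrix.transpose_apply, mul_comm]

theorem phi_mul_phi {i : ℕ} (h1 : 1 ≤ i) (h2 : i ≤ N) (A B : Matrix (Fin 2) (Fin 2) ℚ_[p]) :
    phi N i A * phi N i B = phi N i (A * B) := by
  ext r s
  rw [phi_mul_apply h1 h2]
  simp only [phi, Matrix.of_apply, Matrix.mul_apply, Fin.sum_univ_two]
  have e1 : i - 1 + 1 = i := by omega
  have e2 : i - 1 ≠ i := by omega
  have e3 : i + 1 ≠ i := by omega
  by_cases ha : (r : ℕ) + 1 = i
  · have hr : (r : ℕ) ≠ i := by omega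
    by_cases hb : (s : ℕ) + 1 = i
    · simp [ha, hb, e1]
    · by_cases hc : (s : ℕ) = i
      · simp [ha, hc, e1]
      · have h5 : (⟨i - 1, by omega⟩ : Fin (N + 1)) ≠ s := fun h => by
          have := congrArg Fin.val h; simp at this; omega
        have h6 : (⟨i, by omega⟩ : Fin (N + 1)) ≠ s := fun h => hc (congrArg Fin.val h).symm
        have h7 : r ≠ s := fun h => hb (by rw [← h]; exact ha)
        simp [ha, hr, hb, hc, e1, e2, h5, h6, h7]
  · by_cases ha' : (r : ℕ) = i
    · by_cases hb : (s : ℕ) + 1 = i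
      · have : (s : ℕ) ≠ i := by omega
        simp [ha', hb, e1]
      · by_cases hc : (s : ℕ) = i
        · simp [ha', hc, e1]
        · have h5 : (⟨i - 1, by omega⟩ : Fin (N + 1)) ≠ s := fun h => by
            have := congrArg Fin.val h; simp at this; omega
          have h6 : (⟨i, by omega⟩ : Fin (N + 1)) ≠ s := fun h => hc (congrArg Fin.val h).symm
          have h7 : r ≠ s := fun h => hc (by rw [← h]; exact ha')
          simp [ha', hb, hc, e1, e2, h5, h6, h7]
    · simp [ha, ha']

theorem phi_one (i : ℕ) : phi N i (1 : Matrix (Fin 2) (Fin 2) ℚ_[p]) = 1 := by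
  ext r s
  simp only [phi, Matrix.of_apply, Matrix.one_apply, Fin.ext_iff]
  by_cases h1 : (r : ℕ) + 1 = i <;> by_cases h2 : (s : ℕ) + 1 = i <;>
    by_cases h3 : (r : ℕ) = i <;> by_cases h4 : (s : ℕ) = i <;>
    simp [h1, h2, h3, h4] <;> omega

theorem phi_mem_Integral {i : ℕ} {A : Matrix (Fin 2) (Fin 2) ℚ_[p]}
    (hA : ∀ x y, ‖A x y‖ ≤ 1) : phi N i A ∈ Integral p N := by
  intro r s
  simp only [phi, Matrix.of_apply]
  split_ifs <;> first | exact hA _ _ | simp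

theorem phi_commute {i j : ℕ} (hi : 1 ≤ i) (hi' : i ≤ N) (hj : 1 ≤ j) (hj' : j ≤ N)
    (hij : i + 2 ≤ j) (A B : Matrix (Fin 2) (Fin 2) ℚ_[p]) :
    phi N i A * phi N j B = phi N j B * phi N i A := by
  ext r s
  rw [phi_mul_apply hi hi', phi_mul_apply hj hj']
  simp only [phi, Matrix.of_apply]
  by_cases h1 : (r : ℕ) + 1 = i
  · simp [h1, Fin.ext_iff, show ¬ (i - 1 + 1 = j) by omega, show ¬ (i - 1 = j) by omega,
      show ¬ (i + 1 = j) by omega, show ¬ (i = j) by omega, show ¬ ((r : ℕ) = j) by omega]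
    by_cases h2 : (s : ℕ) + 1 = i
    · simp [h2, show i - 1 = (s : ℕ) by omega, show ¬ (i = (s : ℕ)) by omega]
    · by_cases h3 : (s : ℕ) = i
      · simp [h3, show ¬ (i - 1 = i) by omega]
      · simp [h2, h3, show ¬ (i - 1 = (s : ℕ)) by omega, show ¬ (i = (s : ℕ)) by omega,
          show ¬ ((r : ℕ) = (s : ℕ)) by omega]
  · by_cases h1' : (r : ℕ) = i
    · simp [h1', Fin.ext_iff, show ¬ (i - 1 + 1 = j) by omega, show ¬ (i - 1 = j) by omega,
        show ¬ (i + 1 = j) by omega, show ¬ (i = j) by omega]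
      by_cases h2 : (s : ℕ) + 1 = i
      · simp [h2, show i - 1 = (s : ℕ) by omega, show ¬ (i = (s : ℕ)) by omega]
      · by_cases h3 : (s : ℕ) = i
        · simp [h3, show ¬ (i - 1 = i) by omega]
        · simp [h2, h3, show ¬ (i - 1 = (s : ℕ)) by omega, show ¬ (i = (s : ℕ)) by omega]
    · by_cases h4 : (r : ℕ) + 1 = j
      · simp [h1', h4, Fin.ext_iff, show ¬ (j - 1 + 1 = i) by omega,
          show ¬ (j - 1 = i) by omega, show ¬ (j = i) by omega, show ¬ (j + 1 = i) by omega]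
        by_cases h2 : (s : ℕ) + 1 = j
        · simp [h2, show j - 1 = (s : ℕ) by omega, show ¬ (j = (s : ℕ)) by omega]
        · by_cases h3 : (s : ℕ) = j
          · simp [h3, show ¬ (j - 1 = j) by omega]
          · simp [h2, h3, show ¬ (j - 1 = (s : ℕ)) by omega, show ¬ (j = (s : ℕ)) by omega,
              show ¬ ((r : ℕ) = (s : ℕ)) by omega]
      · by_cases h5 : (r : ℕ) = j
        · simp [h5, Fin.ext_iff, show ¬ (j - 1 + 1 = i) by omega,
            show ¬ (j - 1 = i) by omega, show ¬ (j = i) by omega, show ¬ (j + 1 = i) by omega]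
          by_cases h2 : (s : ℕ) + 1 = j
          · simp [h2, show j - 1 = (s : ℕ) by omega, show ¬ (j = (s : ℕ)) by omega]
          · by_cases h3 : (s : ℕ) = j
            · simp [h3, show ¬ (j - 1 = j) by omega]
            · simp [h2, h3, show ¬ (j - 1 = (s : ℕ)) by omega, show ¬ (j = (s : ℕ)) by omega]
        · simp [h1, h1', h4, h5]

/-- Unipotent matrices stay unipotent if their middle block does. -/
theorem phi_mul_mul_phi_mem_U {i : ℕ} (h1 : 1 ≤ i) (h2 : i ≤ N)
    {A B : Matrix (Fin 2) (Fin 2) ℚ_[p]} {e : ℚ_[p]} {u : Mat p N} (hu : u ∈ U p N)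
    (h : A * !![1, u ⟨i - 1, by omega⟩ ⟨i, by omega⟩; 0, 1] * B = !![1, e; 0, 1]) :
    phi N i A * u * phi N i B ∈ U p N ∧
      (phi N i A * u * phi N i B) ⟨i - 1, by omega⟩ ⟨i, by omega⟩ = e := by
  have hd : u ⟨i - 1, by omega⟩ ⟨i - 1, by omega⟩ = 1 := hu.1 _
  have hd' : u ⟨i, by omega⟩ ⟨i, by omega⟩ = 1 := hu.1 _
  have hl : u ⟨i, by omega⟩ ⟨i - 1, by omega⟩ = 0 := hu.2 _ _ (by
    rw [Fin.lt_def]; simp; omega)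
  have h00 := congrFun (congrFun h 0) 0
  have h01 := congrFun (congrFun h 0) 1
  have h10 := congrFun (congrFun h 1) 0
  have h11 := congrFun (congrFun h 1) 1
  simp [Matrix.mul_apply, Fin.sum_univ_two] at h00 h01 h10 h11
  have e1 : i - 1 + 1 = i := by omega
  have e2 : ¬ (i - 1 = i) := by omega
  have e3 : ¬ (i + 1 = i) := by omega
  refine ⟨⟨fun r => ?_, fun r s hrs => ?_⟩, ?_⟩
  · rw [mul_phi_apply h1 h2]
    simp only [phi_mul_apply h1 h2]
    by_cases ha : (r : ℕ) + 1 = i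
    · have hr : (r : ℕ) ≠ i := by omega
      simp only [ha, if_true, hd, hd', hl]
      linear_combination h00
    · by_cases hb : (r : ℕ) = i
      · simp only [hb, if_true, if_false, e3, hd, hd', hl]
        linear_combination h11
      · simp only [ha, hb, if_false]
        exact hu.1 r
  · rw [Fin.lt_def] at hrs
    have hlow : ∀ r s : Fin (N + 1), (s : ℕ) < r → u r s = 0 := fun r s h => hu.2 r s h
    rw [mul_phi_apply h1 h2]
    simp only [phi_mul_apply h1 h2]
    by_cases ha : (r : ℕ) + 1 = i
    · have hs1 : ¬ (s : ℕ) + 1 = i := by omega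
      have hs2 : ¬ (s : ℕ) = i := by omega
      simp only [ha, hs1, hs2, if_true, if_false]
      rw [hlow _ s (by simp; omega), hlow _ s (by simp; omega)]; ring
    · by_cases hb : (r : ℕ) = i
      · by_cases hs1 : (s : ℕ) + 1 = i
        · simp only [hb, hs1, if_true, if_false, e3, hd, hd', hl]
          linear_combination h10
        · have hs2 : ¬ (s : ℕ) = i := by omega
          simp only [hb, hs1, hs2, if_true, if_false, e3]
          rw [hlow _ s (by simp; omega), hlow _ s (by simp; omega)]; ring
      · simp only [ha, hb, if_false]
        rw [hlow r s hrs]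
        split_ifs
        · rw [hlow r _ (by simp; omega), hlow r _ (by simp; omega)]; ring
        · rw [hlow r _ (by simp; omega), hlow r _ (by simp; omega)]; ring
        · rfl
  · rw [mul_phi_apply h1 h2]
    simp only [phi_mul_apply h1 h2]
    simp only [e1, e3, if_true, if_false, hd, hd', hl]
    linear_combination h01

end Phi

/-! ### The numbers `μ`, `c`, `d` -/

section Single

variable {p : ℕ} [Fact p.Prime]

theorem p_ne_zero : (p : ℚ_[p]) ≠ 0 := by
  exact_mod_cast (Fact.out : p.Prime).ne_zero

theorem norm_eq_zpow_neg_of_mu (a : ℚ_[p]) (h : ¬ ‖a‖ ≤ 1) : ‖a‖ = (p : ℝ) ^ (mu a : ℤ) := by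
  have ha : a ≠ 0 := by rintro rfl; simp at h
  have h1 := Padic.norm_eq_zpow_neg_valuation ha
  have h2 : 0 < -a.valuation := by
    by_contra hn
    apply h
    rw [h1]
    exact zpow_le_one_of_nonpos₀ (by exact_mod_cast (Fact.out : p.Prime).one_lt.le) (by omega)
  rw [h1, mu, if_neg h, Int.toNat_of_nonneg h2.le]

theorem mu_pos_of_not_le (a : ℚ_[p]) (h : ¬ ‖a‖ ≤ 1) : 0 < mu a := by
  have h1 := norm_eq_zpow_neg_of_mu a h
  rcases Nat.eq_zero_or_pos (mu a) with h0 | h0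
  · rw [h0] at h1; simp at h1; exact absurd h1.le h
  · exact h0

theorem mu_eq_zero_iff (a : ℚ_[p]) : mu a = 0 ↔ ‖a‖ ≤ 1 := by
  constructor
  · intro h
    by_contra hn
    have := mu_pos_of_not_le a hn
    omega
  · intro h; rw [mu, if_pos h]

theorem norm_p_pow (m : ℕ) : ‖(p : ℚ_[p]) ^ m‖ = (p : ℝ) ^ (-(m : ℤ)) := by
  rw [norm_pow, Padic.norm_p, inv_pow, zpow_neg, zpow_natCast]

theorem norm_cPart_of_not_le (a : ℚ_[p]) (h : ¬ ‖a‖ ≤ 1) : ‖cPart a‖ = 1 := by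
  rw [cPart, norm_mul, norm_p_pow, norm_eq_zpow_neg_of_mu a h, ← zpow_add₀]
  · simp
  · exact_mod_cast (Fact.out : p.Prime).ne_zero

theorem norm_cPart_le (a : ℚ_[p]) : ‖cPart a‖ ≤ 1 := by
  by_cases h : ‖a‖ ≤ 1
  · rw [cPart, (mu_eq_zero_iff a).2 h, pow_zero, mul_one]; exact h
  · exact (norm_cPart_of_not_le a h).le

theorem cPart_eq (a : ℚ_[p]) : cPart a = a * (p : ℚ_[p]) ^ mu a := rfl

theorem norm_dPart_le (a : ℚ_[p]) : ‖dPart a‖ ≤ 1 := by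
  rw [dPart]
  split_ifs with h
  · simp
  · rw [mu_eq_zero_iff] at h
    rw [norm_inv, norm_cPart_of_not_le a h, inv_one]

/-- The upper right entry of `b_α(a)`. -/
def epsPart (a : ℚ_[p]) : ℚ_[p] := if mu a = 0 then -1 else 0

/-- The `2 × 2` matrix of `b_α(a)`. -/
def bTwo (a : ℚ_[p]) : Matrix (Fin 2) (Fin 2) ℚ_[p] :=
  !![dPart a, epsPart a; (p : ℚ_[p]) ^ mu a, cPart a]

/-- The convention d = 0, together with ε = -1 for integral a and ε = 0 otherwise, merges the two
cases of the definition. From here on mostly the relations dc = 1 + ε and ε p^μ = ε are used. -/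
theorem bSimple_eq (N i : ℕ) (a : ℚ_[p]) : bSimple N i a = phi N i (bTwo a) := by
  rw [bSimple, bTwo]
  congr 1
  by_cases h : ‖a‖ ≤ 1
  · have h0 := (mu_eq_zero_iff a).2 h
    rw [if_pos h, dPart, epsPart, if_pos h0, if_pos h0, cPart, h0]
    simp
  · have h0 : ¬ mu a = 0 := fun e => h ((mu_eq_zero_iff a).1 e)
    rw [if_neg h, dPart, epsPart, if_neg h0, if_neg h0]

theorem dPart_mul_cPart (a : ℚ_[p]) : dPart a * cPart a = 1 + epsPart a := by
  rw [dPart, epsPart]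
  split_ifs with h
  · simp
  · rw [mu_eq_zero_iff] at h
    rw [inv_mul_cancel₀, add_zero]
    intro h0
    have := norm_cPart_of_not_le a h
    rw [h0] at this; simp at this

theorem epsPart_mul_pow (a : ℚ_[p]) : epsPart a * (p : ℚ_[p]) ^ mu a = epsPart a := by
  rw [epsPart]
  split_ifs with h
  · rw [h]; simp
  · simp

theorem norm_epsPart_le (a : ℚ_[p]) : ‖epsPart a‖ ≤ 1 := by
  rw [epsPart]; split_ifs <;> simp

theorem norm_p_pow_le (m : ℕ) : ‖(p : ℚ_[p]) ^ m‖ ≤ 1 := by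
  rw [norm_pow]
  exact pow_le_one₀ (norm_nonneg _) Padic.norm_p_lt_one.le

/-- The inverse of `bTwo a`. -/
def bTwoInv (a : ℚ_[p]) : Matrix (Fin 2) (Fin 2) ℚ_[p] :=
  !![cPart a, -epsPart a; -(p : ℚ_[p]) ^ mu a, dPart a]

theorem bTwo_mul_inv (a : ℚ_[p]) : bTwo a * bTwoInv a = 1 := by
  have h1 := dPart_mul_cPart a
  have h2 := epsPart_mul_pow a
  rw [bTwo, bTwoInv, Matrix.mul_fin_two, Matrix.one_fin_two]
  congr 1
  simp only [Matrix.vecCons_inj, and_true]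
  refine ⟨⟨?_, ?_⟩, ?_, ?_⟩
  · linear_combination h1 - h2
  · ring
  · ring
  · linear_combination h1 - h2

theorem isIntUnit_bSimple {N i : ℕ} (h1 : 1 ≤ i) (h2 : i ≤ N) (a : ℚ_[p]) :
    IsIntUnit (bSimple N i a) := by
  rw [bSimple_eq]
  refine IsIntUnit.of_mul_eq_one (h := phi N i (bTwoInv a)) (phi_mem_Integral ?_)
    (phi_mem_Integral ?_) ?_
  · intro x y
    fin_cases x <;> fin_cases y <;>
      simp [bTwo, norm_dPart_le, norm_epsPart_le, norm_cPart_le]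
    simpa using norm_p_pow_le (p := p) (mu a)
  · intro x y
    fin_cases x <;> fin_cases y <;>
      simp [bTwoInv, norm_dPart_le, norm_epsPart_le, norm_cPart_le]
    simpa using norm_p_pow_le (p := p) (mu a)
  · rw [phi_mul_phi h1 h2, bTwo_mul_inv, phi_one]

end Single

/-! ### Block matrices -/

section Blocks

variable {p : ℕ} [Fact p.Prime] {N n : ℕ}

/-- The splitting of the indices into the first `N - n` and the last `n + 1` ones. -/
def blockEquiv (h : n ≤ N) : Fin (N - n) ⊕ Fin (n + 1) ≃ Fin (N + 1) :=
  finSumFinEquiv.trans (finCongr (by omega))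

theorem blockEquiv_inl (h : n ≤ N) (i : Fin (N - n)) : (blockEquiv h (Sum.inl i) : ℕ) = i := by
  simp [blockEquiv]

theorem blockEquiv_inr (h : n ≤ N) (i : Fin (n + 1)) :
    (blockEquiv h (Sum.inr i) : ℕ) = N - n + i := by
  simp [blockEquiv]

/-- A matrix in block form. -/
def toB (h : n ≤ N) (A : Mat p N) :
    Matrix (Fin (N - n) ⊕ Fin (n + 1)) (Fin (N - n) ⊕ Fin (n + 1)) ℚ_[p] :=
  A.submatrix (blockEquiv h) (blockEquiv h)

theorem toB_apply (h : n ≤ N) (A : Mat p N) (x y : Fin (N - n) ⊕ Fin (n + 1)) :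
    toB h A x y = A (blockEquiv h x) (blockEquiv h y) := rfl

theorem toB_mul (h : n ≤ N) (A B : Mat p N) : toB h (A * B) = toB h A * toB h B :=
  (Matrix.submatrix_mul_equiv A B _ _ _).symm

theorem toB_injective (h : n ≤ N) : Function.Injective (toB (p := p) h) := by
  intro A B e
  ext i j
  have := congrFun (congrFun e ((blockEquiv h).symm i)) ((blockEquiv h).symm j)
  simpa [toB] using this

theorem toB_one (h : n ≤ N) : toB h (1 : Mat p N) = 1 := Matrix.submatrix_one_equiv _

theorem entry_succ (A : Mat p N) (i j : Fin (N + 1)) :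
    entry A ((i : ℕ) + 1) ((j : ℕ) + 1) = A i j := by
  rw [entry, dif_pos (by omega)]
  rfl

theorem toB_idSum (h : n ≤ N) (A : Mat p n) : toB h (idSum N A) = Matrix.fromBlocks 1 0 0 A := by
  ext x y
  rw [toB_apply, idSum, Matrix.of_apply]
  rcases x with x | x <;> rcases y with y | y
  · rw [if_neg (by rw [blockEquiv_inl]; omega), Matrix.fromBlocks_apply₁₁, Matrix.one_apply]
    simp
  · rw [if_neg (by rw [blockEquiv_inl]; omega), Matrix.fromBlocks_apply₁₂, if_neg]
    · rfl
    · simp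
  · rw [if_neg (by rw [blockEquiv_inl, blockEquiv_inr]; omega), Matrix.fromBlocks_apply₂₁, if_neg]
    · rfl
    · simp
  · rw [if_pos (by rw [blockEquiv_inr, blockEquiv_inr]; omega), Matrix.fromBlocks_apply₂₂,
      blockEquiv_inr, blockEquiv_inr, ← entry_succ A x y]
    congr 1 <;> omega

theorem idSum_mul (h : n ≤ N) (A B : Mat p n) : idSum N (A * B) = idSum N A * idSum N B := by
  apply toB_injective h
  rw [toB_mul, toB_idSum, toB_idSum, toB_idSum, Matrix.fromBlocks_multiply]
  simp

theorem idSum_one (h : n ≤ N) : idSum N (1 : Mat p n) = 1 := by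
  apply toB_injective h
  rw [toB_idSum, toB_one, Matrix.fromBlocks_one]

theorem idSum_phi (h : n ≤ N) {i : ℕ} (h1 : 1 ≤ i) (A : Matrix (Fin 2) (Fin 2) ℚ_[p]) :
    idSum N (phi n i A) = phi N (i + (N - n)) A := by
  apply toB_injective h
  rw [toB_idSum]
  ext x y
  rw [toB_apply]
  rcases x with x | x <;> rcases y with y | y <;>
    simp only [phi, Matrix.of_apply, Matrix.fromBlocks_apply₁₁, Matrix.fromBlocks_apply₁₂,
      Matrix.fromBlocks_apply₂₁, Matrix.fromBlocks_apply₂₂, blockEquiv_inl, blockEquiv_inr,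
      Matrix.one_apply, Matrix.zero_apply, EmbeddingLike.apply_eq_iff_eq]
  · simp [show ¬ ((x : ℕ) + 1 = i + (N - n)) by omega, show ¬ ((x : ℕ) = i + (N - n)) by omega]
  · simp [show ¬ ((x : ℕ) + 1 = i + (N - n)) by omega, show ¬ ((x : ℕ) = i + (N - n)) by omega]
  · simp [show ¬ ((y : ℕ) + 1 = i + (N - n)) by omega, show ¬ ((y : ℕ) = i + (N - n)) by omega]
  · have a1 : (N - n + (x : ℕ) + 1 = i + (N - n)) ↔ (x : ℕ) + 1 = i := by omega
    have a2 : (N - n + (x : ℕ) = i + (N - n)) ↔ (x : ℕ) = i := by omega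
    have a3 : (N - n + (y : ℕ) + 1 = i + (N - n)) ↔ (y : ℕ) + 1 = i := by omega
    have a4 : (N - n + (y : ℕ) = i + (N - n)) ↔ (y : ℕ) = i := by omega
    simp only [a1, a2, a3, a4, Sum.inr.injEq]

theorem idSum_bSimple (h : n ≤ N) {i : ℕ} (h1 : 1 ≤ i) (a : ℚ_[p]) :
    idSum N (bSimple n i a) = bSimple N (i + (N - n)) a := by
  rw [bSimple_eq, bSimple_eq, idSum_phi h h1]

end Blocks

/-! ### Products along words -/

section Words

variable {p : ℕ} [Fact p.Prime] {N n : ℕ}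

/-- The product of the simple reflections in a word. -/
def wordPerm : List ℕ → Equiv.Perm ℕ
  | [] => 1
  | i :: is => Equiv.swap i (i + 1) * wordPerm is

theorem wordPerm_append (X Y : List ℕ) : wordPerm (X ++ Y) = wordPerm X * wordPerm Y := by
  induction X with
  | nil => rfl
  | cons i X ih => rw [List.cons_append, wordPerm, wordPerm, ih, mul_assoc]

theorem bAlong_append (a : ℕ × ℕ → ℚ_[p]) (X Y : List ℕ) (σ : Equiv.Perm ℕ) :
    bAlong N a (X ++ Y) σ = bAlong N a X σ * bAlong N a Y (σ * wordPerm X) := by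
  induction X generalizing σ with
  | nil => simp [bAlong, wordPerm]
  | cons i X ih =>
    rw [List.cons_append, bAlong, bAlong, ih, wordPerm, Matrix.mul_assoc, mul_assoc]

/-- Distant reflections commute and fix each other's indices, so exchanging the letters alters
neither the factors nor their root labels. -/
theorem bAlong_swap (a : ℕ × ℕ → ℚ_[p]) {i j : ℕ} (hi : 1 ≤ i) (hj : j ≤ N) (hij : i + 2 ≤ j)
    (Z : List ℕ) (σ : Equiv.Perm ℕ) :
    bAlong N a (i :: j :: Z) σ = bAlong N a (j :: i :: Z) σ := by
  have e1 : Equiv.swap i (i + 1) j = j := Equiv.swap_apply_of_ne_of_ne (by omega) (by omega)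
  have e2 : Equiv.swap i (i + 1) (j + 1) = j + 1 :=
    Equiv.swap_apply_of_ne_of_ne (by omega) (by omega)
  have e3 : Equiv.swap j (j + 1) i = i := Equiv.swap_apply_of_ne_of_ne (by omega) (by omega)
  have e4 : Equiv.swap j (j + 1) (i + 1) = i + 1 :=
    Equiv.swap_apply_of_ne_of_ne (by omega) (by omega)
  have e5 : Equiv.swap i (i + 1) * Equiv.swap j (j + 1) =
      Equiv.swap j (j + 1) * Equiv.swap i (i + 1) := by
    rw [Equiv.mul_swap_eq_swap_mul, e1, e2]
  simp only [bAlong, Equiv.Perm.mul_apply, e1, e2, e3, e4]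
  rw [← Matrix.mul_assoc, ← Matrix.mul_assoc, mul_assoc σ, mul_assoc σ, e5, bSimple_eq, bSimple_eq,
    phi_commute hi (by omega) (by omega) hj hij]

theorem bAlong_comm (a : ℕ × ℕ → ℚ_[p]) (X Y Z : List ℕ) (hX : ∀ i ∈ X, 1 ≤ i)
    (hY : ∀ j ∈ Y, j ≤ N) (hXY : ∀ i ∈ X, ∀ j ∈ Y, i + 2 ≤ j) (σ : Equiv.Perm ℕ) :
    bAlong N a (X ++ (Y ++ Z)) σ = bAlong N a (Y ++ (X ++ Z)) σ := by
  induction X generalizing σ with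
  | nil => rfl
  | cons i X ih =>
    have step : ∀ (Y Z : List ℕ) (σ : Equiv.Perm ℕ), (∀ j ∈ Y, j ≤ N) → (∀ j ∈ Y, i + 2 ≤ j) →
        bAlong N a (i :: (Y ++ Z)) σ = bAlong N a (Y ++ (i :: Z)) σ := by
      intro Y
      induction Y with
      | nil => intro Z σ _ _; rfl
      | cons j Y ihY =>
        intro Z σ h1 h2
        rw [List.cons_append, bAlong_swap a (hX i (by simp)) (h1 j (by simp)) (h2 j (by simp)),
          List.cons_append, bAlong, ihY Z _ (fun j hj => h1 j (by simp [hj]))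
          (fun j hj => h2 j (by simp [hj]))]
        rfl
    rw [List.cons_append, List.cons_append, ← step Y _ σ hY (fun j hj => hXY i (by simp) j hj),
      bAlong, bAlong, ih (fun i hi => hX i (by simp [hi]))
      (fun i hi j hj => hXY i (by simp [hi]) j hj)]

/-- The word `i, i + 1, …, i + S - 1`. -/
def rowW (i S : ℕ) : List ℕ := (List.range S).map (fun u => i + u)

/-- The word `(k, …, k + S - 1), …, (1, …, S)`. -/
def grassW (k S : ℕ) : List ℕ :=
  (List.range k).flatMap (fun t => (List.range S).map (fun u => k - t + u))

theorem rowW_zero (i : ℕ) : rowW i 0 = [] := rfl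

theorem rowW_succ (i S : ℕ) : rowW i (S + 1) = i :: rowW (i + 1) S := by
  rw [rowW, rowW, List.range_succ_eq_map, List.map_cons, List.map_map]
  simp only [add_zero, List.cons.injEq, true_and]
  apply List.map_congr_left
  intro u _
  simp; omega

theorem grassW_zero (S : ℕ) : grassW 0 S = [] := rfl

theorem grassW_succ (k S : ℕ) : grassW (k + 1) S = rowW (k + 1) S ++ grassW k S := by
  rw [grassW, List.range_succ_eq_map, List.flatMap_cons, List.flatMap_map]
  simp [rowW, grassW]

theorem rowW_add (i M q : ℕ) : rowW i (M + q) = rowW i M ++ rowW (i + M) q := by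
  simp only [rowW, List.range_add, List.map_append, List.map_map]
  congr 1
  apply List.map_congr_left
  intro u _
  simp; omega

theorem rowW_map (i q M : ℕ) : (rowW i q).map (fun x => x + M) = rowW (i + M) q := by
  simp only [rowW, List.map_map]
  apply List.map_congr_left
  intro u _
  simp; omega

theorem mem_rowW {i S x : ℕ} : x ∈ rowW i S ↔ i ≤ x ∧ x < i + S := by
  simp only [rowW, List.mem_map, List.mem_range]
  constructor
  · rintro ⟨u, hu, rfl⟩; omega
  · intro h; exact ⟨x - i, by omega, by omega⟩

theorem mem_grassW {k S x : ℕ} (h : x ∈ grassW k S) : 1 ≤ x ∧ x + 1 ≤ k + S := by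
  simp only [grassW, List.mem_map, List.mem_range, List.mem_flatMap] at h
  obtain ⟨t, ht, u, hu, rfl⟩ := h
  omega

theorem redWord_cons (k : ℕ) (bs : List ℕ) :
    redWord (k :: bs) = (redWord bs).map (fun i => i + k) ++ grassW k bs.sum := rfl

theorem redWord_singleton (k : ℕ) : redWord [k] = [] := by
  simp [redWord]

theorem redWord_pair (k q : ℕ) : redWord [k, q] = grassW k q := by
  rw [redWord_cons, redWord_singleton]
  simp

theorem mem_redWord : ∀ (bs : List ℕ) {x : ℕ}, x ∈ redWord bs → 1 ≤ x ∧ x + 1 ≤ bs.sum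
  | [], x, h => by simp [redWord] at h
  | k :: bs, x, h => by
      rw [redWord_cons, List.mem_append] at h
      rw [List.sum_cons]
      rcases h with h | h
      · obtain ⟨y, hy, rfl⟩ := List.mem_map.mp h
        have := mem_redWord bs hy
        omega
      · exact mem_grassW h

/-! ### The permutations of the words and their effect on root labels. -/

theorem wordPerm_rowW_fix (i S x : ℕ) (h : x < i ∨ i + S < x) : wordPerm (rowW i S) x = x := by
  induction S generalizing i with
  | zero => rfl
  | succ S ih =>
    rw [rowW_succ, wordPerm, Equiv.Perm.mul_apply, ih (i + 1) (by omega),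
      Equiv.swap_apply_of_ne_of_ne (by omega) (by omega)]

theorem wordPerm_rowW_last (i S : ℕ) : wordPerm (rowW i S) (i + S) = i := by
  induction S generalizing i with
  | zero => rfl
  | succ S ih =>
    rw [rowW_succ, wordPerm, Equiv.Perm.mul_apply, show i + (S + 1) = i + 1 + S by omega, ih,
      Equiv.swap_apply_right]

theorem wordPerm_rowW_mid (i S x : ℕ) (h : i ≤ x) (h' : x < i + S) :
    wordPerm (rowW i S) x = x + 1 := by
  induction S generalizing i with
  | zero => omega
  | succ S ih =>
    rw [rowW_succ, wordPerm, Equiv.Perm.mul_apply]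
    rcases Nat.eq_or_lt_of_le h with rfl | h1
    · rw [wordPerm_rowW_fix _ _ _ (Or.inl (by omega)), Equiv.swap_apply_left]
    · rw [ih (i + 1) (by omega) (by omega), Equiv.swap_apply_of_ne_of_ne (by omega) (by omega)]

theorem wordPerm_grassW_fix (k S x : ℕ) (h : k + S < x) : wordPerm (grassW k S) x = x := by
  induction k with
  | zero => rfl
  | succ k ih =>
    rw [grassW_succ, wordPerm_append, Equiv.Perm.mul_apply, ih (by omega),
      wordPerm_rowW_fix _ _ _ (Or.inr (by omega))]

theorem wordPerm_grassW_add (k S x : ℕ) (h1 : 1 ≤ x) (h2 : x ≤ k) :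
    wordPerm (grassW k S) (x + S) = x := by
  induction k with
  | zero => omega
  | succ k ih =>
    rw [grassW_succ, wordPerm_append, Equiv.Perm.mul_apply]
    rcases Nat.eq_or_lt_of_le h2 with rfl | h3
    · rw [wordPerm_grassW_fix _ _ _ (by omega), wordPerm_rowW_last]
    · rw [ih (by omega), wordPerm_rowW_fix _ _ _ (Or.inl (by omega))]

theorem wordPerm_fix (ws : List ℕ) (K x : ℕ) (hx : x ≤ K) (h : ∀ i ∈ ws, K < i) :
    wordPerm ws x = x := by
  induction ws with
  | nil => rfl
  | cons i ws ih =>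
    rw [wordPerm, Equiv.Perm.mul_apply, ih (fun i hi => h i (by simp [hi]))]
    have := h i (by simp)
    exact Equiv.swap_apply_of_ne_of_ne (by omega) (by omega)

/-- The prefix permutation undoes the shift by `rest.sum`. This is why the second factor in the
merge takes the entries of a on I_v itself, although its letters are shifted. -/
theorem wordPerm_redWord_add (K : ℕ) (rest : List ℕ) (x : ℕ) (h1 : 1 ≤ x) (h2 : x ≤ K) :
    wordPerm (redWord (K :: rest)) (x + rest.sum) = x := by
  rw [redWord_cons, wordPerm_append, Equiv.Perm.mul_apply, wordPerm_grassW_add _ _ _ h1 h2]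
  apply wordPerm_fix _ K _ h2
  intro i hi
  obtain ⟨y, hy, rfl⟩ := List.mem_map.mp hi
  have := mem_redWord rest hy
  omega

/-- The letters are shifted but the labels are not, so the two starting permutations only have to
agree after the shift, on the indices that the word can touch. -/
theorem bAlong_shift (h : n ≤ N) (a : ℕ × ℕ → ℚ_[p]) (ws : List ℕ)
    (hws : ∀ i ∈ ws, 1 ≤ i ∧ i ≤ n) (σ τ : Equiv.Perm ℕ)
    (hσ : ∀ i, 1 ≤ i → i ≤ n + 1 → σ (i + (N - n)) = τ i) :
    bAlong N a (ws.map (fun i => i + (N - n))) σ = idSum N (bAlong n a ws τ) := by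
  induction ws generalizing σ τ with
  | nil => simp only [List.map_nil, bAlong]; rw [idSum_one h]
  | cons i ws ih =>
    obtain ⟨h1, h2⟩ := hws i (by simp)
    simp only [List.map_cons, bAlong]
    rw [idSum_mul h, idSum_bSimple h h1, hσ i h1 (by omega),
      show i + (N - n) + 1 = i + 1 + (N - n) by omega, hσ (i + 1) (by omega) (by omega),
      ih (fun j hj => hws j (by simp [hj])) _ (τ * Equiv.swap i (i + 1))]
    intro j hj1 hj2
    rw [Equiv.Perm.mul_apply, Equiv.Perm.mul_apply]
    by_cases e1 : j = i
    · subst e1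
      rw [Equiv.swap_apply_left, Equiv.swap_apply_left, hσ _ (by omega) (by omega)]
    · by_cases e2 : j = i + 1
      · subst e2
        rw [Equiv.swap_apply_right, Equiv.swap_apply_right, hσ _ (by omega) (by omega)]
      · rw [Equiv.swap_apply_of_ne_of_ne (by omega) (by omega),
          Equiv.swap_apply_of_ne_of_ne e1 e2, hσ _ hj1 hj2]

/-- Each row of letters is cut after M letters. The tail of a row consists of letters exceeding all
letters in the heads of the later rows by at least two, so it can be moved past these heads. Only
the products agree here, not the words. -/
theorem bAlong_grassW_split (a : ℕ × ℕ → ℚ_[p]) (k M q : ℕ) (hN : k + M + q ≤ N + 1)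
    (σ : Equiv.Perm ℕ) :
    bAlong N a (grassW k (M + q)) σ =
      bAlong N a (grassW k M ++ (grassW k q).map (fun x => x + M)) σ := by
  induction k generalizing σ with
  | zero => rfl
  | succ k ih =>
    have e1 := ih (by omega) (σ * wordPerm (rowW (k + 1) (M + q)))
    rw [grassW_succ, bAlong_append, e1, ← bAlong_append, rowW_add, grassW_succ, grassW_succ,
      List.map_append, rowW_map, List.append_assoc, List.append_assoc, bAlong_append,
      bAlong_append a (rowW (k + 1) M)]
    congr 1
    refine (bAlong_comm a _ _ _ ?_ ?_ ?_ _).symm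
    · intro i hi; exact (mem_grassW hi).1
    · intro j hj; have := mem_rowW.mp hj; omega
    · intro i hi j hj
      have := mem_grassW hi
      have := mem_rowW.mp hj
      omega

/-- In contrast to splitting the length of the rows, splitting the number of rows is an equality of
words. -/
theorem grassW_add (k q S : ℕ) :
    grassW (k + q) S = (grassW q S).map (fun x => x + k) ++ grassW k S := by
  induction q with
  | zero => rfl
  | succ q ih =>
    rw [← add_assoc, grassW_succ, ih, grassW_succ, List.map_append, rowW_map, List.append_assoc]
    congr 2
    omega

/-- The factorization of `b_w` obtained by merging the two top blocks. -/
theorem bMap_merge (a : ℕ × ℕ → ℚ_[p]) (k q : ℕ) (rest : List ℕ)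
    (hn : k + q = n + 1) (hN : (k :: q :: rest).sum = N + 1) :
    bMap N (k :: q :: rest) a = bMap N ((k + q) :: rest) a * idSum N (bMap n [k, q] a) := by
  simp only [List.sum_cons] at hN
  have hM : rest.sum = N - n := by omega
  have hnN : n ≤ N := by omega
  rw [bMap, bMap, bMap, redWord_pair, ← bAlong_shift hnN a (grassW k q) _
    (1 * wordPerm (redWord ((k + q) :: rest))) 1, ← hM, ← bAlong_append]
  · rw [redWord_cons, redWord_cons, redWord_cons, grassW_add, List.map_append, List.map_map,
      List.sum_cons, bAlong_append, add_comm q, bAlong_grassW_split a k _ q (by omega),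
      ← bAlong_append]
    simp only [List.append_assoc]
    congr 2
    apply List.map_congr_left
    intro x _
    simp; omega
  · intro i h1 h2
    rw [one_mul, ← hM, wordPerm_redWord_add _ _ _ h1 (by omega)]
    rfl
  · intro i hi
    have := mem_grassW hi
    omega

theorem bMap_singleton (a : ℕ × ℕ → ℚ_[p]) (K : ℕ) : bMap N [K] a = 1 := by
  rw [bMap, redWord_singleton]; rfl

theorem isIntUnit_bAlong (a : ℕ × ℕ → ℚ_[p]) (ws : List ℕ) (h : ∀ i ∈ ws, 1 ≤ i ∧ i ≤ N)
    (σ : Equiv.Perm ℕ) : IsIntUnit (bAlong N a ws σ) := by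
  induction ws generalizing σ with
  | nil => exact isIntUnit_one
  | cons i ws ih =>
    obtain ⟨h1, h2⟩ := h i (by simp)
    exact (isIntUnit_bSimple h1 h2 _).mul (ih (fun j hj => h j (by simp [hj])) _)

theorem isIntUnit_bMap {bs : List ℕ} (hs : bs.sum = N + 1) (a : ℕ × ℕ → ℚ_[p]) :
    IsIntUnit (bMap N bs a) := by
  apply isIntUnit_bAlong
  intro i hi
  have := mem_redWord bs hi
  omega

end Words

/-! ### The factorization of admissible Weyl elements -/

section WeylMerge

variable {p : ℕ} [Fact p.Prime] {N n : ℕ}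

theorem idSum_apply_inl_left (A : Mat p n) {x y : Fin (N + 1)}
    (hx : (x : ℕ) < N - n) : idSum N A x y = if x = y then 1 else 0 := by
  rw [idSum, Matrix.of_apply, if_neg (by omega)]

theorem idSum_apply_inl_right (A : Mat p n) {x y : Fin (N + 1)}
    (hy : (y : ℕ) < N - n) : idSum N A x y = if x = y then 1 else 0 := by
  rw [idSum, Matrix.of_apply, if_neg (by omega)]

theorem idSum_apply_inr (h : n ≤ N) (A : Mat p n) (x y : Fin (n + 1)) :
    idSum N A (blockEquiv h (Sum.inr x)) (blockEquiv h (Sum.inr y)) = A x y := by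
  have := congrFun (congrFun (toB_idSum h A) (Sum.inr x)) (Sum.inr y)
  exact this

theorem exists_inr_of_le (h : n ≤ N) (x : Fin (N + 1)) (hx : N - n ≤ (x : ℕ)) :
    ∃ y : Fin (n + 1), x = blockEquiv h (Sum.inr y) ∧ (x : ℕ) = N - n + y := by
  refine ⟨⟨x - (N - n), by omega⟩, Fin.ext ?_, ?_⟩
  · rw [blockEquiv_inr]; simp; omega
  · simp; omega

theorem wcol_merge (k q : ℕ) (rest : List ℕ) (y : ℕ) :
    wcol (k :: q :: rest) y =
      if y < rest.sum then wcol ((k + q) :: rest) y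
      else wcol [k, q] (y - rest.sum) := by
  simp only [wcol, List.sum_cons, List.sum_nil]
  by_cases h : y < rest.sum
  · simp only [h, if_true, show y < q + rest.sum by omega]; omega
  · by_cases h2 : y < q + rest.sum
    · simp only [h, h2, if_true, if_false, show y - rest.sum < q + 0 by omega, Nat.not_lt_zero]
      omega
    · simp only [h, h2, if_false, show ¬ (y - rest.sum < q + 0) by omega]; omega

theorem wcol_merged_left (K : ℕ) (rest : List ℕ) {y : ℕ} (h : y < rest.sum) :
    K ≤ wcol (K :: rest) y := by
  simp [wcol, h]

theorem wcol_merged_right (K : ℕ) (rest : List ℕ) {y : ℕ} (h : rest.sum ≤ y) :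
    wcol (K :: rest) y = y - rest.sum := by
  simp [wcol, show ¬ y < rest.sum by omega]

theorem wsgn_merge (k q : ℕ) (rest : List ℕ) (y : ℕ) :
    wsgn (k :: q :: rest) y =
      if y < rest.sum then wsgn ((k + q) :: rest) y
      else (-1) ^ rest.sum * wsgn [k, q] (y - rest.sum) := by
  simp only [wsgn, List.sum_cons, List.sum_nil]
  by_cases h : y < rest.sum
  · simp only [h, if_true, show y < q + rest.sum by omega]
  · by_cases h2 : y < q + rest.sum
    · simp only [h, h2, if_true, if_false, show y - rest.sum < q + 0 by omega]
      simp
    · simp only [h, h2, if_false, show ¬ (y - rest.sum < q + 0) by omega]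
      rw [← pow_add]; congr 1; omega

theorem wsgn_merged_right (K : ℕ) (rest : List ℕ) {y : ℕ} (h : rest.sum ≤ y) :
    wsgn (K :: rest) y = (-1) ^ rest.sum := by
  simp [wsgn, show ¬ y < rest.sum by omega]

theorem weyl_merge (k q : ℕ) (rest : List ℕ) (hn : k + q = n + 1)
    (hN : (k :: q :: rest).sum = N + 1) :
    weyl p N (k :: q :: rest) = weyl p N ((k + q) :: rest) * idSum N (weyl p n [k, q]) := by
  have hs' : ((k + q) :: rest).sum = N + 1 := by simp at hN ⊢; omega
  have hv : [k, q].sum = n + 1 := by simp; omega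
  have hM : rest.sum = N - n := by simp at hs'; omega
  have hnN : n ≤ N := by simp at hs'; omega
  ext x y
  obtain ⟨x, rfl⟩ := (wfin_bijective hs').2 x
  rw [weyl_mul_apply, weyl_apply hN]
  change (if wcol ((k + q) :: rest) x = _ then _ else _) = _
  rw [wcol_merge, wsgn_merge]
  by_cases hy : (y : ℕ) < rest.sum
  · rw [if_pos hy, if_pos hy, idSum_apply_inl_right _ (by omega)]
    by_cases hxy : x = y
    · subst hxy; simp
    · rw [if_neg hxy, if_neg, mul_zero]
      intro h
      exact hxy (Fin.ext (wcol_inj _ _ _ (by rw [hs']; exact x.2) (by rw [hs']; exact y.2) h))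
  · rw [if_neg hy, if_neg hy]
    obtain ⟨y', hy1, hy2⟩ := exists_inr_of_le hnN y (by omega)
    have ey : (y : ℕ) - rest.sum = y' := by omega
    have hlt : wcol [k, q] (y' : ℕ) < n + 1 :=
      (wcol_lt [k, q] y' (by rw [hv]; exact y'.2)).trans_eq hv
    by_cases hx : (x : ℕ) < rest.sum
    · rw [idSum_apply_inl_left _ (by omega), if_neg (c := x = y) (by rintro rfl; exact hy hx),
        if_neg, mul_zero]
      have := wcol_merged_left (k + q) rest hx
      rw [ey]; omega
    · obtain ⟨x', hx1, hx2⟩ := exists_inr_of_le hnN x (by omega)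
      have e1 : idSum N (weyl p n [k, q]) x y = weyl p n [k, q] x' y' := by
        rw [hx1, hy1, idSum_apply_inr]
      rw [e1, weyl_apply hv, ey, wcol_merged_right _ _ (show rest.sum ≤ (x : ℕ) by omega),
        wsgn_merged_right _ _ (show rest.sum ≤ (x : ℕ) by omega),
        show (x : ℕ) - rest.sum = x' by omega]
      split_ifs
      · push_cast; rfl
      · simp

end WeylMerge

/-! ### Rows of the Grassmannian factor -/

section Rows

variable {p : ℕ} [Fact p.Prime] {N : ℕ}

/-- The product `b_{α_i}(a_0) ⋯ b_{α_{i+q-1}}(a_{q-1})`. -/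
def rowMat (N : ℕ) : ℕ → ℕ → (ℕ → ℚ_[p]) → Mat p N
  | _, 0, _ => 1
  | i, q + 1, a => bSimple N i (a 0) * rowMat N (i + 1) q (fun u => a (u + 1))

/-- The product of `k` rows. -/
def grassMat (N q : ℕ) (A : ℕ → ℕ → ℚ_[p]) : ℕ → Mat p N
  | 0 => 1
  | k + 1 => rowMat N (k + 1) q (A k) * grassMat N q A k

/-- The simple reflections of a word are in range, and every prefix is reduced with the next
letter. -/
def RedAlong (N : ℕ) : List ℕ → Equiv.Perm ℕ → Prop
  | [], _ => True
  | i :: is, σ => (1 ≤ i ∧ i ≤ N ∧ σ i < σ (i + 1)) ∧ RedAlong N is (σ * Equiv.swap i (i + 1))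

/-- The sum of the `μ(a_γ)` over the roots of a word that contain `α_l`. -/
def expoAlong (a : ℕ × ℕ → ℚ_[p]) : List ℕ → Equiv.Perm ℕ → ℕ → ℤ
  | [], _, _ => 0
  | i :: is, σ, l =>
      (if σ i ≤ l ∧ l < σ (i + 1) then (mu (a (σ i, σ (i + 1) - 1)) : ℤ) else 0) +
        expoAlong a is (σ * Equiv.swap i (i + 1)) l

theorem redAlong_append (X Y : List ℕ) (σ : Equiv.Perm ℕ) :
    RedAlong N (X ++ Y) σ ↔ RedAlong N X σ ∧ RedAlong N Y (σ * wordPerm X) := by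
  induction X generalizing σ with
  | nil => simp [RedAlong, wordPerm]
  | cons i X ih => rw [List.cons_append, RedAlong, RedAlong, ih, wordPerm, mul_assoc]; tauto

theorem expoAlong_append (a : ℕ × ℕ → ℚ_[p]) (X Y : List ℕ) (σ : Equiv.Perm ℕ) (l : ℕ) :
    expoAlong a (X ++ Y) σ l = expoAlong a X σ l + expoAlong a Y (σ * wordPerm X) l := by
  induction X generalizing σ with
  | nil => simp [expoAlong, wordPerm]
  | cons i X ih => rw [List.cons_append, expoAlong, expoAlong, ih, wordPerm, mul_assoc, add_assoc]

/-- Along a row the first index σ(i) is carried along while the second runs through L+1, L+2, …, so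
the roots met are α_{σ(i),L+u}. Product, reducedness and torus exponents all follow from this
invariant. -/
theorem along_rowW (a : ℕ × ℕ → ℚ_[p]) (i q L : ℕ) (h1 : 1 ≤ i) (h2 : i + q ≤ N + 1)
    (σ : Equiv.Perm ℕ) (hL : σ i ≤ L) (hσ : ∀ u < q, σ (i + 1 + u) = L + 1 + u) :
    bAlong N a (rowW i q) σ = rowMat N i q (fun u => a (σ i, L + u)) ∧
    RedAlong N (rowW i q) σ ∧
    ∀ l, expoAlong a (rowW i q) σ l =
      ∑ u ∈ Finset.range q, if σ i ≤ l ∧ l ≤ L + u then (mu (a (σ i, L + u)) : ℤ) else 0 := by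
  induction q generalizing i L σ with
  | zero => exact ⟨rfl, trivial, fun l => by simp [expoAlong, rowW_zero]⟩
  | succ q ih =>
    have e0 : σ (i + 1) = L + 1 := hσ 0 (by omega)
    have e1 : (σ * Equiv.swap i (i + 1)) (i + 1) = σ i := by simp
    obtain ⟨h3, h4, h5⟩ := ih (i + 1) (L + 1) (by omega) (by omega) (σ * Equiv.swap i (i + 1))
      (by rw [e1]; omega) (fun u hu => by
        rw [Equiv.Perm.mul_apply, Equiv.swap_apply_of_ne_of_ne (by omega) (by omega),
          show i + 1 + 1 + u = i + 1 + (u + 1) by omega, hσ (u + 1) (by omega)]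
        omega)
    rw [rowW_succ]
    refine ⟨?_, ⟨⟨h1, by omega, by omega⟩, h4⟩, fun l => ?_⟩
    · rw [bAlong, rowMat, h3, e1, e0]
      congr 1
      congr 1
      funext u
      rw [add_right_comm, add_assoc]
    · rw [expoAlong, h5, Finset.sum_range_succ', e1, e0, add_comm]
      congr 1
      · apply Finset.sum_congr rfl
        intro u _
        rw [show L + 1 + u = L + (u + 1) by omega]
      · simp

/-- K is kept apart from k for the induction: once a row is processed, the same labels K+1, …, K+q
sit one position lower. -/
theorem along_grassW (a : ℕ × ℕ → ℚ_[p]) (k q K : ℕ) (h2 : k + q ≤ N + 1) (hK : k ≤ K)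
    (σ : Equiv.Perm ℕ) (hσ1 : ∀ x, 1 ≤ x → x ≤ k → σ x = x)
    (hσ : ∀ u < q, σ (k + 1 + u) = K + 1 + u) :
    bAlong N a (grassW k q) σ = grassMat N q (fun i u => a (i + 1, K + u)) k ∧
    RedAlong N (grassW k q) σ ∧
    ∀ l, expoAlong a (grassW k q) σ l = ∑ i ∈ Finset.range k, ∑ u ∈ Finset.range q,
      if i + 1 ≤ l ∧ l ≤ K + u then (mu (a (i + 1, K + u)) : ℤ) else 0 := by
  induction k generalizing σ with
  | zero => exact ⟨rfl, trivial, fun l => by simp [expoAlong, grassW_zero]⟩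
  | succ k ih =>
    have e0 := hσ1 (k + 1) (by omega) le_rfl
    obtain ⟨r1, r2, r3⟩ := along_rowW (N := N) a (k + 1) q K (by omega) (by omega) σ (by omega) hσ
    obtain ⟨h3, h4, h5⟩ := ih (by omega) (by omega) (σ * wordPerm (rowW (k + 1) q))
      (fun x hx1 hx2 => by
        rw [Equiv.Perm.mul_apply, wordPerm_rowW_fix _ _ _ (Or.inl (by omega)),
          hσ1 x hx1 (by omega)])
      (fun u hu => by
        rw [Equiv.Perm.mul_apply, wordPerm_rowW_mid _ _ _ (by omega) (by omega), ← hσ u hu]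
        congr 1; omega)
    rw [grassW_succ]
    refine ⟨?_, ?_, fun l => ?_⟩
    · rw [bAlong_append, r1, h3, e0]; rfl
    · rw [redAlong_append]; exact ⟨r2, h4⟩
    · rw [expoAlong_append, r3, h5, Finset.sum_range_succ, e0, add_comm]

theorem bMap_pair {n : ℕ} (a : ℕ × ℕ → ℚ_[p]) (k q : ℕ) (h : k + q = n + 1) :
    bMap n [k, q] a = grassMat n q (fun i u => a (i + 1, k + u)) k := by
  rw [bMap, redWord_pair]
  exact (along_grassW a k q k (by omega) le_rfl 1 (fun _ _ _ => rfl) (fun _ _ => rfl)).1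

end Rows

/-! ### Action on basis vectors -/

section Vectors

variable {p : ℕ} [Fact p.Prime] {N : ℕ}

/-- The basis vector `e_x`, with `1 ≤ x ≤ N + 1`. -/
def ev (p : ℕ) [Fact p.Prime] (N x : ℕ) : Fin (N + 1) → ℚ_[p] :=
  fun r => if (r : ℕ) + 1 = x then 1 else 0

theorem mulVec_ev (A : Mat p N) (x : ℕ) (h1 : 1 ≤ x) (h2 : x ≤ N + 1) (r : Fin (N + 1)) :
    (A.mulVec (ev p N x)) r = A r ⟨x - 1, by omega⟩ := by
  rw [Matrix.mulVec, dotProduct, Finset.sum_eq_single ⟨x - 1, by omega⟩]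
  · simp [ev, show x - 1 + 1 = x by omega]
  · intro l _ hl
    rw [ev, if_neg, mul_zero]
    intro h; exact hl (Fin.ext (by simp; omega))
  · intro h; exact absurd (Finset.mem_univ _) h

theorem vecMul_ev (A : Mat p N) (x : ℕ) (h1 : 1 ≤ x) (h2 : x ≤ N + 1) (r : Fin (N + 1)) :
    (Matrix.vecMul (ev p N x) A) r = A ⟨x - 1, by omega⟩ r := by
  rw [← Matrix.mulVec_transpose, mulVec_ev _ _ h1 h2, Matrix.transpose_apply]

theorem phi_mulVec_ev {i : ℕ} (h1 : 1 ≤ i) (h2 : i ≤ N) (A : Matrix (Fin 2) (Fin 2) ℚ_[p])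
    (x : ℕ) (hx1 : 1 ≤ x) (hx2 : x ≤ N + 1) :
    (phi N i A).mulVec (ev p N x) =
      if x = i then A 0 0 • ev p N i + A 1 0 • ev p N (i + 1)
      else if x = i + 1 then A 0 1 • ev p N i + A 1 1 • ev p N (i + 1)
      else ev p N x := by
  funext r
  rw [mulVec_ev _ _ hx1 hx2]
  have e1 : x - 1 + 1 = x := by omega
  simp only [phi, Matrix.of_apply, e1]
  have e2 : (x - 1 = i) ↔ (x = i + 1) := by omega
  simp only [e2]
  by_cases ha : x = i
  · subst ha
    simp only [and_true, if_true, ev, Pi.add_apply, Pi.smul_apply, smul_eq_mul]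
    by_cases hb : (r : ℕ) + 1 = x
    · simp [hb]
    · by_cases hc : (r : ℕ) = x
      · simp [hc]
      · rw [if_neg hb, if_neg (by omega), if_neg hc, if_neg (by omega), if_neg]
        · simp [hb, hc]
        · intro h; have := congrArg Fin.val h; simp at this; omega
  · by_cases ha' : x = i + 1
    · subst ha'
      simp only [ha, and_true, if_true, if_false, and_false, ev, Pi.add_apply, Pi.smul_apply, smul_eq_mul]
      by_cases hb : (r : ℕ) + 1 = i
      · simp [hb]
      · by_cases hc : (r : ℕ) = i
        · simp [hc]
        · simp [hb, hc, Fin.ext_iff]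
    · simp only [ha, ha', and_false, if_false, ev, Fin.ext_iff]
      congr 1
      exact propext ⟨fun h => by omega, fun h => by omega⟩

theorem vecMul_phi_ev {i : ℕ} (h1 : 1 ≤ i) (h2 : i ≤ N) (A : Matrix (Fin 2) (Fin 2) ℚ_[p])
    (x : ℕ) (hx1 : 1 ≤ x) (hx2 : x ≤ N + 1) :
    Matrix.vecMul (ev p N x) (phi N i A) =
      if x = i then A 0 0 • ev p N i + A 0 1 • ev p N (i + 1)
      else if x = i + 1 then A 1 0 • ev p N i + A 1 1 • ev p N (i + 1)
      else ev p N x := by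
  rw [← Matrix.mulVec_transpose, phi_transpose, phi_mulVec_ev h1 h2 _ _ hx1 hx2]
  rfl

theorem bSimple_mulVec_self {i : ℕ} (h1 : 1 ≤ i) (h2 : i ≤ N) (a : ℚ_[p]) :
    (bSimple N i a).mulVec (ev p N i) =
      dPart a • ev p N i + (p : ℚ_[p]) ^ mu a • ev p N (i + 1) := by
  rw [bSimple_eq, phi_mulVec_ev h1 h2 _ _ h1 (by omega), if_pos rfl]; rfl

theorem bSimple_mulVec_succ {i : ℕ} (h1 : 1 ≤ i) (h2 : i ≤ N) (a : ℚ_[p]) :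
    (bSimple N i a).mulVec (ev p N (i + 1)) =
      epsPart a • ev p N i + cPart a • ev p N (i + 1) := by
  rw [bSimple_eq, phi_mulVec_ev h1 h2 _ _ (by omega) (by omega), if_neg (by omega), if_pos rfl]; rfl

theorem bSimple_mulVec_of_ne {i x : ℕ} (h1 : 1 ≤ i) (h2 : i ≤ N) (a : ℚ_[p]) (hx1 : 1 ≤ x)
    (hx2 : x ≤ N + 1) (hx : x ≠ i) (hx' : x ≠ i + 1) :
    (bSimple N i a).mulVec (ev p N x) = ev p N x := by
  rw [bSimple_eq, phi_mulVec_ev h1 h2 _ _ hx1 hx2, if_neg hx, if_neg hx']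

theorem vecMul_bSimple_self {i : ℕ} (h1 : 1 ≤ i) (h2 : i ≤ N) (a : ℚ_[p]) :
    Matrix.vecMul (ev p N i) (bSimple N i a) =
      dPart a • ev p N i + epsPart a • ev p N (i + 1) := by
  rw [bSimple_eq, vecMul_phi_ev h1 h2 _ _ h1 (by omega), if_pos rfl]; rfl

theorem vecMul_bSimple_succ {i : ℕ} (h1 : 1 ≤ i) (h2 : i ≤ N) (a : ℚ_[p]) :
    Matrix.vecMul (ev p N (i + 1)) (bSimple N i a) =
      (p : ℚ_[p]) ^ mu a • ev p N i + cPart a • ev p N (i + 1) := by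
  rw [bSimple_eq, vecMul_phi_ev h1 h2 _ _ (by omega) (by omega), if_neg (by omega), if_pos rfl]; rfl

theorem vecMul_bSimple_of_ne {i x : ℕ} (h1 : 1 ≤ i) (h2 : i ≤ N) (a : ℚ_[p]) (hx1 : 1 ≤ x)
    (hx2 : x ≤ N + 1) (hx : x ≠ i) (hx' : x ≠ i + 1) :
    Matrix.vecMul (ev p N x) (bSimple N i a) = ev p N x := by
  rw [bSimple_eq, vecMul_phi_ev h1 h2 _ _ hx1 hx2, if_neg hx, if_neg hx']

theorem rowMat_mulVec_of_lt (i q : ℕ) (a : ℕ → ℚ_[p]) (h1 : 1 ≤ i) (h2 : i + q ≤ N + 1)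
    (x : ℕ) (hx1 : 1 ≤ x) (hx2 : x ≤ N + 1) (hx : x < i ∨ i + q < x) :
    (rowMat N i q a).mulVec (ev p N x) = ev p N x := by
  induction q generalizing i a with
  | zero => rw [rowMat, Matrix.one_mulVec]
  | succ q ih =>
    rw [rowMat, ← Matrix.mulVec_mulVec, ih (i + 1) _ (by omega) (by omega) (by omega),
      bSimple_mulVec_of_ne h1 (by omega) _ hx1 hx2 (by omega) (by omega)]

theorem vecMul_rowMat_of_lt (i q : ℕ) (a : ℕ → ℚ_[p]) (h1 : 1 ≤ i) (h2 : i + q ≤ N + 1)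
    (x : ℕ) (hx1 : 1 ≤ x) (hx2 : x ≤ N + 1) (hx : x < i ∨ i + q < x) :
    Matrix.vecMul (ev p N x) (rowMat N i q a) = ev p N x := by
  induction q generalizing i a with
  | zero => rw [rowMat, Matrix.vecMul_one]
  | succ q ih =>
    rw [rowMat, ← Matrix.vecMul_vecMul,
      vecMul_bSimple_of_ne h1 (by omega) _ hx1 hx2 (by omega) (by omega),
      ih (i + 1) _ (by omega) (by omega) (by omega)]

theorem vecMul_grassMat_of_lt (q : ℕ) (A : ℕ → ℕ → ℚ_[p]) (k : ℕ) (h2 : k + q ≤ N + 1)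
    (x : ℕ) (hx1 : 1 ≤ x) (hx2 : x ≤ N + 1) (hx : k + q < x) :
    Matrix.vecMul (ev p N x) (grassMat N q A k) = ev p N x := by
  induction k with
  | zero => rw [grassMat, Matrix.vecMul_one]
  | succ k ih =>
    rw [grassMat, ← Matrix.vecMul_vecMul,
      vecMul_rowMat_of_lt _ _ _ (by omega) (by omega) _ hx1 hx2 (by omega),
      ih (by omega) (by omega)]

theorem mu_zero : mu (0 : ℚ_[p]) = 0 := (mu_eq_zero_iff 0).2 (by simp)

theorem dPart_zero : dPart (0 : ℚ_[p]) = 0 := by simp [dPart, mu_zero]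

theorem epsPart_zero : epsPart (0 : ℚ_[p]) = -1 := by simp [epsPart, mu_zero]

theorem cPart_zero : cPart (0 : ℚ_[p]) = 0 := by simp [cPart]

theorem rowMat_zero_mulVec_mid (i q x : ℕ) (h1 : 1 ≤ i) (h2 : i + q ≤ N + 1)
    (hx1 : i ≤ x) (hx2 : x < i + q) :
    (rowMat N i q (0 : ℕ → ℚ_[p])).mulVec (ev p N x) = ev p N (x + 1) := by
  induction q generalizing i with
  | zero => omega
  | succ q ih =>
    rw [rowMat, ← Matrix.mulVec_mulVec]
    rcases Nat.eq_or_lt_of_le hx1 with rfl | h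
    · rw [rowMat_mulVec_of_lt _ _ _ (by omega) (by omega) _ h1 (by omega) (Or.inl (by omega)),
        bSimple_mulVec_self h1 (by omega)]
      simp [dPart_zero, mu_zero]
    · have := ih (i + 1) (by omega) (by omega) (by omega) (by omega)
      erw [this]
      rw [bSimple_mulVec_of_ne h1 (by omega) _ (by omega) (by omega) (by omega) (by omega)]

theorem rowMat_zero_mulVec_last (i q : ℕ) (h1 : 1 ≤ i) (h2 : i + q ≤ N + 1) :
    (rowMat N i q (0 : ℕ → ℚ_[p])).mulVec (ev p N (i + q)) = (-1 : ℚ_[p]) ^ q • ev p N i := by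
  induction q generalizing i with
  | zero => rw [rowMat, Matrix.one_mulVec]; simp
  | succ q ih =>
    rw [rowMat, ← Matrix.mulVec_mulVec, show i + (q + 1) = i + 1 + q by omega]
    have := ih (i + 1) (by omega) (by omega)
    erw [this]
    rw [Matrix.mulVec_smul, bSimple_mulVec_succ h1 (by omega)]
    simp [epsPart_zero, cPart_zero, pow_succ]

theorem grassMat_mulVec_of_lt (q : ℕ) (A : ℕ → ℕ → ℚ_[p]) (k : ℕ) (h2 : k + q ≤ N + 1)
    (x : ℕ) (hx1 : 1 ≤ x) (hx2 : x ≤ N + 1) (hx : k + q < x) :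
    (grassMat N q A k).mulVec (ev p N x) = ev p N x := by
  induction k with
  | zero => rw [grassMat, Matrix.one_mulVec]
  | succ k ih =>
    rw [grassMat, ← Matrix.mulVec_mulVec, ih (by omega) (by omega),
      rowMat_mulVec_of_lt _ _ _ (by omega) (by omega) _ hx1 hx2 (by omega)]

theorem grassMat_zero_mulVec_left (q k x : ℕ) (h2 : k + q ≤ N + 1) (hx1 : 1 ≤ x) (hx2 : x ≤ q) :
    (grassMat N q (0 : ℕ → ℕ → ℚ_[p]) k).mulVec (ev p N x) = ev p N (x + k) := by
  induction k with
  | zero => rw [grassMat, Matrix.one_mulVec]; rfl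
  | succ k ih =>
    rw [grassMat, ← Matrix.mulVec_mulVec, ih (by omega)]
    exact rowMat_zero_mulVec_mid _ _ _ (by omega) (by omega) (by omega) (by omega)

theorem grassMat_zero_mulVec_right (q k x : ℕ) (h2 : k + q ≤ N + 1) (hx1 : 1 ≤ x) (hx2 : x ≤ k) :
    (grassMat N q (0 : ℕ → ℕ → ℚ_[p]) k).mulVec (ev p N (x + q)) =
      (-1 : ℚ_[p]) ^ q • ev p N x := by
  induction k with
  | zero => omega
  | succ k ih =>
    rw [grassMat, ← Matrix.mulVec_mulVec]
    rcases Nat.eq_or_lt_of_le hx2 with rfl | h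
    · rw [grassMat_mulVec_of_lt _ _ _ (by omega) _ (by omega) (by omega) (by omega)]
      exact rowMat_zero_mulVec_last _ _ (by omega) (by omega)
    · rw [ih (by omega) (by omega), Matrix.mulVec_smul,
        rowMat_mulVec_of_lt _ _ _ (by omega) (by omega) _ (by omega) (by omega) (by omega)]

/-- b_α(0) represents the simple reflection, so the product at a = 0 is monomial. Following the
basis vectors shows that its signs are those of the chosen representative, and no extra torus
element enters. -/
theorem weyl_pair {n : ℕ} (k q : ℕ) (h : k + q = n + 1) :
    weyl p n [k, q] = bMap n [k, q] 0 := by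
  rw [bMap_pair _ _ _ h]
  have hs : [k, q].sum = n + 1 := by simp; omega
  ext r s
  rw [weyl_apply hs]
  have := mulVec_ev (grassMat n q (0 : ℕ → ℕ → ℚ_[p]) k) ((s : ℕ) + 1) (by omega) (by omega) r
  change _ = grassMat n q (0 : ℕ → ℕ → ℚ_[p]) k r s
  rw [show (⟨(s : ℕ) + 1 - 1, by omega⟩ : Fin (n + 1)) = s from rfl] at this
  rw [← this]
  simp only [wcol, wsgn, List.sum_cons, List.sum_nil, add_zero]
  by_cases hsq : (s : ℕ) < q
  · rw [if_pos hsq, if_pos hsq, grassMat_zero_mulVec_left _ _ _ (by omega) (by omega) (by omega), ev]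
    simp only [Nat.not_lt_zero, if_false, pow_zero, Int.cast_one]
    congr 1
    exact propext ⟨fun h => by omega, fun h => by omega⟩
  · rw [if_neg hsq, if_neg hsq, show (s : ℕ) + 1 = (s + 1 - q) + q by omega,
      grassMat_zero_mulVec_right _ _ _ (by omega) (by omega) (by omega), Pi.smul_apply, ev,
      smul_eq_mul]
    by_cases hr : (r : ℕ) = s - q
    · rw [if_pos hr, if_pos (by omega)]; simp
    · rw [if_neg hr, if_neg (by omega)]; simp

end Vectors

/-! ### Bruhat decompositions along reduced words -/

section Along

variable {p : ℕ} [Fact p.Prime] {N : ℕ}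

/-- `Q` is a monomial matrix for the permutation `τ`. -/
structure IsMono (τ : Equiv.Perm (Fin (N + 1))) (Q : Mat p N) : Prop where
  zero : ∀ x y, x ≠ τ y → Q x y = 0
  ne_zero : ∀ y, Q (τ y) y ≠ 0

theorem IsMono.mul_apply {τ : Equiv.Perm (Fin (N + 1))} {Q : Mat p N} (hQ : IsMono τ Q)
    (X : Mat p N) (r c : Fin (N + 1)) : (X * Q) r c = X r (τ c) * Q (τ c) c := by
  rw [Matrix.mul_apply, Finset.sum_eq_single (τ c)]
  · intro l _ hl; rw [hQ.zero l c hl, mul_zero]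
  · intro h; exact absurd (Finset.mem_univ _) h

/-- The index `x - 1` of `Fin (N + 1)` for `1 ≤ x ≤ N + 1`. -/
abbrev fi (N x : ℕ) (h : x < N + 1) : Fin (N + 1) := ⟨x, h⟩

/-- A monomial matrix conjugates the root subgroup of α_i to that of τ(α_i), which is positive by
`hlt`; the conjugated element is the transvection given as witness. -/
theorem IsMono.mul_upper {τ : Equiv.Perm (Fin (N + 1))} {Q : Mat p N} (hQ : IsMono τ Q)
    {i : ℕ} (h1 : 1 ≤ i) (h2 : i ≤ N)
    (hlt : τ (fi N (i - 1) (by omega)) < τ (fi N i (by omega))) (e : ℚ_[p]) :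
    ∃ X ∈ U p N, X * Q = Q * phi N i !![1, e; 0, 1] := by
  set x := τ (fi N (i - 1) (by omega)) with hx
  set y := τ (fi N i (by omega)) with hy
  refine ⟨Matrix.transvection x y (Q x (fi N (i - 1) (by omega)) * e *
    (Q y (fi N i (by omega)))⁻¹), ?_, ?_⟩
  · refine ⟨fun r => ?_, fun r s hrs => ?_⟩
    · simp only [Matrix.transvection, Matrix.add_apply, Matrix.one_apply_eq]
      rw [Matrix.single_apply_of_ne, add_zero]
      rintro ⟨rfl, h⟩; exact absurd h hlt.ne'
    · simp only [Matrix.transvection, Matrix.add_apply]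
      rw [Matrix.one_apply_ne hrs.ne', Matrix.single_apply_of_ne, add_zero]
      rintro ⟨rfl, rfl⟩; exact absurd hrs (not_lt_of_gt hlt)
  · ext r s
    rw [hQ.mul_apply, mul_phi_apply h1 h2]
    simp only [Matrix.transvection, Matrix.add_apply, Matrix.one_apply]
    by_cases ha : (s : ℕ) + 1 = i
    · have es : s = fi N (i - 1) (by omega) := Fin.ext (by simp; omega)
      rw [if_pos ha, es, ← hx, Matrix.single_apply_of_ne]
      · by_cases hr : r = x
        · subst hr; simp
        · rw [if_neg hr, hQ.zero r _ hr]; simp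
      · rintro ⟨_, h⟩; exact absurd h hlt.ne'
    · rw [if_neg ha]
      by_cases hb : (s : ℕ) = i
      · have es : s = fi N i (by omega) := Fin.ext hb
        rw [if_pos hb, es, ← hy]
        by_cases hr : r = x
        · rw [hr, Matrix.single_apply_same, if_neg hlt.ne, hQ.zero x _ hlt.ne]
          simp only [Matrix.of_apply, Matrix.cons_val', Matrix.cons_val_zero, Matrix.cons_val_one]
          rw [zero_add, inv_mul_cancel_right₀ (hQ.ne_zero _)]; simp
        · rw [Matrix.single_apply_of_row_ne (Ne.symm hr), hQ.zero r (fi N (i - 1) _) hr]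
          by_cases hr' : r = y
          · rw [if_pos hr', hr']; simp
          · rw [if_neg hr', hQ.zero r _ hr']; simp
      · rw [if_neg hb, Matrix.single_apply_of_ne]
        · by_cases hr : r = τ s
          · subst hr; simp
          · rw [if_neg hr, hQ.zero r _ hr]; simp
        · rintro ⟨_, h⟩
          have := τ.injective h
          exact hb (by rw [← this])

theorem IsMono.mul_diagonal {τ : Equiv.Perm (Fin (N + 1))} {Q : Mat p N} (hQ : IsMono τ Q)
    (f : Fin (N + 1) → ℚ_[p]) :
    Q * Matrix.diagonal f = Matrix.diagonal (fun x => f (τ.symm x)) * Q := by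
  ext r s
  rw [Matrix.mul_diagonal, Matrix.diagonal_mul]
  by_cases hr : r = τ s
  · subst hr; rw [Equiv.symm_apply_apply, mul_comm]
  · rw [hQ.zero r s hr, zero_mul, mul_zero]

theorem IsMono.diagonal_mul {τ : Equiv.Perm (Fin (N + 1))} {Q : Mat p N} (hQ : IsMono τ Q)
    {t : Fin (N + 1) → ℚ_[p]} (ht : ∀ i, t i ≠ 0) : IsMono τ (Matrix.diagonal t * Q) := by
  refine ⟨fun x y h => ?_, fun y => ?_⟩
  · rw [Matrix.diagonal_mul, hQ.zero x y h, mul_zero]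
  · rw [Matrix.diagonal_mul]; exact mul_ne_zero (ht _) (hQ.ne_zero y)

theorem IsMono.mul_bSimple_zero {τ : Equiv.Perm (Fin (N + 1))} {Q : Mat p N} (hQ : IsMono τ Q)
    {i : ℕ} (h1 : 1 ≤ i) (h2 : i ≤ N) :
    IsMono (τ * Equiv.swap (fi N (i - 1) (by omega)) (fi N i (by omega)))
      (Q * bSimple N i (0 : ℚ_[p])) := by
  have hv : ∀ r s, (Q * bSimple N i (0 : ℚ_[p])) r s =
      if (s : ℕ) + 1 = i then Q r (fi N i (by omega))
      else if (s : ℕ) = i then - Q r (fi N (i - 1) (by omega)) else Q r s := by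
    intro r s
    rw [bSimple_eq, mul_phi_apply h1 h2]
    simp [bTwo, mu_zero, dPart_zero, epsPart_zero, cPart_zero]
  refine ⟨fun r s h => ?_, fun s => ?_⟩
  · rw [hv]
    rw [Equiv.Perm.mul_apply] at h
    split_ifs with ha hb
    · rw [show s = fi N (i - 1) (by omega) from Fin.ext (by simp; omega),
        Equiv.swap_apply_left] at h
      exact hQ.zero _ _ h
    · rw [show s = fi N i (by omega) from Fin.ext hb, Equiv.swap_apply_right] at h
      rw [hQ.zero _ _ h, neg_zero]
    · rw [Equiv.swap_apply_of_ne_of_ne] at h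
      · exact hQ.zero _ _ h
      · intro e; apply ha; rw [e]; simp; omega
      · intro e; apply hb; rw [e]
  · rw [hv, Equiv.Perm.mul_apply]
    split_ifs with ha hb
    · rw [show s = fi N (i - 1) (by omega) from Fin.ext (by simp; omega),
        Equiv.swap_apply_left]
      exact hQ.ne_zero _
    · rw [show s = fi N i (by omega) from Fin.ext hb, Equiv.swap_apply_right]
      exact neg_ne_zero.mpr (hQ.ne_zero _)
    · rw [Equiv.swap_apply_of_ne_of_ne]
      · exact hQ.ne_zero _
      · intro e; apply ha; rw [e]; simp; omega
      · intro e; apply hb; rw [e]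

/-- This is the SL_2 decomposition (1 z; 0 1) b(a) = (1 e; 0 1) diag(p^{-μ}, p^μ) b(0) (1 a; 0 1)
with e = z + d p^{-μ}. The first matrix is the inverse of the product in front of (1 a; 0 1), as
`bTwo_upper_left` confirms. -/
theorem bTwo_upper (a z : ℚ_[p]) :
    !![0, (p : ℚ_[p]) ^ (-(mu a : ℤ)); -(p : ℚ_[p]) ^ mu a,
        (z + dPart a * (p : ℚ_[p]) ^ (-(mu a : ℤ))) * (p : ℚ_[p]) ^ mu a] *
      !![1, z; 0, 1] * bTwo a = !![1, a; 0, 1] := by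
  have h1 := dPart_mul_cPart a
  have h2 := epsPart_mul_pow a
  have h3 : (p : ℚ_[p]) ^ (-(mu a : ℤ)) * (p : ℚ_[p]) ^ mu a = 1 := by
    rw [zpow_neg, zpow_natCast, inv_mul_cancel₀ (pow_ne_zero _ p_ne_zero)]
  have h4 := cPart_eq a
  rw [bTwo, Matrix.mul_fin_two, Matrix.mul_fin_two]
  congr 1
  simp only [Matrix.vecCons_inj, and_true]
  refine ⟨⟨?_, ?_⟩, ?_, ?_⟩
  · linear_combination h3
  · rw [h4]; linear_combination a * h3
  · linear_combination (dPart a * (p : ℚ_[p]) ^ mu a) * h3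
  · linear_combination h1 - h2 + (dPart a * cPart a) * h3

theorem bTwo_upper_left (m : ℕ) (e : ℚ_[p]) :
    !![1, e; 0, 1] * (!![(p : ℚ_[p]) ^ (-(m : ℤ)), 0; 0, (p : ℚ_[p]) ^ m] * bTwo 0) *
      !![0, (p : ℚ_[p]) ^ (-(m : ℤ)); -(p : ℚ_[p]) ^ m, e * (p : ℚ_[p]) ^ m] = 1 := by
  have h3 : (p : ℚ_[p]) ^ (-(m : ℤ)) * (p : ℚ_[p]) ^ m = 1 := by
    rw [zpow_neg, zpow_natCast, inv_mul_cancel₀ (pow_ne_zero _ p_ne_zero)]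
  rw [bTwo, mu_zero, dPart_zero, epsPart_zero, cPart_zero, Matrix.mul_fin_two, Matrix.mul_fin_two,
    Matrix.mul_fin_two, Matrix.one_fin_two]
  congr 1
  simp only [Matrix.vecCons_inj, and_true]
  refine ⟨⟨?_, ?_⟩, ?_, ?_⟩
  · linear_combination h3
  · linear_combination 0 * h3
  · ring
  · linear_combination h3

/-- The diagonal entries attached to an exponent function. -/
def torus (p : ℕ) [Fact p.Prime] (N : ℕ) (E : ℕ → ℤ) : Fin (N + 1) → ℚ_[p] :=
  fun x => (p : ℚ_[p]) ^ (E (x : ℕ) - E ((x : ℕ) + 1))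

theorem torus_ne_zero (E : ℕ → ℤ) (x : Fin (N + 1)) : torus p N E x ≠ 0 :=
  zpow_ne_zero _ p_ne_zero

theorem torus_add (E F : ℕ → ℤ) (x : Fin (N + 1)) :
    torus p N (fun l => E l + F l) x = torus p N E x * torus p N F x := by
  rw [torus, torus, torus, ← zpow_add₀ p_ne_zero]
  congr 1; ring

/-- One letter of a reduced word. The SL_2 decomposition is applied to the α_i-entry of R: its upper
part crosses the monomial factor into U because τ(α_i) is positive, and its torus part becomes p^μ
along the coroot of τ(α_i). -/
theorem bruhat_step {τ : Equiv.Perm (Fin (N + 1))} {P : Mat p N} (hP : IsMono τ P)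
    (E : ℕ → ℤ) {i : ℕ} (h1 : 1 ≤ i) (h2 : i ≤ N)
    (hlt : τ (fi N (i - 1) (by omega)) < τ (fi N i (by omega))) (a : ℚ_[p])
    {R : Mat p N} (hR : R ∈ U p N) :
    ∃ L' ∈ U p N, ∃ R' ∈ U p N,
      (Matrix.diagonal (torus p N E) * P) * R * bSimple N i a =
        L' * (Matrix.diagonal (torus p N (fun l => E l +
          if ((τ (fi N (i - 1) (by omega)) : Fin (N + 1)) : ℕ) + 1 ≤ l ∧
            l < ((τ (fi N i (by omega)) : Fin (N + 1)) : ℕ) + 1 then (mu a : ℤ) else 0)) *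
          (P * bSimple N i 0)) * R' := by
  have hQ := hP.diagonal_mul (torus_ne_zero (p := p) (N := N) E)
  obtain ⟨hR', -⟩ := phi_mul_mul_phi_mem_U h1 h2 hR
    (bTwo_upper a (R ⟨i - 1, by omega⟩ ⟨i, by omega⟩))
  set e := R ⟨i - 1, by omega⟩ ⟨i, by omega⟩ + dPart a * (p : ℚ_[p]) ^ (-(mu a : ℤ)) with he
  obtain ⟨X, hX, hXQ⟩ := hQ.mul_upper h1 h2 hlt e
  refine ⟨X, hX, _, hR', ?_⟩
  set A : Matrix (Fin 2) (Fin 2) ℚ_[p] :=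
    !![0, (p : ℚ_[p]) ^ (-(mu a : ℤ)); -(p : ℚ_[p]) ^ mu a, e * (p : ℚ_[p]) ^ mu a] with hA
  set H : Matrix (Fin 2) (Fin 2) ℚ_[p] :=
    !![(p : ℚ_[p]) ^ (-(mu a : ℤ)), 0; 0, (p : ℚ_[p]) ^ mu a] with hH
  -- This identity is inserted in front of R. Its first factor moves left through the monomial
  -- matrix, and its last one combines with R and b(a) to the new right factor.
  have key : phi N i !![1, e; 0, 1] * (phi N i H * phi N i (bTwo 0)) * phi N i A = 1 := by
    rw [phi_mul_phi h1 h2, phi_mul_phi h1 h2, phi_mul_phi h1 h2, hA, hH, bTwo_upper_left, phi_one]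
  have hdiag : phi N i H = Matrix.diagonal (fun x : Fin (N + 1) =>
      if (x : ℕ) + 1 = i then (p : ℚ_[p]) ^ (-(mu a : ℤ)) else
        if (x : ℕ) = i then (p : ℚ_[p]) ^ mu a else 1) := by
    ext r s
    rw [phi, Matrix.of_apply, Matrix.diagonal_apply]
    by_cases hrs : r = s
    · subst hrs
      by_cases ha : (r : ℕ) + 1 = i
      · simp [ha, hH]
      · by_cases hb : (r : ℕ) = i
        · simp [hb, hH]
        · simp [ha, hb]
    · have hrs' : (r : ℕ) ≠ s := fun h => hrs (Fin.ext h)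
      rw [if_neg hrs]
      split_ifs <;> first | omega | simp [hH]
  have hPH : P * phi N i H = Matrix.diagonal (torus p N (fun l =>
      if ((τ (fi N (i - 1) (by omega)) : Fin (N + 1)) : ℕ) + 1 ≤ l ∧
            l < ((τ (fi N i (by omega)) : Fin (N + 1)) : ℕ) + 1 then (mu a : ℤ) else 0)) * P := by
    rw [hdiag, hP.mul_diagonal]
    congr 2
    funext x
    obtain ⟨y, rfl⟩ := τ.surjective x
    rw [Equiv.symm_apply_apply, torus]
    have hlt' := hlt
    rw [Fin.lt_def] at hlt'
    by_cases ha : (y : ℕ) + 1 = i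
    · have ey : y = fi N (i - 1) (by omega) := Fin.ext (by simp; omega)
      rw [if_pos ha, ey, if_neg (by omega), if_pos (by omega), zero_sub]
    · by_cases hb : (y : ℕ) = i
      · have ey : y = fi N i (by omega) := Fin.ext hb
        rw [if_neg ha, if_pos hb, ey, if_pos (by omega), if_neg (by omega), sub_zero, zpow_natCast]
      · rw [if_neg ha, if_neg hb]
        have n1 : ((τ y : Fin (N + 1)) : ℕ) ≠ τ (fi N (i - 1) (by omega)) := by
          intro h
          have := τ.injective (Fin.ext h)
          exact ha (by rw [this]; simp; omega)
        have n2 : ((τ y : Fin (N + 1)) : ℕ) ≠ τ (fi N i (by omega)) := by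
          intro h
          have := τ.injective (Fin.ext h)
          exact hb (by rw [this])
        split_ifs <;> first | omega | simp
  have htor : Matrix.diagonal (torus p N (fun l => E l +
      if ((τ (fi N (i - 1) (by omega)) : Fin (N + 1)) : ℕ) + 1 ≤ l ∧
            l < ((τ (fi N i (by omega)) : Fin (N + 1)) : ℕ) + 1 then (mu a : ℤ) else 0)) =
      Matrix.diagonal (torus p N E) * Matrix.diagonal (torus p N (fun l =>
      if ((τ (fi N (i - 1) (by omega)) : Fin (N + 1)) : ℕ) + 1 ≤ l ∧
            l < ((τ (fi N i (by omega)) : Fin (N + 1)) : ℕ) + 1 then (mu a : ℤ) else 0)) := by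
    rw [Matrix.diagonal_mul_diagonal]
    congr 1
    funext x
    exact torus_add _ _ x
  rw [htor, bSimple_eq, bSimple_eq]
  set D := Matrix.diagonal (torus p N E) with hD
  calc D * P * R * phi N i (bTwo a)
      = D * P * (phi N i !![1, e; 0, 1] * (phi N i H * phi N i (bTwo 0)) * phi N i A) * R *
          phi N i (bTwo a) := by rw [key, Matrix.mul_one]
    _ = (D * P * phi N i !![1, e; 0, 1]) * phi N i H * phi N i (bTwo 0) *
          (phi N i A * R * phi N i (bTwo a)) := by simp only [Matrix.mul_assoc]
    _ = X * D * (P * phi N i H) * phi N i (bTwo 0) * (phi N i A * R * phi N i (bTwo a)) := by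
          rw [← hXQ]; simp only [Matrix.mul_assoc]
    _ = _ := by rw [hPH]; simp only [Matrix.mul_assoc]

/-- τ is the restriction of σ to the matrix indices, counted from 0 instead of 1. Arbitrary initial
E and R are needed because both change with every letter. -/
theorem bruhat_bAlong (a : ℕ × ℕ → ℚ_[p]) (ws : List ℕ) (σ : Equiv.Perm ℕ)
    (hred : RedAlong N ws σ) {τ : Equiv.Perm (Fin (N + 1))}
    (hτ : ∀ y : Fin (N + 1), ((τ y : Fin (N + 1)) : ℕ) + 1 = σ ((y : ℕ) + 1))
    {P : Mat p N} (hP : IsMono τ P) (E : ℕ → ℤ) {R : Mat p N} (hR : R ∈ U p N) :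
    ∃ L' ∈ U p N, ∃ R' ∈ U p N,
      (Matrix.diagonal (torus p N E) * P) * R * bAlong N a ws σ =
        L' * (Matrix.diagonal (torus p N (fun l => E l + expoAlong a ws σ l)) *
          (P * bAlong N 0 ws σ)) * R' := by
  induction ws generalizing σ τ P E R with
  | nil =>
    refine ⟨1, one_mem_U, R, hR, ?_⟩
    simp [bAlong, expoAlong]
  | cons i ws ih =>
    obtain ⟨⟨h1, h2, h3⟩, h4⟩ := hred
    have t1 := hτ (fi N (i - 1) (by omega))
    have t2 := hτ (fi N i (by omega))
    rw [show (((fi N (i - 1) (by omega) : Fin (N + 1)) : ℕ) + 1) = i by simp; omega] at t1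
    obtain ⟨L1, hL1, R1, hR1, e1⟩ := bruhat_step hP E h1 h2
      (by rw [Fin.lt_def]; simp only at t2; omega) (a (σ i, σ (i + 1) - 1)) hR
    obtain ⟨L2, hL2, R2, hR2, e2⟩ := ih (σ * Equiv.swap i (i + 1)) h4
      (τ := τ * Equiv.swap (fi N (i - 1) (by omega)) (fi N i (by omega)))
      (fun y => by
        rw [Equiv.Perm.mul_apply, Equiv.Perm.mul_apply, hτ]
        congr 1
        by_cases ha : (y : ℕ) + 1 = i
        · rw [show y = fi N (i - 1) (by omega) from Fin.ext (by simp; omega),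
            Equiv.swap_apply_left, show (((fi N (i - 1) (by omega) : Fin (N + 1)) : ℕ) + 1) = i by
              simp; omega, Equiv.swap_apply_left]
        · by_cases hb : (y : ℕ) = i
          · rw [show y = fi N i (by omega) from Fin.ext hb,
              Equiv.swap_apply_right, Equiv.swap_apply_right]
            simp; omega
          · rw [Equiv.swap_apply_of_ne_of_ne, Equiv.swap_apply_of_ne_of_ne]
            · exact ha
            · omega
            · intro e; apply ha; rw [e]; simp; omega
            · intro e; apply hb; rw [e])
      (hP.mul_bSimple_zero h1 h2)
      (fun l => E l + if ((τ (fi N (i - 1) (by omega)) : Fin (N + 1)) : ℕ) + 1 ≤ l ∧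
            l < ((τ (fi N i (by omega)) : Fin (N + 1)) : ℕ) + 1 then
              (mu (a (σ i, σ (i + 1) - 1)) : ℤ) else 0) hR1
    refine ⟨L1 * L2, mul_mem_U hL1 hL2, R2, hR2, ?_⟩
    rw [bAlong, ← Matrix.mul_assoc, e1, Matrix.mul_assoc L1, Matrix.mul_assoc L1, e2, bAlong]
    have : (fun l => E l + expoAlong a (i :: ws) σ l) = fun l => (E l +
        if ((τ (fi N (i - 1) (by omega)) : Fin (N + 1)) : ℕ) + 1 ≤ l ∧
            l < ((τ (fi N i (by omega)) : Fin (N + 1)) : ℕ) + 1 then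
              (mu (a (σ i, σ (i + 1) - 1)) : ℤ) else 0) +
          expoAlong a ws (σ * Equiv.swap i (i + 1)) l := by
      funext l
      rw [expoAlong, t1, t2, add_assoc]
    rw [this]
    simp only [Matrix.mul_assoc]
    rfl

/-- The Bruhat decomposition of `b(a)` for two blocks. -/
theorem bruhat_pair {n : ℕ} (a : ℕ × ℕ → ℚ_[p]) (k q : ℕ) (h : k + q = n + 1) :
    ∃ L R, L ∈ U p n ∧ R ∈ Uw p n [k, q] ∧
      bMap n [k, q] a = L * (Matrix.diagonal (torus p n (fun l =>
        ∑ i ∈ Finset.range k, ∑ u ∈ Finset.range q,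
          if i + 1 ≤ l ∧ l ≤ k + u then (mu (a (i + 1, k + u)) : ℤ) else 0)) *
            weyl p n [k, q]) * R := by
  have hs : [k, q].sum = n + 1 := by simp; omega
  obtain ⟨-, hred, hexp⟩ := along_grassW (N := n) a k q k (by omega) le_rfl 1
    (fun _ _ _ => rfl) (fun _ _ => rfl)
  have hone : IsMono (1 : Equiv.Perm (Fin (n + 1))) (1 : Mat p n) :=
    ⟨fun x y h => Matrix.one_apply_ne h, fun y => by
      rw [Equiv.Perm.one_apply, Matrix.one_apply_eq]; exact one_ne_zero⟩
  obtain ⟨L', hL', R', hR', e⟩ := bruhat_bAlong a (grassW k q) 1 hred (τ := 1)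
    (fun y => rfl) hone (fun _ => 0) (one_mem_U (p := p) (N := n))
  -- The word only produces a right factor in U. Its component in U ∩ w⁻¹Uw is now moved to the left
  -- factor.
  obtain ⟨A, R, hAR, hA, hR, hA0⟩ := exists_factor_Uw hs hR'
  set t := torus p n (fun l => ∑ i ∈ Finset.range k, ∑ u ∈ Finset.range q,
          if i + 1 ≤ l ∧ l ≤ k + u then (mu (a (i + 1, k + u)) : ℤ) else 0) with ht
  have e' : bMap n [k, q] a = L' * (Matrix.diagonal t * weyl p n [k, q]) * R' := by
    have h0 : torus p n (fun _ => 0) = fun _ => 1 := by funext x; simp [torus]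
    have h1 : (fun l => 0 + expoAlong a (grassW k q) 1 l) = fun l =>
        ∑ i ∈ Finset.range k, ∑ u ∈ Finset.range q,
          if i + 1 ≤ l ∧ l ≤ k + u then (mu (a (i + 1, k + u)) : ℤ) else 0 := by
      funext l; rw [zero_add, hexp]
    rw [h0, h1, Matrix.diagonal_one, Matrix.one_mul, Matrix.one_mul, Matrix.one_mul,
      Matrix.one_mul] at e
    rw [weyl_pair k q h, bMap, bMap, redWord_pair]
    exact e
  have hC := cell_conj_mem_U hs (t := t) (torus_ne_zero _) hA hA0
  refine ⟨_, R, mul_mem_U hL' hC, hR, ?_⟩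
  rw [e', hAR]
  set C := Matrix.diagonal t * weyl p n [k, q] with hCdef
  have hCu : C⁻¹ * C = 1 := Matrix.nonsing_inv_mul _ (isUnit_det_cell hs (torus_ne_zero _))
  calc L' * C * (A * R) = L' * (C * A * (C⁻¹ * C)) * R := by
        rw [hCu]; simp only [Matrix.mul_assoc, Matrix.one_mul]
    _ = _ := by simp only [Matrix.mul_assoc]

end Along

/-! ### Index sets -/

section Index

theorem kappa_merge (k q : ℕ) (rest : List ℕ) (l : ℕ) (hl : 1 ≤ l) :
    kappa (k :: q :: rest) (l + 1) = kappa ((k + q) :: rest) l := by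
  obtain ⟨l, rfl⟩ := Nat.exists_eq_add_of_le' hl
  simp [kappa, add_assoc]

theorem indexBlock_merge (k q : ℕ) (rest : List ℕ) (l : ℕ) (hl : 1 ≤ l) :
    indexBlock (k :: q :: rest) (l + 1) = indexBlock ((k + q) :: rest) l := by
  rw [indexBlock, indexBlock, kappa_merge _ _ _ _ hl, kappa_merge _ _ _ _ (by omega)]

theorem indexBlock_one (k q : ℕ) (rest : List ℕ) :
    indexBlock (k :: q :: rest) 1 = {x | 1 ≤ x.1 ∧ x.1 ≤ k ∧ k ≤ x.2 ∧ x.2 + 1 ≤ k + q} := by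
  simp [indexBlock, kappa]

theorem mem_indexSet {bs : List ℕ} {x : ℕ × ℕ} :
    x ∈ indexSet bs ↔ ∃ l, (1 ≤ l ∧ l < bs.length) ∧ x ∈ indexBlock bs l := by
  simp [indexSet]

theorem indexSet_singleton (K : ℕ) : indexSet [K] = ∅ := by
  ext x
  rw [mem_indexSet]
  simp only [List.length_cons, List.length_nil, Set.mem_empty_iff_false, iff_false]
  rintro ⟨l, h, _⟩; omega

theorem mem_indexSet_pair {k q : ℕ} {x : ℕ × ℕ} :
    x ∈ indexSet [k, q] ↔ 1 ≤ x.1 ∧ x.1 ≤ k ∧ k ≤ x.2 ∧ x.2 + 1 ≤ k + q := by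
  rw [mem_indexSet]
  constructor
  · rintro ⟨l, hl, hx⟩
    have : l = 1 := by simp at hl; omega
    subst this
    rwa [indexBlock_one] at hx
  · intro h
    exact ⟨1, by simp, by rw [indexBlock_one]; exact h⟩

/-- I_1 of w is I_1 of [k, q], and I_{l+1} of w is I_l of the merged list, since the later partial
sums of the block sizes do not change. -/
theorem indexSet_merge (k q : ℕ) (rest : List ℕ) :
    indexSet (k :: q :: rest) = indexSet ((k + q) :: rest) ∪ indexSet [k, q] := by
  ext x
  rw [Set.mem_union, mem_indexSet, mem_indexSet, mem_indexSet_pair]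
  constructor
  · rintro ⟨l, hl, hx⟩
    rcases Nat.eq_or_lt_of_le hl.1 with rfl | h
    · right; rwa [indexBlock_one] at hx
    · left
      obtain ⟨l', rfl⟩ := Nat.exists_eq_add_of_le' hl.1
      refine ⟨l', ⟨by omega, by simp at hl ⊢; omega⟩, ?_⟩
      rwa [← indexBlock_merge _ _ _ _ (by omega)]
  · rintro (⟨l, hl, hx⟩ | h)
    · refine ⟨l + 1, ⟨by omega, by simp at hl ⊢; omega⟩, ?_⟩
      rwa [indexBlock_merge _ _ _ _ hl.1]
    · exact ⟨1, ⟨le_rfl, by simp⟩, by rw [indexBlock_one]; exact h⟩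

theorem kappa_le_sum (bs : List ℕ) (l : ℕ) : kappa bs l ≤ bs.sum :=
  (List.take_sublist l bs).sum_le_sum (by simp)

theorem bounds_of_mem_indexSet {K : ℕ} {rest : List ℕ} {x : ℕ × ℕ}
    (h : x ∈ indexSet (K :: rest)) :
    1 ≤ x.1 ∧ x.1 ≤ x.2 ∧ K ≤ x.2 ∧ x.2 + 1 ≤ (K :: rest).sum := by
  obtain ⟨l, hl, h1, h2, h3, h4⟩ := mem_indexSet.mp h
  refine ⟨h1, h2.trans h3, ?_, h4.trans (kappa_le_sum _ _)⟩
  refine le_trans ?_ h3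
  obtain ⟨l', rfl⟩ := Nat.exists_eq_add_of_le' hl.1
  simp [kappa]

theorem disjoint_indexSet (k q : ℕ) (rest : List ℕ) :
    Disjoint (indexSet ((k + q) :: rest)) (indexSet [k, q]) := by
  rw [Set.disjoint_left]
  intro x h1 h2
  have := bounds_of_mem_indexSet h1
  have := mem_indexSet_pair.mp h2
  omega

/-- The first K rows of the index set have no gaps in the second index. This turns torus exponents
at small l into plain double sums. -/
theorem mem_indexSet_of_le : ∀ (rest : List ℕ) (K : ℕ) {x : ℕ × ℕ}, 1 ≤ x.1 → x.1 ≤ K →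
    K ≤ x.2 → x.2 + 1 ≤ (K :: rest).sum → x ∈ indexSet (K :: rest)
  | [], K, x, _, _, h3, h4 => by simp at h4; omega
  | q :: rest, K, x, h1, h2, h3, h4 => by
      rw [indexSet_merge]
      by_cases h : x.2 + 1 ≤ K + q
      · exact Or.inr (mem_indexSet_pair.mpr ⟨h1, h2, h3, h⟩)
      · left
        refine mem_indexSet_of_le rest (K + q) h1 (by omega) (by omega) ?_
        simpa [add_assoc] using h4

variable {p : ℕ} [Fact p.Prime] {N n : ℕ}

open Classical in
/-- The sum of the `μ(a_{i,j})` over the `(i, j)` in the index set with `i ≤ l ≤ j`. -/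
def expoSet (N : ℕ) (bs : List ℕ) (a : ℕ × ℕ → ℚ_[p]) (l : ℕ) : ℤ :=
  ∑ x ∈ (Finset.range (N + 1) ×ˢ Finset.range (N + 1)).filter
    (fun x => x ∈ indexSet bs ∧ x.1 ≤ l ∧ l ≤ x.2), (mu (a x) : ℤ)

theorem expoSet_eq_zero {N : ℕ} {bs : List ℕ} (a : ℕ × ℕ → ℚ_[p]) {l : ℕ} (hl : N < l) :
    expoSet N bs a l = 0 := by
  rw [expoSet]
  apply Finset.sum_eq_zero
  intro x hx
  simp only [Finset.mem_filter, Finset.mem_product, Finset.mem_range] at hx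
  omega

theorem expoSet_zero {N K : ℕ} {rest : List ℕ} (a : ℕ × ℕ → ℚ_[p]) :
    expoSet N (K :: rest) a 0 = 0 := by
  rw [expoSet]
  apply Finset.sum_eq_zero
  intro x hx
  simp only [Finset.mem_filter, Finset.mem_product, Finset.mem_range] at hx
  have := bounds_of_mem_indexSet hx.2.1
  omega

theorem expoSet_singleton {N K : ℕ} (a : ℕ × ℕ → ℚ_[p]) (l : ℕ) : expoSet N [K] a l = 0 := by
  rw [expoSet]
  apply Finset.sum_eq_zero
  intro x hx
  simp only [Finset.mem_filter, indexSet_singleton] at hx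
  exact absurd hx.2.1 (Set.notMem_empty x)

theorem expoSet_merge (a : ℕ × ℕ → ℚ_[p]) (k q : ℕ) (rest : List ℕ) (h : k + q = n + 1)
    (hnN : n ≤ N) (l : ℕ) :
    expoSet N (k :: q :: rest) a l = expoSet N ((k + q) :: rest) a l + expoSet n [k, q] a l := by
  classical
  rw [expoSet, expoSet, expoSet, ← Finset.sum_union]
  · apply Finset.sum_congr _ fun _ _ => rfl
    ext x
    rw [indexSet_merge k q rest]
    simp only [Finset.mem_filter, Finset.mem_union, Finset.mem_product, Finset.mem_range,
      Set.mem_union, mem_indexSet_pair]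
    constructor
    · rintro ⟨h1, h2 | h2, h3⟩
      · exact Or.inl ⟨h1, h2, h3⟩
      · exact Or.inr ⟨by omega, h2, h3⟩
    · rintro (⟨h1, h2, h3⟩ | ⟨h1, h2, h3⟩)
      · exact ⟨h1, Or.inl h2, h3⟩
      · exact ⟨by omega, Or.inr h2, h3⟩
  · rw [Finset.disjoint_left]
    intro x hx hx'
    simp only [Finset.mem_filter] at hx hx'
    exact Set.disjoint_left.mp (disjoint_indexSet k q rest) hx.2.1 hx'.2.1

theorem expoSet_pair (a : ℕ × ℕ → ℚ_[p]) (k q : ℕ) (h : k + q = n + 1) (l : ℕ) :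
    expoSet n [k, q] a l = ∑ i ∈ Finset.range k, ∑ u ∈ Finset.range q,
      if i + 1 ≤ l ∧ l ≤ k + u then (mu (a (i + 1, k + u)) : ℤ) else 0 := by
  classical
  rw [expoSet, ← Finset.sum_product', ← Finset.sum_filter]
  refine Finset.sum_nbij' (fun x => (x.1 - 1, x.2 - k)) (fun y => (y.1 + 1, k + y.2)) ?_ ?_ ?_ ?_ ?_
  · intro x hx
    simp only [Finset.mem_filter, Finset.mem_product, Finset.mem_range, mem_indexSet_pair] at hx ⊢
    omega
  · intro x hx
    simp only [Finset.mem_filter, Finset.mem_product, Finset.mem_range, mem_indexSet_pair] at hx ⊢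
    omega
  · rintro ⟨x, y⟩ hx
    simp only [Finset.mem_filter, Finset.mem_product, Finset.mem_range, mem_indexSet_pair] at hx ⊢
    simp only [Prod.mk.injEq]
    omega
  · rintro ⟨x, y⟩ hx
    simp
  · rintro ⟨x, y⟩ hx
    simp only [Finset.mem_filter, Finset.mem_product, Finset.mem_range, mem_indexSet_pair] at hx ⊢
    rw [show x - 1 + 1 = x by omega, show k + (y - k) = y by omega]

theorem rowMat_congr (i q : ℕ) (a a' : ℕ → ℚ_[p]) (h : ∀ u < q, a u = a' u) :
    rowMat N i q a = rowMat N i q a' := by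
  induction q generalizing i a a' with
  | zero => rfl
  | succ q ih =>
    rw [rowMat, rowMat, h 0 (by omega), ih (i + 1) _ _ (fun u hu => h (u + 1) (by omega))]

theorem grassMat_congr (q k : ℕ) (A A' : ℕ → ℕ → ℚ_[p]) (h : ∀ i < k, ∀ u < q, A i u = A' i u) :
    grassMat N q A k = grassMat N q A' k := by
  induction k with
  | zero => rfl
  | succ k ih =>
    rw [grassMat, grassMat, ih (fun i hi => h i (by omega)),
      rowMat_congr _ _ _ _ (h k (by omega))]

theorem bMap_pair_congr {k q : ℕ} (h : k + q = n + 1) {a a' : ℕ × ℕ → ℚ_[p]}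
    (haa : ∀ x ∈ indexSet [k, q], a x = a' x) : bMap n [k, q] a = bMap n [k, q] a' := by
  rw [bMap_pair _ _ _ h, bMap_pair _ _ _ h]
  apply grassMat_congr
  intro i hi u hu
  apply haa
  rw [mem_indexSet_pair]
  simp only
  omega

/-- That only labels in I_w occur follows from the merge by induction; the roots of the full word
are never enumerated. -/
theorem bMap_congr : ∀ (rest : List ℕ) (K : ℕ), 1 ≤ K → (K :: rest).sum = N + 1 →
    ∀ {a a' : ℕ × ℕ → ℚ_[p]}, (∀ x ∈ indexSet (K :: rest), a x = a' x) →
    bMap N (K :: rest) a = bMap N (K :: rest) a'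
  | [], K, _, _, a, a', _ => by rw [bMap_singleton, bMap_singleton]
  | q :: rest, K, hK, hs, a, a', haa => by
      have hs' : ((K + q) :: rest).sum = N + 1 := by simp at hs ⊢; omega
      have hn : K + q = (K + q - 1) + 1 := by omega
      rw [bMap_merge a K q rest hn hs, bMap_merge a' K q rest hn hs]
      rw [indexSet_merge] at haa
      rw [bMap_congr rest (K + q) (by omega) hs' (fun x hx => haa x (Or.inl hx)),
        bMap_pair_congr hn (fun x hx => haa x (Or.inr hx))]

theorem expoSet_congr {bs : List ℕ} {a a' : ℕ × ℕ → ℚ_[p]}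
    (haa : ∀ x ∈ indexSet bs, mu (a x) = mu (a' x)) (l : ℕ) :
    expoSet N bs a l = expoSet N bs a' l := by
  rw [expoSet, expoSet]
  apply Finset.sum_congr rfl
  intro x hx
  simp only [Finset.mem_filter] at hx
  rw [haa x hx.2.1]

end Index

/-! ### Bruhat decompositions and merging of the two top blocks -/

section Merge

variable {p : ℕ} [Fact p.Prime] {N n : ℕ}

theorem mem_U_of_toB (h : n ≤ N) {u : Mat p N} {A : Matrix (Fin (N - n)) (Fin (N - n)) ℚ_[p]}
    {B : Matrix (Fin (N - n)) (Fin (n + 1)) ℚ_[p]} {D : Mat p n}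
    (hu : toB h u = Matrix.fromBlocks A B 0 D) :
    u ∈ U p N ↔ ((∀ i, A i i = 1) ∧ ∀ i j, j < i → A i j = 0) ∧ D ∈ U p n := by
  have h11 : ∀ i j, u (blockEquiv h (Sum.inl i)) (blockEquiv h (Sum.inl j)) = A i j :=
    fun i j => congrFun (congrFun hu (Sum.inl i)) (Sum.inl j)
  have h21 : ∀ i j, u (blockEquiv h (Sum.inr i)) (blockEquiv h (Sum.inl j)) = 0 :=
    fun i j => congrFun (congrFun hu (Sum.inr i)) (Sum.inl j)
  have h22 : ∀ i j, u (blockEquiv h (Sum.inr i)) (blockEquiv h (Sum.inr j)) = D i j :=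
    fun i j => congrFun (congrFun hu (Sum.inr i)) (Sum.inr j)
  constructor
  · rintro ⟨h1, h2⟩
    refine ⟨⟨fun i => by rw [← h11, h1], fun i j hij => ?_⟩, fun i => by rw [← h22, h1],
      fun i j hij => ?_⟩
    · rw [← h11]; apply h2; rw [Fin.lt_def, blockEquiv_inl, blockEquiv_inl]; exact hij
    · rw [← h22]; apply h2; rw [Fin.lt_def, blockEquiv_inr, blockEquiv_inr]
      rw [Fin.lt_def] at hij; omega
  · rintro ⟨⟨a1, a2⟩, d1, d2⟩
    refine ⟨fun i => ?_, fun i j hij => ?_⟩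
    · obtain ⟨i, rfl⟩ := (blockEquiv h).surjective i
      rcases i with i | i
      · rw [h11, a1]
      · rw [h22, d1]
    · obtain ⟨i, rfl⟩ := (blockEquiv h).surjective i
      obtain ⟨j, rfl⟩ := (blockEquiv h).surjective j
      rw [Fin.lt_def] at hij
      rcases i with i | i <;> rcases j with j | j <;>
        simp only [blockEquiv_inl, blockEquiv_inr] at hij
      · rw [h11]; exact a2 _ _ hij
      · omega
      · exact h21 _ _
      · rw [h22]; exact d2 _ _ (by rw [Fin.lt_def]; omega)

theorem exists_toB_of_mem_U (h : n ≤ N) {u : Mat p N} (hu : u ∈ U p N) :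
    ∃ A B D, toB h u = Matrix.fromBlocks A B 0 D := by
  refine ⟨(toB h u).toBlocks₁₁, (toB h u).toBlocks₁₂, (toB h u).toBlocks₂₂, ?_⟩
  have : (toB h u).toBlocks₂₁ = 0 := by
    ext i j
    apply hu.2
    rw [Fin.lt_def, blockEquiv_inl, blockEquiv_inr]
    omega
  rw [← this, Matrix.fromBlocks_toBlocks]

/-- The condition on the upper left block of an element of `U_w`. -/
def TopCond (bs : List ℕ) {M : ℕ} (A : Matrix (Fin M) (Fin M) ℚ_[p]) : Prop :=
  ∀ i j : Fin M, i < j → wcol bs i < wcol bs j → A i j = 0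

/-- w' keeps the order of the last n+1 columns, which kills the off-diagonal part of D, and moves
them above all other columns, which leaves B free. -/
theorem mem_Uw_merged_iff {K : ℕ} {rest : List ℕ} (hK : K = n + 1)
    (hs : (K :: rest).sum = N + 1) (h : n ≤ N) {u : Mat p N}
    {A : Matrix (Fin (N - n)) (Fin (N - n)) ℚ_[p]}
    {B : Matrix (Fin (N - n)) (Fin (n + 1)) ℚ_[p]} {D : Mat p n}
    (hu : toB h u = Matrix.fromBlocks A B 0 D) :
    u ∈ Uw p N (K :: rest) ↔
      ((∀ i, A i i = 1) ∧ ∀ i j, j < i → A i j = 0) ∧ TopCond (K :: rest) A ∧ D = 1 := by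
  have hM : rest.sum = N - n := by simp at hs; omega
  have h11 : ∀ i j, u (blockEquiv h (Sum.inl i)) (blockEquiv h (Sum.inl j)) = A i j :=
    fun i j => congrFun (congrFun hu (Sum.inl i)) (Sum.inl j)
  have h22 : ∀ i j, u (blockEquiv h (Sum.inr i)) (blockEquiv h (Sum.inr j)) = D i j :=
    fun i j => congrFun (congrFun hu (Sum.inr i)) (Sum.inr j)
  rw [mem_Uw_iff hs, mem_U_of_toB h hu]
  constructor
  · rintro ⟨⟨hA, hD⟩, h2⟩
    refine ⟨hA, fun i j hij hw => ?_, ?_⟩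
    · rw [← h11]
      apply h2
      · rw [Fin.lt_def, blockEquiv_inl, blockEquiv_inl]; exact hij
      · rw [blockEquiv_inl, blockEquiv_inl]; exact hw
    · ext i j
      rcases lt_trichotomy i j with hij | hij | hij
      · rw [Matrix.one_apply_ne hij.ne, ← h22]
        rw [Fin.lt_def] at hij
        apply h2
        · rw [Fin.lt_def, blockEquiv_inr, blockEquiv_inr]; omega
        · rw [blockEquiv_inr, blockEquiv_inr, wcol_merged_right _ _ (by omega),
            wcol_merged_right _ _ (by omega)]
          omega
      · subst hij; rw [hD.1, Matrix.one_apply_eq]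
      · rw [hD.2 _ _ hij, Matrix.one_apply_ne hij.ne']
  · rintro ⟨hA, hT, rfl⟩
    refine ⟨⟨hA, one_mem_U⟩, fun i j hij hw => ?_⟩
    obtain ⟨i, rfl⟩ := (blockEquiv h).surjective i
    obtain ⟨j, rfl⟩ := (blockEquiv h).surjective j
    rw [Fin.lt_def] at hij
    rcases i with i | i <;> rcases j with j | j <;>
      simp only [blockEquiv_inl, blockEquiv_inr] at hij hw
    · rw [h11]; exact hT _ _ hij hw
    · rw [wcol_merged_right _ _ (show rest.sum ≤ N - n + (j : ℕ) by omega)] at hw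
      have := wcol_merged_left K rest (show (i : ℕ) < rest.sum by omega)
      omega
    · omega
    · rw [h22, Matrix.one_apply_ne]
      rintro rfl; omega

theorem mem_Uw_split_iff {k q : ℕ} {rest : List ℕ} (hK : k + q = n + 1)
    (hs : (k :: q :: rest).sum = N + 1) (h : n ≤ N) {u : Mat p N}
    {A : Matrix (Fin (N - n)) (Fin (N - n)) ℚ_[p]}
    {B : Matrix (Fin (N - n)) (Fin (n + 1)) ℚ_[p]} {D : Mat p n}
    (hu : toB h u = Matrix.fromBlocks A B 0 D) :
    u ∈ Uw p N (k :: q :: rest) ↔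
      ((∀ i, A i i = 1) ∧ ∀ i j, j < i → A i j = 0) ∧ TopCond ((k + q) :: rest) A ∧
        D ∈ Uw p n [k, q] := by
  have hM : rest.sum = N - n := by simp at hs; omega
  have hv : [k, q].sum = n + 1 := by simp; omega
  have h11 : ∀ i j, u (blockEquiv h (Sum.inl i)) (blockEquiv h (Sum.inl j)) = A i j :=
    fun i j => congrFun (congrFun hu (Sum.inl i)) (Sum.inl j)
  have h22 : ∀ i j, u (blockEquiv h (Sum.inr i)) (blockEquiv h (Sum.inr j)) = D i j :=
    fun i j => congrFun (congrFun hu (Sum.inr i)) (Sum.inr j)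
  have hw1 : ∀ i : Fin (N - n), wcol (k :: q :: rest) i = wcol ((k + q) :: rest) i := by
    intro i; rw [wcol_merge, if_pos (by omega)]
  have hw2 : ∀ i : Fin (n + 1), wcol (k :: q :: rest) (N - n + i) = wcol [k, q] i := by
    intro i
    rw [wcol_merge, if_neg (by omega)]
    congr 1; omega
  rw [mem_Uw_iff hs, mem_U_of_toB h hu, mem_Uw_iff hv]
  constructor
  · rintro ⟨⟨hA, hD⟩, h2⟩
    refine ⟨hA, fun i j hij hw => ?_, hD, fun i j hij hw => ?_⟩
    · rw [← h11]
      apply h2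
      · rw [Fin.lt_def, blockEquiv_inl, blockEquiv_inl]; exact hij
      · rw [blockEquiv_inl, blockEquiv_inl, hw1, hw1]; exact hw
    · rw [← h22]
      rw [Fin.lt_def] at hij
      apply h2
      · rw [Fin.lt_def, blockEquiv_inr, blockEquiv_inr]; omega
      · rw [blockEquiv_inr, blockEquiv_inr, hw2, hw2]; exact hw
  · rintro ⟨hA, hT, hD, hD2⟩
    refine ⟨⟨hA, hD⟩, fun i j hij hw => ?_⟩
    obtain ⟨i, rfl⟩ := (blockEquiv h).surjective i
    obtain ⟨j, rfl⟩ := (blockEquiv h).surjective j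
    rw [Fin.lt_def] at hij
    rcases i with i | i <;> rcases j with j | j <;>
      simp only [blockEquiv_inl, blockEquiv_inr] at hij hw
    · rw [h11]; rw [hw1, hw1] at hw; exact hT _ _ hij hw
    · rw [hw1, hw2] at hw
      have := wcol_merged_left (k + q) rest (show (i : ℕ) < rest.sum by omega)
      have h3 : wcol [k, q] j < n + 1 := (wcol_lt [k, q] j (by rw [hv]; exact j.2)).trans_eq hv
      omega
    · omega
    · rw [h22]; rw [hw2, hw2] at hw; exact hD2 _ _ (by rw [Fin.lt_def]; omega) hw

theorem idSum_mem_U (h : n ≤ N) {L : Mat p n} (hL : L ∈ U p n) : idSum N L ∈ U p N := by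
  rw [mem_U_of_toB h (toB_idSum h L)]
  exact ⟨⟨fun i => Matrix.one_apply_eq i, fun i j hij => Matrix.one_apply_ne hij.ne'⟩, hL⟩

theorem idSum_inv (h : n ≤ N) {g : Mat p n} (hg : IsUnit g.det) :
    (idSum N g)⁻¹ = idSum N g⁻¹ := by
  apply Matrix.inv_eq_right_inv
  rw [← idSum_mul h, Matrix.mul_nonsing_inv _ hg, idSum_one h]

/-- The diagonal matrix entries of `I ⊕ diag(t)` moved to the top. -/
def extTop (N : ℕ) (t : Fin (n + 1) → ℚ_[p]) (x : Fin (N + 1)) : ℚ_[p] :=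
  if h : (x : ℕ) < n + 1 then t ⟨x, h⟩ else 1

/-- w' takes the last n+1 coordinates in order to the first n+1 ones, so a torus element of the
lower right block reappears at the top. -/
theorem weyl_mul_idSum_diagonal {K : ℕ} {rest : List ℕ} (hK : K = n + 1)
    (hs : (K :: rest).sum = N + 1) (h : n ≤ N) (t : Fin (n + 1) → ℚ_[p]) :
    weyl p N (K :: rest) * idSum N (Matrix.diagonal t) =
      Matrix.diagonal (extTop N t) * weyl p N (K :: rest) := by
  have hM : rest.sum = N - n := by simp at hs; omega
  ext x y
  obtain ⟨x, rfl⟩ := (wfin_bijective hs).2 x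
  rw [weyl_mul_apply, Matrix.diagonal_mul, weyl_apply_wfin]
  by_cases hx : (x : ℕ) < N - n
  · rw [idSum_apply_inl_left _ hx, extTop, dif_neg]
    · split_ifs with e
      · rw [mul_one, one_mul, e]
      · rw [mul_zero, mul_zero]
    · have := wcol_merged_left K rest (show (x : ℕ) < rest.sum by omega)
      simp only [wfin]; omega
  · obtain ⟨x', hx1, hx2⟩ := exists_inr_of_le h x (by omega)
    have hxw : ((wfin hs x : Fin (N + 1)) : ℕ) = x' := by
      simp only [wfin]; rw [wcol_merged_right _ _ (by omega)]; omega
    have hext : extTop N t (wfin hs x) = t x' := by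
      rw [extTop, dif_pos (by rw [hxw]; exact x'.2)]
      congr 1; exact Fin.ext hxw
    rw [hext]
    by_cases hy : (y : ℕ) < N - n
    · rw [idSum_apply_inl_right _ hy, if_neg (by rintro rfl; exact hx hy),
        if_neg (by rintro rfl; exact hx hy), mul_zero, mul_zero]
    · obtain ⟨y', hy1, hy2⟩ := exists_inr_of_le h y (by omega)
      rw [hx1, hy1, idSum_apply_inr, ← hx1, ← hy1, Matrix.diagonal_apply]
      by_cases e : x = y
      · have : x' = y' := Fin.ext (by rw [e] at hx2; omega)
        subst this
        rw [if_pos e, if_pos rfl, e, mul_comm]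
      · rw [if_neg e, if_neg]
        · rw [mul_zero, mul_zero]
        · rintro rfl; exact e (hx1.trans hy1.symm)

theorem conj_idSum_mem_U {K : ℕ} {rest : List ℕ} (hK : K = n + 1)
    (hs : (K :: rest).sum = N + 1) (h : n ≤ N) {t : Fin (N + 1) → ℚ_[p]} (ht : ∀ i, t i ≠ 0)
    {L : Mat p n} (hL : L ∈ U p n) :
    (Matrix.diagonal t * weyl p N (K :: rest)) * idSum N L *
      (Matrix.diagonal t * weyl p N (K :: rest))⁻¹ ∈ U p N := by
  have hM : rest.sum = N - n := by simp at hs; omega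
  apply cell_conj_mem_U hs ht (idSum_mem_U h hL)
  intro i j hij hw
  by_cases hi : (i : ℕ) < N - n
  · rw [idSum_apply_inl_left _ hi, if_neg hij.ne]
  · rw [Fin.lt_def] at hij
    rw [wcol_merged_right _ _ (show rest.sum ≤ (i : ℕ) by omega),
      wcol_merged_right _ _ (show rest.sum ≤ (j : ℕ) by omega)] at hw
    omega

theorem toB_conj_idSum (h : n ≤ N) {g : Mat p n} (hg : IsUnit g.det) {u : Mat p N}
    {A : Matrix (Fin (N - n)) (Fin (N - n)) ℚ_[p]}
    {B : Matrix (Fin (N - n)) (Fin (n + 1)) ℚ_[p]}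
    (hu : toB h u = Matrix.fromBlocks A B 0 1) :
    toB h ((idSum N g)⁻¹ * u * idSum N g) = Matrix.fromBlocks A (B * g) 0 1 := by
  rw [idSum_inv h hg, toB_mul, toB_mul, toB_idSum, toB_idSum, hu, Matrix.fromBlocks_multiply,
    Matrix.fromBlocks_multiply]
  simp [Matrix.nonsing_inv_mul _ hg]

/-- Conjugation by I ⊕ g only replaces B by Bg, and B is unrestricted in U_{w'}. So every invertible
g is allowed. -/
theorem conj_idSum_mem_Uw {K : ℕ} {rest : List ℕ} (hK : K = n + 1)
    (hs : (K :: rest).sum = N + 1) (h : n ≤ N) {g : Mat p n} (hg : IsUnit g.det)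
    {u : Mat p N} (hu : u ∈ Uw p N (K :: rest)) :
    (idSum N g)⁻¹ * u * idSum N g ∈ Uw p N (K :: rest) := by
  obtain ⟨A, B, D, e⟩ := exists_toB_of_mem_U h hu.1
  obtain ⟨h1, h2, rfl⟩ := (mem_Uw_merged_iff hK hs h e).1 hu
  exact (mem_Uw_merged_iff hK hs h (toB_conj_idSum h hg e)).2 ⟨h1, h2, rfl⟩

/-- The Bruhat decomposition of a product `g' (I ⊕ g)`. -/
theorem bruhat_merge {k q : ℕ} {rest : List ℕ} (hK : k + q = n + 1)
    (hs : (k :: q :: rest).sum = N + 1) (h : n ≤ N) {L' R' : Mat p N} {L R : Mat p n}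
    {t' : Fin (N + 1) → ℚ_[p]} {t : Fin (n + 1) → ℚ_[p]} (ht' : ∀ i, t' i ≠ 0)
    (ht : ∀ i, t i ≠ 0) (hL' : L' ∈ U p N) (hL : L ∈ U p n)
    (hR' : R' ∈ Uw p N ((k + q) :: rest)) (hR : R ∈ Uw p n [k, q]) :
    ∃ RR : Mat p N, RR ∈ Uw p N (k :: q :: rest) ∧
      L' * ((Matrix.diagonal t' * weyl p N ((k + q) :: rest)) * idSum N L *
        (Matrix.diagonal t' * weyl p N ((k + q) :: rest))⁻¹) ∈ U p N ∧
      (∀ A B, toB h R' = Matrix.fromBlocks A B 0 1 → toB h RR =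
        Matrix.fromBlocks A (B * (L * (Matrix.diagonal t * weyl p n [k, q]) * R)) 0 R) ∧
      (Matrix.diagonal t' * weyl p N ((k + q) :: rest)) *
        idSum N (Matrix.diagonal t * weyl p n [k, q]) =
        Matrix.diagonal (fun x => t' x * extTop N t x) * weyl p N (k :: q :: rest) ∧
      L' * (Matrix.diagonal t' * weyl p N ((k + q) :: rest)) * R' *
        idSum N (L * (Matrix.diagonal t * weyl p n [k, q]) * R) =
      L' * ((Matrix.diagonal t' * weyl p N ((k + q) :: rest)) * idSum N L *
        (Matrix.diagonal t' * weyl p N ((k + q) :: rest))⁻¹) *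
        (Matrix.diagonal (fun x => t' x * extTop N t x) * weyl p N (k :: q :: rest)) * RR := by
  have hs' : ((k + q) :: rest).sum = N + 1 := by simp at hs ⊢; omega
  have hv : [k, q].sum = n + 1 := by simp; omega
  set C' := Matrix.diagonal t' * weyl p N ((k + q) :: rest) with hC'
  set C := Matrix.diagonal t * weyl p n [k, q] with hC
  have hLC : IsUnit (L * C).det := by
    rw [Matrix.det_mul]; exact (isUnit_det_of_mem_U hL).mul (isUnit_det_cell hv ht)
  have hCu : C'⁻¹ * C' = 1 := Matrix.nonsing_inv_mul _ (isUnit_det_cell hs' ht')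
  have hJ : idSum N (L * C) * (idSum N (L * C))⁻¹ = 1 := by
    rw [idSum_inv h hLC, ← idSum_mul h, Matrix.mul_nonsing_inv _ hLC, idSum_one h]
  have hCC : C' * idSum N C =
      Matrix.diagonal (fun x => t' x * extTop N t x) * weyl p N (k :: q :: rest) := by
    rw [hC', hC, idSum_mul h, weyl_merge k q rest hK hs, Matrix.mul_assoc,
      ← Matrix.mul_assoc (weyl p N _), weyl_mul_idSum_diagonal hK hs' h,
      ← Matrix.diagonal_mul_diagonal]
    simp only [Matrix.mul_assoc]
  have hcj := conj_idSum_mem_Uw hK hs' h hLC hR'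
  have hBB : ∀ A B, toB h R' = Matrix.fromBlocks A B 0 1 →
      toB h ((idSum N (L * C))⁻¹ * R' * idSum N (L * C) * idSum N R) =
        Matrix.fromBlocks A (B * (L * C * R)) 0 R := by
    intro A B e
    rw [toB_mul, toB_conj_idSum h hLC e, toB_idSum, Matrix.fromBlocks_multiply]
    simp [Matrix.mul_assoc]
  -- R' is moved to the right past I ⊕ LC; the remaining I ⊕ R is appended.
  refine ⟨(idSum N (L * C))⁻¹ * R' * idSum N (L * C) * idSum N R, ?_,
    mul_mem_U hL' (conj_idSum_mem_U hK hs' h ht' hL), hBB, hCC, ?_⟩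
  · obtain ⟨A, B, D, e⟩ := exists_toB_of_mem_U h hR'.1
    obtain ⟨h1, h2, rfl⟩ := (mem_Uw_merged_iff hK hs' h e).1 hR'
    exact (mem_Uw_split_iff hK hs h (hBB A B e)).2 ⟨h1, h2, hR⟩
  · rw [← hCC, idSum_mul h (L * C)]
    calc L' * C' * R' * (idSum N (L * C) * idSum N R)
        = L' * C' * (idSum N (L * C) * (idSum N (L * C))⁻¹) * R' *
            (idSum N (L * C) * idSum N R) := by rw [hJ, Matrix.mul_one]
      _ = L' * C' * idSum N L * (C'⁻¹ * C') * idSum N C * (idSum N (L * C))⁻¹ * R' *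
            (idSum N (L * C) * idSum N R) := by
          rw [hCu, Matrix.mul_one, idSum_mul h L C]; simp only [Matrix.mul_assoc]
      _ = _ := by simp only [Matrix.mul_assoc]

theorem torus_merge {k q : ℕ} {rest : List ℕ} (hK : k + q = n + 1) (h : n ≤ N)
    (a : ℕ × ℕ → ℚ_[p]) :
    (fun x => torus p N (expoSet N ((k + q) :: rest) a) x *
      extTop N (torus p n (expoSet n [k, q] a)) x) =
      torus p N (expoSet N (k :: q :: rest) a) := by
  have : expoSet N (k :: q :: rest) a = fun l => expoSet N ((k + q) :: rest) a l +
      expoSet n [k, q] a l := by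
    funext l; exact expoSet_merge a k q rest hK h l
  funext x
  rw [this, torus_add]
  congr 1
  rw [extTop]
  split_ifs with hx
  · rfl
  · rw [torus, expoSet_eq_zero _ (by omega), expoSet_eq_zero _ (by omega)]; simp

/-- `b(a) = L C R` with the explicit central factor. -/
def HasBruhat (N : ℕ) (bs : List ℕ) (a : ℕ × ℕ → ℚ_[p]) (L R : Mat p N) : Prop :=
  L ∈ U p N ∧ R ∈ Uw p N bs ∧
    bMap N bs a = L * (Matrix.diagonal (torus p N (expoSet N bs a)) * weyl p N bs) * R

theorem hasBruhat_pair {k q : ℕ} (hK : k + q = n + 1) (a : ℕ × ℕ → ℚ_[p]) :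
    ∃ L R, HasBruhat n [k, q] a L R := by
  obtain ⟨L, R, hL, hR, e⟩ := bruhat_pair a k q hK
  refine ⟨L, R, hL, hR, ?_⟩
  have : expoSet n [k, q] a = _ := funext (expoSet_pair a k q hK)
  rw [this]
  exact e

theorem weyl_singleton : weyl p N [N + 1] = 1 := by
  ext i j
  rw [weyl_apply (by simp)]
  simp [wcol, wsgn, Matrix.one_apply, Fin.ext_iff]

theorem exists_hasBruhat : ∀ (rest : List ℕ) (K : ℕ), 1 ≤ K → (K :: rest).sum = N + 1 →
    ∀ a : ℕ × ℕ → ℚ_[p], ∃ L R, HasBruhat N (K :: rest) a L R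
  | [], K, _, hs, a => by
      have : K = N + 1 := by simpa using hs
      subst this
      refine ⟨1, 1, one_mem_U, one_mem_Uw (isUnit_det_weyl hs), ?_⟩
      have h0 : torus p N (expoSet N [N + 1] a) = fun _ => 1 := by
        funext x; simp [torus, expoSet_singleton]
      rw [bMap_singleton, h0, weyl_singleton, Matrix.diagonal_one]; simp
  | q :: rest, K, hK, hs, a => by
      have hs' : ((K + q) :: rest).sum = N + 1 := by simp at hs ⊢; omega
      -- Matrices of type `Mat p n` have size n+1, so the merged block of size K+q corresponds to n
      -- = K+q-1; the subtraction is not truncated because K is positive.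
      have hn : K + q = (K + q - 1) + 1 := by omega
      have h : K + q - 1 ≤ N := by simp at hs; omega
      obtain ⟨L', R', hL', hR', e'⟩ := exists_hasBruhat rest (K + q) (by omega) hs' a
      obtain ⟨L, R, hL, hR, e⟩ := hasBruhat_pair hn a
      obtain ⟨RR, h1, h2, -, -, h3⟩ := bruhat_merge hn hs h (torus_ne_zero _) (torus_ne_zero _)
        hL' hL hR' hR
      refine ⟨_, RR, h2, h1, ?_⟩
      rw [bMap_merge a K q rest hn hs, e', e, h3, torus_merge hn h]

end Merge

/-! ### Explicit rows -/

section Explicit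

variable {p : ℕ} [Fact p.Prime] {N n : ℕ}

/-- The first row of `b_{α_1}(a_1) ⋯ b_{α_q}(a_q)`. -/
def topv : (q : ℕ) → (Fin q → ℚ_[p]) → Fin (q + 1) → ℚ_[p]
  | 0, _ => fun _ => 1
  | q + 1, a => Fin.cons (dPart (a 0)) (fun l => epsPart (a 0) * topv q (fun j => a j.succ) l)

/-- The other rows of `b_{α_1}(a_1) ⋯ b_{α_q}(a_q)`. -/
def botv : (q : ℕ) → (Fin q → ℚ_[p]) → Fin q → Fin (q + 1) → ℚ_[p]
  | 0, _ => Fin.elim0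
  | q + 1, a => Fin.cons
      (Fin.cons ((p : ℚ_[p]) ^ mu (a 0)) (fun l => cPart (a 0) * topv q (fun j => a j.succ) l))
      (fun j => Fin.cons 0 (botv q (fun j => a j.succ) j))

/-- The last column of `R` in the Bruhat decomposition of `b_{α_1}(a_1) ⋯ b_{α_q}(a_q)`. -/
def yvec : (q : ℕ) → (Fin q → ℚ_[p]) → Fin q → ℚ_[p]
  | 0, _ => Fin.elim0
  | q + 1, a => Fin.cons
      ((-1) ^ q * (a 0 * (p : ℚ_[p]) ^ (-(∑ b : Fin q, (mu (a b.succ) : ℤ)))))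
      (yvec q (fun j => a j.succ))

theorem dPart_mul_self (a : ℚ_[p]) :
    dPart a * a = (1 + epsPart a) * (p : ℚ_[p]) ^ (-(mu a : ℤ)) := by
  rw [← dPart_mul_cPart, cPart_eq, zpow_neg, zpow_natCast]
  field_simp [p_ne_zero (p := p)]

theorem epsPart_mul_zpow (a : ℚ_[p]) : epsPart a * (p : ℚ_[p]) ^ (-(mu a : ℤ)) = epsPart a := by
  rw [epsPart]
  split_ifs with h
  · rw [h]; simp
  · simp

/-- The first row fails to satisfy the linear relation among columns of `botv_last` by the term
(-1)^q p^{-Σμ}. After multiplication by c = p^μ a at the next step, exactly this defect supplies the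
new coordinate of `yvec`. -/
theorem topv_last : ∀ (q : ℕ) (a : Fin q → ℚ_[p]), topv q a (Fin.last q) =
    (-1) ^ q * (p : ℚ_[p]) ^ (-(∑ b : Fin q, (mu (a b) : ℤ))) +
      ∑ l : Fin q, topv q a l.castSucc * yvec q a l
  | 0, a => by simp [topv]
  | q + 1, a => by
      have ih := topv_last q (fun j => a j.succ)
      rw [topv, ← Fin.succ_last, Fin.cons_succ, ih, Fin.sum_univ_succ, Fin.sum_univ_succ]
      simp only [yvec, Fin.cons_zero, Fin.cons_succ, ← Fin.succ_castSucc, Fin.castSucc_zero]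
      rw [mul_add, Finset.mul_sum, neg_add, zpow_add₀ p_ne_zero, ← add_assoc]
      congr 1
      · have h1 := dPart_mul_self (a 0)
        have h2 := epsPart_mul_zpow (a 0)
        rw [pow_succ]
        set X := (p : ℚ_[p]) ^ (-∑ b : Fin q, (mu (a b.succ) : ℤ))
        linear_combination (-(-1) ^ q * X) * h1 - ((-1) ^ q * X) * h2
      · apply Finset.sum_congr rfl; intro l _; ring

theorem cPart_eq_mul (a : ℚ_[p]) : cPart a = (p : ℚ_[p]) ^ mu a * a := by rw [cPart_eq, mul_comm]

/-- Below its first row, a product of one row of letters has its last column in the span of the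
others, with coefficients `yvec`. For a single row of letters these coefficients form the free block
of the right factor. -/
theorem botv_last : ∀ (q : ℕ) (a : Fin q → ℚ_[p]) (j : Fin q), botv q a j (Fin.last q) =
    ∑ l : Fin q, botv q a j l.castSucc * yvec q a l
  | 0, a, j => j.elim0
  | q + 1, a, j => by
      have ih := botv_last q (fun j => a j.succ)
      rw [Fin.sum_univ_succ]
      refine Fin.cases ?_ (fun j => ?_) j
      · rw [botv, Fin.cons_zero, ← Fin.succ_last, Fin.cons_succ, topv_last]
        simp only [yvec, Fin.cons_zero, Fin.cons_succ, ← Fin.succ_castSucc, Fin.castSucc_zero]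
        rw [mul_add, Finset.mul_sum, cPart_eq_mul]
        congr 1
        · ring
        · apply Finset.sum_congr rfl; intro l _; ring
      · rw [botv, Fin.cons_succ, ← Fin.succ_last, Fin.cons_succ, ih]
        simp only [yvec, Fin.cons_zero, Fin.cons_succ, ← Fin.succ_castSucc, Fin.castSucc_zero,
          zero_mul, zero_add]

/-- The square block of `botv`. -/
def aMat (q : ℕ) (a : Fin q → ℚ_[p]) : Matrix (Fin q) (Fin q) ℚ_[p] :=
  Matrix.of fun j l => botv q a j l.castSucc

theorem norm_topv_le : ∀ (q : ℕ) (a : Fin q → ℚ_[p]) (l : Fin (q + 1)), ‖topv q a l‖ ≤ 1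
  | 0, a, l => by simp [topv]
  | q + 1, a, l => by
      refine Fin.cases ?_ (fun l => ?_) l
      · exact norm_dPart_le _
      · exact norm_mul_le_one (norm_epsPart_le _) (norm_topv_le q _ l)

theorem norm_botv_le : ∀ (q : ℕ) (a : Fin q → ℚ_[p]) (j : Fin q) (l : Fin (q + 1)),
    ‖botv q a j l‖ ≤ 1
  | 0, a, j, l => j.elim0
  | q + 1, a, j, l => by
      refine Fin.cases ?_ (fun j => ?_) j
      · refine Fin.cases ?_ (fun l => ?_) l
        · exact norm_p_pow_le _
        · exact norm_mul_le_one (norm_cPart_le _) (norm_topv_le q _ l)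
      · refine Fin.cases ?_ (fun l => ?_) l
        · simp [botv]
        · exact norm_botv_le q _ j l

theorem botv_of_lt : ∀ (q : ℕ) (a : Fin q → ℚ_[p]) (j l : Fin q), l < j →
    botv q a j l.castSucc = 0
  | 0, a, j, l, _ => j.elim0
  | q + 1, a, j, l, h => by
      revert h
      refine Fin.cases ?_ (fun j => ?_) j
      · intro h; exact absurd h (Fin.not_lt_zero l)
      · refine Fin.cases ?_ (fun l => ?_) l
        · intro _; simp [botv]
        · intro h
          rw [← Fin.succ_castSucc]
          exact botv_of_lt q _ j l (Fin.succ_lt_succ_iff.mp h)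

theorem botv_self : ∀ (q : ℕ) (a : Fin q → ℚ_[p]) (j : Fin q),
    botv q a j j.castSucc = (p : ℚ_[p]) ^ mu (a j)
  | 0, a, j => j.elim0
  | q + 1, a, j => by
      refine Fin.cases ?_ (fun j => ?_) j
      · simp [botv]
      · rw [← Fin.succ_castSucc]
        exact botv_self q _ j

theorem vecMul_ev_rowMat_top (q i : ℕ) (a : ℕ → ℚ_[p]) (h1 : 1 ≤ i) (h2 : i + q ≤ N + 1) :
    Matrix.vecMul (ev p N i) (rowMat N i q a) =
      ∑ l : Fin (q + 1), topv q (fun j => a j) l • ev p N (i + l) := by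
  induction q generalizing i a with
  | zero => simp [rowMat, topv]
  | succ q ih =>
    rw [rowMat, ← Matrix.vecMul_vecMul, vecMul_bSimple_self h1 (by omega), Matrix.add_vecMul,
      Matrix.smul_vecMul, Matrix.smul_vecMul, ih (i + 1) _ (by omega) (by omega),
      vecMul_rowMat_of_lt _ _ _ (by omega) (by omega) _ h1 (by omega) (Or.inl (by omega)),
      Fin.sum_univ_succ (n := q + 1), Finset.smul_sum]
    congr 1
    apply Finset.sum_congr rfl
    intro l _
    rw [smul_smul, topv, Fin.cons_succ, Fin.val_succ, show i + 1 + (l : ℕ) = i + (l + 1) by omega]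
    rfl

theorem vecMul_ev_rowMat_bot (q i : ℕ) (a : ℕ → ℚ_[p]) (h1 : 1 ≤ i) (h2 : i + q ≤ N + 1)
    (j : Fin q) :
    Matrix.vecMul (ev p N (i + 1 + j)) (rowMat N i q a) =
      ∑ l : Fin (q + 1), botv q (fun j => a j) j l • ev p N (i + l) := by
  induction q generalizing i a with
  | zero => exact j.elim0
  | succ q ih =>
    rw [rowMat, ← Matrix.vecMul_vecMul, Fin.sum_univ_succ (n := q + 1)]
    refine Fin.cases ?_ (fun j => ?_) j
    · rw [Fin.val_zero, add_zero, vecMul_bSimple_succ h1 (by omega), Matrix.add_vecMul,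
        Matrix.smul_vecMul, Matrix.smul_vecMul, vecMul_ev_rowMat_top _ _ _ (by omega) (by omega),
        vecMul_rowMat_of_lt _ _ _ (by omega) (by omega) _ h1 (by omega) (Or.inl (by omega)),
        Finset.smul_sum]
      congr 1
      apply Finset.sum_congr rfl
      intro l _
      rw [smul_smul, botv, Fin.cons_zero, Fin.cons_succ, Fin.val_succ,
        show i + 1 + (l : ℕ) = i + (l + 1) by omega]
      rfl
    · rw [vecMul_bSimple_of_ne h1 (by omega) _ (by omega) (by rw [Fin.val_succ]; omega)
        (by omega) (by rw [Fin.val_succ]; omega), Fin.val_succ,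
        show i + 1 + ((j : ℕ) + 1) = i + 1 + 1 + j by omega, ih (i + 1) _ (by omega) (by omega),
        botv, Fin.cons_succ, Fin.cons_zero, zero_smul, zero_add]
      apply Finset.sum_congr rfl
      intro l _
      rw [Fin.cons_succ, Fin.val_succ, show i + 1 + (l : ℕ) = i + (l + 1) by omega]
      rfl

/-- The left lower block of a product of rows. -/
def gMat (q : ℕ) (A : ℕ → Fin q → ℚ_[p]) : ℕ → Matrix (Fin q) (Fin q) ℚ_[p]
  | 0 => 1
  | i + 1 => aMat q (A i) * gMat q A i

/-- Upper triangular integral matrices with the diagonal `p ^ e`. -/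
structure IsLattice {q : ℕ} (G : Matrix (Fin q) (Fin q) ℚ_[p]) (e : Fin q → ℕ) : Prop where
  upper : ∀ i j, j < i → G i j = 0
  diag : ∀ i, G i i = (p : ℚ_[p]) ^ e i
  integral : ∀ i j, ‖G i j‖ ≤ 1

theorem isLattice_aMat (q : ℕ) (a : Fin q → ℚ_[p]) : IsLattice (aMat q a) (fun j => mu (a j)) :=
  ⟨fun i j h => botv_of_lt q a i j h, fun i => botv_self q a i, fun i _ => norm_botv_le q a i _⟩

theorem IsLattice.mul {q : ℕ} {G H : Matrix (Fin q) (Fin q) ℚ_[p]} {e f : Fin q → ℕ}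
    (hG : IsLattice G e) (hH : IsLattice H f) : IsLattice (G * H) (fun j => f j + e j) := by
  refine ⟨fun i j h => ?_, fun i => ?_, fun i j => ?_⟩
  · exact Matrix.BlockTriangular.mul (b := id) (M := G) (N := H) (fun i j h => hG.upper i j h)
      (fun i j h => hH.upper i j h) h
  · rw [Matrix.mul_apply, Finset.sum_eq_single i, hG.diag, hH.diag, ← pow_add, add_comm]
    · intro l _ hl
      rcases lt_or_gt_of_ne hl with h | h
      · rw [hG.upper i l h, zero_mul]
      · rw [hH.upper l i h, mul_zero]
    · intro h; exact absurd (Finset.mem_univ i) h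
  · rw [Matrix.mul_apply]
    exact norm_sum_le_one _ _ fun l _ => norm_mul_le_one (hG.integral i l) (hH.integral l j)

theorem IsLattice.isUnit_det {q : ℕ} {G : Matrix (Fin q) (Fin q) ℚ_[p]} {e : Fin q → ℕ}
    (hG : IsLattice G e) : IsUnit G.det := by
  rw [Matrix.det_of_isUpperTriangular (fun i j h => hG.upper i j h), isUnit_iff_ne_zero,
    Finset.prod_ne_zero_iff]
  intro i _
  rw [hG.diag]
  exact pow_ne_zero _ p_ne_zero

theorem isLattice_gMat (q : ℕ) (A : ℕ → Fin q → ℚ_[p]) (i : ℕ) :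
    IsLattice (gMat q A i) (fun j => ∑ i' ∈ Finset.range i, mu (A i' j)) := by
  induction i with
  | zero =>
    refine ⟨fun i _ h => Matrix.one_apply_ne h.ne', fun i => ?_, fun i j => ?_⟩
    · simp [gMat]
    · rw [gMat, Matrix.one_apply]; split_ifs <;> simp
  | succ i ih =>
    have := (isLattice_aMat q (A i)).mul ih
    simp only [Finset.sum_range_succ]
    exact this

/-- The columns of the upper right block of `R`. -/
def ycol (q : ℕ) (A : ℕ → Fin q → ℚ_[p]) (i : ℕ) : Fin q → ℚ_[p] :=
  (gMat q A i)⁻¹.mulVec (yvec q (A i))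

theorem gMat_mulVec_ycol (q : ℕ) (A : ℕ → Fin q → ℚ_[p]) (i : ℕ) :
    (gMat q A i).mulVec (ycol q A i) = yvec q (A i) := by
  rw [ycol, Matrix.mulVec_mulVec, Matrix.mul_nonsing_inv _ (isLattice_gMat q A i).isUnit_det,
    Matrix.one_mulVec]

theorem gMat_congr {q : ℕ} {A A' : ℕ → Fin q → ℚ_[p]} {i : ℕ} (h : ∀ i' < i, A i' = A' i') :
    gMat q A i = gMat q A' i := by
  induction i with
  | zero => rfl
  | succ i ih => rw [gMat, gMat, ih (fun i' hi => h i' (by omega)), h i (by omega)]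

/-- The bottom q rows have the form G(1 | Y). A further row of letters multiplies G by `aMat` from
the left and adds one column, equal to `aMat` times `yvec`, hence to the new G times `ycol`; the
earlier columns of Y stay as they are. -/
theorem vecMul_ev_grassMat (q : ℕ) (A : ℕ → ℕ → ℚ_[p]) (k : ℕ) (h2 : k + q ≤ N + 1) (j : Fin q) :
    Matrix.vecMul (ev p N (k + 1 + j)) (grassMat N q A k) =
      ∑ l : Fin q, gMat q (fun i u => A i u) k j l • (ev p N (1 + l) +
        ∑ i ∈ Finset.range k, ycol q (fun i u => A i u) i l • ev p N (q + 1 + i)) := by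
  induction k generalizing j with
  | zero =>
    rw [Finset.sum_eq_single j]
    · simp [grassMat, gMat]
    · intro l _ hl; rw [gMat, Matrix.one_apply_ne hl.symm, zero_smul]
    · intro h; exact absurd (Finset.mem_univ j) h
  | succ k ih =>
    have hy : ∑ l : Fin q, gMat q (fun i u => A i u) (k + 1) j l *
        ycol q (fun i u => A i u) k l = botv q (fun u => A k u) j (Fin.last q) := by
      have := congrArg (fun v => (aMat q (fun u : Fin q => A k u)).mulVec v j)
        (gMat_mulVec_ycol q (fun i (u : Fin q) => A i u) k)
      simp only [Matrix.mulVec_mulVec] at this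
      rw [botv_last]
      exact this
    rw [grassMat, ← Matrix.vecMul_vecMul, vecMul_ev_rowMat_bot _ _ _ (by omega) (by omega),
      Fin.sum_univ_castSucc, Matrix.add_vecMul, Matrix.sum_vecMul, Matrix.smul_vecMul,
      Fin.val_last, vecMul_grassMat_of_lt _ _ _ (by omega) _ (by omega) (by omega) (by omega), ← hy]
    simp only [Matrix.smul_vecMul, Fin.val_castSucc]
    have e1 : ∀ l : Fin q, Matrix.vecMul (ev p N (k + 1 + l)) (grassMat N q A k) = _ :=
      fun l => ih (by omega) l
    simp only [e1, Finset.sum_range_succ, ← add_assoc]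
    generalize hV : (fun l : Fin q => ev p N (1 + l) + ∑ i ∈ Finset.range k,
      ycol q (fun i (u : Fin q) => A i u) i l • ev p N (q + 1 + i)) = V
    have hV' : ∀ l : Fin q, ev p N (1 + l) + ∑ i ∈ Finset.range k,
      ycol q (fun i (u : Fin q) => A i u) i l • ev p N (q + 1 + i) = V l := fun l => congrFun hV l
    simp only [hV', smul_add, Finset.sum_add_distrib, Finset.smul_sum, smul_smul, Finset.sum_smul]
    rw [Finset.sum_comm, show k + 1 + q = q + 1 + k by omega]
    congr 1
    apply Finset.sum_congr rfl
    intro l _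
    rw [← Finset.sum_smul, gMat, Matrix.mul_apply]
    rfl

end Explicit

/-! ### Representatives of `p`-adic numbers modulo powers of `p` -/

section Residues

variable {p : ℕ} [Fact p.Prime]

theorem one_lt_p_real : (1 : ℝ) < p := by exact_mod_cast (Fact.out : p.Prime).one_lt

theorem mu_eq_of_norm {a : ℚ_[p]} {m : ℕ} (hm : 0 < m) (h : ‖a‖ = (p : ℝ) ^ (m : ℤ)) :
    mu a = m := by
  have h1 : ¬ ‖a‖ ≤ 1 := by
    rw [h, not_le]
    exact one_lt_zpow₀ one_lt_p_real (by exact_mod_cast hm)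
  have h2 := norm_eq_zpow_neg_of_mu a h1
  rw [h] at h2
  have := zpow_right_injective₀ (by positivity [one_lt_p_real (p := p)] : (0 : ℝ) < p)
    (ne_of_gt one_lt_p_real) h2
  exact_mod_cast this.symm

theorem mu_add {a z : ℚ_[p]} (hz : ‖z‖ ≤ 1) : mu (a + z) = mu a := by
  by_cases h : ‖a‖ ≤ 1
  · rw [(mu_eq_zero_iff a).2 h, mu_eq_zero_iff]
    exact norm_add_le_one h hz
  · apply mu_eq_of_norm (mu_pos_of_not_le a h)
    rw [← norm_eq_zpow_neg_of_mu a h, Padic.add_eq_max_of_ne]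
    · exact max_eq_left (hz.trans (not_le.mp h).le)
    · intro e; rw [e] at h; exact h hz

theorem not_dvd_of_isCoprime {c : ℤ} {m : ℕ} (hm : 0 < m) (h : IsCoprime c ((p : ℤ) ^ m)) :
    ¬ (p : ℤ) ∣ c := by
  intro hd
  have hu := h.isUnit_of_dvd' hd (dvd_pow_self _ hm.ne')
  have := Int.isUnit_iff.mp hu
  have := (Fact.out : p.Prime).one_lt
  omega

theorem isCoprime_of_not_dvd {c : ℤ} {m : ℕ} (h : ¬ (p : ℤ) ∣ c) : IsCoprime c ((p : ℤ) ^ m) :=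
  (((Nat.prime_iff_prime_int.mp Fact.out).coprime_iff_not_dvd.mpr h).symm).pow_right

theorem norm_intCast_eq_one_of_not_dvd {c : ℤ} (h : ¬ (p : ℤ) ∣ c) : ‖(c : ℚ_[p])‖ = 1 := by
  refine le_antisymm (Padic.norm_int_le_one c) (not_lt.mp fun hlt => h ?_)
  exact Padic.norm_intCast_lt_one_iff.mp hlt

theorem mu_of_isCoprime {c : ℤ} {m : ℕ} (h : IsCoprime c ((p : ℤ) ^ m)) :
    mu ((c : ℚ_[p]) * (p : ℚ_[p]) ^ (-(m : ℤ))) = m := by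
  rcases Nat.eq_zero_or_pos m with rfl | hm
  · rw [mu_eq_zero_iff]
    simpa using Padic.norm_int_le_one c
  · apply mu_eq_of_norm hm
    rw [norm_mul, norm_intCast_eq_one_of_not_dvd (not_dvd_of_isCoprime hm h), one_mul,
      Padic.norm_p_zpow, neg_neg]

/-- Reducing α modulo p^E is the same as reducing c(α) ∈ ℤ_p modulo p^{E+μ}. The integer is the
corresponding truncation of c(α). -/
theorem exists_residue (α : ℚ_[p]) (E : ℕ) : ∃ c : ℤ, 0 ≤ c ∧ c < (p : ℤ) ^ (E + mu α) ∧
    IsCoprime c ((p : ℤ) ^ mu α) ∧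
    ∃ z : ℚ_[p], ‖z‖ ≤ 1 ∧
      (c : ℚ_[p]) * (p : ℚ_[p]) ^ (-(mu α : ℤ)) = α + (p : ℚ_[p]) ^ E * z := by
  let β : ℤ_[p] := ⟨cPart α, norm_cPart_le α⟩
  have hspec := PadicInt.appr_spec (E + mu α) β
  obtain ⟨ζ, hζ⟩ := Ideal.mem_span_singleton.mp hspec
  have hζ' : cPart α - (PadicInt.appr β (E + mu α) : ℚ_[p]) =
      (p : ℚ_[p]) ^ (E + mu α) * (ζ : ℚ_[p]) := by
    have := congrArg (fun x : ℤ_[p] => (x : ℚ_[p])) hζ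
    simpa using this
  refine ⟨PadicInt.appr β (E + mu α), by positivity, ?_, ?_, -ζ, ?_, ?_⟩
  · exact_mod_cast PadicInt.appr_lt β (E + mu α)
  · by_cases h : ‖α‖ ≤ 1
    · rw [(mu_eq_zero_iff α).2 h, pow_zero]; exact isCoprime_one_right
    · apply isCoprime_of_not_dvd
      intro hd
      have h1 := norm_cPart_of_not_le α h
      have h2 : ‖((PadicInt.appr β (E + mu α) : ℤ) : ℚ_[p])‖ < 1 :=
        Padic.norm_intCast_lt_one_iff.mpr hd
      have h3 : ‖(p : ℚ_[p]) ^ (E + mu α) * (ζ : ℚ_[p])‖ < 1 := by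
        have hm := mu_pos_of_not_le α h
        have h4 : ‖(p : ℚ_[p]) ^ (E + mu α)‖ < 1 := by
          rw [norm_pow]
          exact pow_lt_one₀ (norm_nonneg _) Padic.norm_p_lt_one (by omega)
        rw [norm_mul]
        have h5 : ‖(ζ : ℚ_[p])‖ ≤ 1 := ζ.2
        nlinarith [norm_nonneg ((p : ℚ_[p]) ^ (E + mu α)), norm_nonneg (ζ : ℚ_[p])]
      have h6 : cPart α = ((PadicInt.appr β (E + mu α) : ℤ) : ℚ_[p]) +
          (p : ℚ_[p]) ^ (E + mu α) * (ζ : ℚ_[p]) := by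
        rw [← hζ']; push_cast; ring
      have h7 := IsUltrametricDist.norm_add_le_max ((PadicInt.appr β (E + mu α) : ℤ) : ℚ_[p])
        ((p : ℚ_[p]) ^ (E + mu α) * (ζ : ℚ_[p]))
      rw [← h6, h1] at h7
      exact absurd h7 (not_le.mpr (max_lt h2 h3))
  · rw [norm_neg]; exact ζ.2
  · have h3 : (p : ℚ_[p]) ^ (-(mu α : ℤ)) * (p : ℚ_[p]) ^ mu α = 1 := by
      rw [zpow_neg, zpow_natCast, inv_mul_cancel₀ (pow_ne_zero _ p_ne_zero)]
    rw [cPart_eq, pow_add] at hζ'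
    push_cast
    linear_combination (-(p : ℚ_[p]) ^ (-(mu α : ℤ))) * hζ' +
      (α - (p : ℚ_[p]) ^ E * (ζ : ℚ_[p])) * h3

/-- Both exponents equal μ(α), since an integral change does not affect μ. Then c and c' are
congruent modulo p^{E+m} and lie in the same range of that length. -/
theorem residue_unique {α : ℚ_[p]} {E m m' : ℕ} {c c' : ℤ} {z z' : ℚ_[p]}
    (hc : 0 ≤ c ∧ c < (p : ℤ) ^ (E + m) ∧ IsCoprime c ((p : ℤ) ^ m))
    (hc' : 0 ≤ c' ∧ c' < (p : ℤ) ^ (E + m') ∧ IsCoprime c' ((p : ℤ) ^ m'))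
    (hz : ‖z‖ ≤ 1) (hz' : ‖z'‖ ≤ 1)
    (h : (c : ℚ_[p]) * (p : ℚ_[p]) ^ (-(m : ℤ)) = α + (p : ℚ_[p]) ^ E * z)
    (h' : (c' : ℚ_[p]) * (p : ℚ_[p]) ^ (-(m' : ℤ)) = α + (p : ℚ_[p]) ^ E * z') :
    m = m' ∧ c = c' ∧ z = z' := by
  have e1 := mu_of_isCoprime hc.2.2
  have e2 := mu_of_isCoprime hc'.2.2
  rw [h, mu_add (norm_mul_le_one (norm_p_pow_le E) hz)] at e1
  rw [h', mu_add (norm_mul_le_one (norm_p_pow_le E) hz')] at e2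
  have hm : m = m' := e1.symm.trans e2
  subst hm
  have h3 : (p : ℚ_[p]) ^ (-(m : ℤ)) * (p : ℚ_[p]) ^ m = 1 := by
    rw [zpow_neg, zpow_natCast, inv_mul_cancel₀ (pow_ne_zero _ p_ne_zero)]
  have e3 : ((c - c' : ℤ) : ℚ_[p]) = (p : ℚ_[p]) ^ (E + m) * (z - z') := by
    rw [pow_add]; push_cast
    linear_combination ((p : ℚ_[p]) ^ m) * h - ((p : ℚ_[p]) ^ m) * h' -
      ((c : ℚ_[p]) - c') * h3
  have e4 : ‖z - z'‖ ≤ 1 := by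
    rw [sub_eq_add_neg]
    exact norm_add_le_one hz (by rw [norm_neg]; exact hz')
  have e5 : ((p : ℤ) ^ (E + m)) ∣ c - c' := by
    have := (Padic.norm_int_le_pow_iff_dvd (p := p) (c - c') (E + m)).mp (by
      rw [e3, norm_mul, Padic.norm_p_pow]
      exact mul_le_of_le_one_right (by positivity) e4)
    exact_mod_cast this
  have e6 : c = c' := by
    have := Int.eq_zero_of_abs_lt_dvd e5 (by rw [abs_lt]; constructor <;> linarith [hc.1, hc.2.1, hc'.1, hc'.2.1])
    linarith
  refine ⟨rfl, e6, ?_⟩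
  subst e6
  have e7 : (p : ℚ_[p]) ^ E * z = (p : ℚ_[p]) ^ E * z' := by
    have := h.symm.trans h'
    linear_combination this
  exact mul_left_cancel₀ (pow_ne_zero _ p_ne_zero) e7

/-- The conditions on the integers `c_j` in one row. -/
def RowCond {q : ℕ} (p : ℕ) (e m : Fin q → ℕ) (c : Fin q → ℤ) : Prop :=
  ∀ j, 0 ≤ c j ∧ c j < (p : ℤ) ^ (e j + m j + ∑ b ∈ Finset.Ioi j, m b) ∧
    IsCoprime (c j) ((p : ℤ) ^ m j)

/-- The row with entries `c_j p ^ (-m_j)`. -/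
def rowFam (p : ℕ) [Fact p.Prime] {q : ℕ} (m : Fin q → ℕ) (c : Fin q → ℤ) : Fin q → ℚ_[p] :=
  fun j => (c j : ℚ_[p]) * (p : ℚ_[p]) ^ (-(m j : ℤ))

theorem mulVec_succ_of_upper {q : ℕ} {G : Matrix (Fin (q + 1)) (Fin (q + 1)) ℚ_[p]}
    (hG : ∀ i j, j < i → G i j = 0) (z : Fin (q + 1) → ℚ_[p]) (j : Fin q) :
    G.mulVec z j.succ = (G.submatrix Fin.succ Fin.succ).mulVec (fun l => z l.succ) j := by
  rw [Matrix.mulVec, dotProduct, Fin.sum_univ_succ, hG _ _ (Fin.succ_pos j), zero_mul, zero_add]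
  rfl

theorem mulVec_zero_eq {q : ℕ} {G : Matrix (Fin (q + 1)) (Fin (q + 1)) ℚ_[p]}
    (z : Fin (q + 1) → ℚ_[p]) :
    G.mulVec z 0 = G 0 0 * z 0 + ∑ l : Fin q, G 0 l.succ * z l.succ := by
  rw [Matrix.mulVec, dotProduct, Fin.sum_univ_succ]

theorem IsLattice.tail {q : ℕ} {G : Matrix (Fin (q + 1)) (Fin (q + 1)) ℚ_[p]}
    {e : Fin (q + 1) → ℕ} (hG : IsLattice G e) :
    IsLattice (G.submatrix Fin.succ Fin.succ) (fun j => e j.succ) :=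
  ⟨fun _ _ h => hG.upper _ _ (Fin.succ_lt_succ_iff.mpr h), fun _ => hG.diag _,
    fun _ _ => hG.integral _ _⟩

theorem RowCond.tail {q : ℕ} {e m : Fin (q + 1) → ℕ} {c : Fin (q + 1) → ℤ} (h : RowCond p e m c) :
    RowCond p (fun j => e j.succ) (fun j => m j.succ) (fun j => c j.succ) := by
  intro j
  have := h j.succ
  rwa [Fin.sum_Ioi_succ] at this

theorem yvec_zero {q : ℕ} (a : Fin (q + 1) → ℚ_[p]) : yvec (q + 1) a 0 =
    (-1) ^ q * (a 0 * (p : ℚ_[p]) ^ (-(∑ b : Fin q, (mu (a b.succ) : ℤ)))) := rfl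

theorem yvec_succ {q : ℕ} (a : Fin (q + 1) → ℚ_[p]) (j : Fin q) : yvec (q + 1) a j.succ =
    yvec q (fun j => a j.succ) j := rfl

theorem neg_one_pow_mul_self (q : ℕ) : ((-1 : ℚ_[p]) ^ q) * (-1) ^ q = 1 := by
  rw [← mul_pow]; norm_num

/-- Back substitution: coordinate j of `yvec` is a_j up to sign and the factor p^{-S}, with S the
sum of the later exponents, and G is upper triangular with diagonal p^{e_j}. Once the later
coordinates are solved, a_j is prescribed modulo p^{e_j+S}, so c_j ranges below p^{e_j+S+m_j}. -/
theorem exists_row : ∀ (q : ℕ) (e : Fin q → ℕ) (G : Matrix (Fin q) (Fin q) ℚ_[p])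
    (_ : IsLattice G e) (y : Fin q → ℚ_[p]),
    ∃ m c z, RowCond p e m c ∧ (∀ j, ‖z j‖ ≤ 1) ∧ yvec q (rowFam p m c) = y + G.mulVec z
  | 0, e, G, _, y => ⟨Fin.elim0, Fin.elim0, Fin.elim0, fun j => j.elim0, fun j => j.elim0,
      funext fun j => j.elim0⟩
  | q + 1, e, G, hG, y => by
      obtain ⟨m, c, z, hc, hz, hy⟩ := exists_row q _ _ hG.tail (fun j => y j.succ)
      set S := ∑ b : Fin q, m b with hS
      set T := ∑ l : Fin q, G 0 l.succ * z l with hT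
      -- The equation for coordinate 0, multiplied by (-1)^q p^S to isolate a_0; T collects the
      -- contribution of the coordinates already solved.
      obtain ⟨c0, h1, h2, h3, ζ, h4, h5⟩ :=
        exists_residue ((-1) ^ q * (p : ℚ_[p]) ^ S * (y 0 + T)) (e 0 + S)
      set m0 := mu ((-1) ^ q * (p : ℚ_[p]) ^ S * (y 0 + T)) with hm0
      have hmu : ∀ j, mu (rowFam p m c j) = m j := fun j => mu_of_isCoprime (hc j).2.2
      refine ⟨Fin.cons m0 m, Fin.cons c0 c, Fin.cons ((-1) ^ q * ζ) z, ?_, ?_, ?_⟩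
      · intro j
        refine Fin.cases ?_ (fun j => ?_) j
        · rw [Fin.sum_Ioi_zero]
          simp only [Fin.cons_zero, Fin.cons_succ]
          rw [add_right_comm]
          exact ⟨h1, h2, h3⟩
        · rw [Fin.sum_Ioi_succ]
          simp only [Fin.cons_succ]
          exact hc j
      · intro j
        refine Fin.cases ?_ (fun j => ?_) j
        · rw [Fin.cons_zero]
          exact norm_mul_le_one (by simp) h4
        · exact hz j
      · funext j
        refine Fin.cases ?_ (fun j => ?_) j
        · rw [yvec_zero, Pi.add_apply, mulVec_zero_eq, hG.diag]
          have e1 : rowFam p (Fin.cons m0 m : Fin (q + 1) → ℕ) (Fin.cons c0 c : Fin (q + 1) → ℤ) 0 =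
            (c0 : ℚ_[p]) * (p : ℚ_[p]) ^ (-(m0 : ℤ)) := rfl
          have e2 : ∑ b : Fin q, (mu (rowFam p (Fin.cons m0 m : Fin (q + 1) → ℕ)
              (Fin.cons c0 c : Fin (q + 1) → ℤ) b.succ) : ℤ) = (S : ℤ) := by
            rw [hS]; push_cast
            exact Finset.sum_congr rfl fun b _ => congrArg _ (hmu b)
          rw [e1, e2, h5]
          simp only [Fin.cons_zero, Fin.cons_succ]
          rw [← hT]
          have h6 : (p : ℚ_[p]) ^ (-(S : ℤ)) * (p : ℚ_[p]) ^ S = 1 := by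
            rw [zpow_neg, zpow_natCast, inv_mul_cancel₀ (pow_ne_zero _ p_ne_zero)]
          have h7 := neg_one_pow_mul_self (p := p) q
          rw [pow_add]
          linear_combination ((y 0 + T) * (-1) ^ q * (-1) ^ q +
            (-1) ^ q * (p : ℚ_[p]) ^ e 0 * ζ) * h6 + (y 0 + T) * h7
        · rw [yvec_succ, Pi.add_apply, mulVec_succ_of_upper hG.upper]
          exact congrFun hy j

/-- Uniqueness of z is carried along because the tail of z enters the equation for the first
coordinate. -/
theorem row_unique : ∀ (q : ℕ) (e : Fin q → ℕ) (G : Matrix (Fin q) (Fin q) ℚ_[p])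
    (_ : IsLattice G e) (y : Fin q → ℚ_[p]) (m m' : Fin q → ℕ) (c c' : Fin q → ℤ)
    (z z' : Fin q → ℚ_[p]), RowCond p e m c → RowCond p e m' c' → (∀ j, ‖z j‖ ≤ 1) →
    (∀ j, ‖z' j‖ ≤ 1) → yvec q (rowFam p m c) = y + G.mulVec z →
    yvec q (rowFam p m' c') = y + G.mulVec z' → m = m' ∧ c = c' ∧ z = z'
  | 0, _, _, _, _, _, _, _, _, _, _, _, _, _, _, _, _ =>
      ⟨funext fun j => j.elim0, funext fun j => j.elim0, funext fun j => j.elim0⟩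
  | q + 1, e, G, hG, y, m, m', c, c', z, z', hc, hc', hz, hz', h, h' => by
      have hs : ∀ {m : Fin (q + 1) → ℕ} {c : Fin (q + 1) → ℤ} {z : Fin (q + 1) → ℚ_[p]},
          yvec (q + 1) (rowFam p m c) = y + G.mulVec z →
          yvec q (rowFam p (fun j => m j.succ) (fun j => c j.succ)) =
          (fun j => y j.succ) + (G.submatrix Fin.succ Fin.succ).mulVec (fun l => z l.succ) := by
        intro m c z h
        funext j
        have := congrFun h j.succ
        rw [yvec_succ, Pi.add_apply, mulVec_succ_of_upper hG.upper] at this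
        exact this
      obtain ⟨t1, t2, t3⟩ := row_unique q _ _ hG.tail (fun j => y j.succ) _ _ _ _ _ _ hc.tail
        hc'.tail (fun j => hz j.succ) (fun j => hz' j.succ) (hs h) (hs h')
      set S := ∑ b : Fin q, m b.succ with hS
      set T := ∑ l : Fin q, G 0 l.succ * z l.succ with hT
      have hS' : S = ∑ b : Fin q, m' b.succ :=
        Finset.sum_congr rfl fun b _ => congrFun t1 b
      have hT' : T = ∑ l : Fin q, G 0 l.succ * z' l.succ :=
        Finset.sum_congr rfl fun b _ => congrArg _ (congrFun t3 b)
      have hz0 : ∀ {m : Fin (q + 1) → ℕ} {c : Fin (q + 1) → ℤ} {z : Fin (q + 1) → ℚ_[p]},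
          RowCond p e m c →
          yvec (q + 1) (rowFam p m c) = y + G.mulVec z →
          S = ∑ b : Fin q, m b.succ → T = ∑ l : Fin q, G 0 l.succ * z l.succ →
          (c 0 : ℚ_[p]) * (p : ℚ_[p]) ^ (-(m 0 : ℤ)) =
            (-1) ^ q * (p : ℚ_[p]) ^ S * (y 0 + T) + (p : ℚ_[p]) ^ (e 0 + S) * ((-1) ^ q * z 0) := by
        intro m c z hc h hS hT
        have h0 := congrFun h 0
        have e2 : ∑ b : Fin q, (mu (rowFam p m c b.succ) : ℤ) = (S : ℤ) := by
          rw [hS]; push_cast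
          exact Finset.sum_congr rfl fun b _ => congrArg _ (mu_of_isCoprime (hc b.succ).2.2)
        rw [yvec_zero, Pi.add_apply, mulVec_zero_eq, hG.diag, e2, ← hT] at h0
        change (-1) ^ q * ((c 0 : ℚ_[p]) * (p : ℚ_[p]) ^ (-(m 0 : ℤ)) * _) = _ at h0
        have h6 : (p : ℚ_[p]) ^ (-(S : ℤ)) * (p : ℚ_[p]) ^ S = 1 := by
          rw [zpow_neg, zpow_natCast, inv_mul_cancel₀ (pow_ne_zero _ p_ne_zero)]
        have h7 := neg_one_pow_mul_self (p := p) q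
        rw [pow_add]
        set x := (c 0 : ℚ_[p]) * (p : ℚ_[p]) ^ (-(m 0 : ℤ))
        linear_combination ((-1) ^ q * (p : ℚ_[p]) ^ S) * h0 - (x * (-1) ^ q * (-1) ^ q) * h6 -
          x * h7
      have hc0 := hc 0
      have hc0' := hc' 0
      rw [Fin.sum_Ioi_zero, add_right_comm] at hc0 hc0'
      rw [← hS] at hc0
      rw [← hS'] at hc0'
      have hn : ∀ w : ℚ_[p], ‖w‖ ≤ 1 → ‖(-1) ^ q * w‖ ≤ 1 :=
        fun w hw => norm_mul_le_one (by simp) hw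
      obtain ⟨u1, u2, u3⟩ := residue_unique hc0 hc0' (hn _ (hz 0)) (hn _ (hz' 0))
        (hz0 hc h hS hT) (hz0 hc' h' hS' hT')
      have u4 : z 0 = z' 0 := by
        have := congrArg (fun w => (-1 : ℚ_[p]) ^ q * w) u3
        simpa only [← mul_assoc, neg_one_pow_mul_self, one_mul] using this
      refine ⟨?_, ?_, ?_⟩ <;> funext j <;> refine Fin.cases ?_ (fun j => ?_) j
      · exact u1
      · exact congrFun t1 j
      · exact u2
      · exact congrFun t2 j
      · exact u4
      · exact congrFun t3 j

theorem yvec_injective : ∀ (q : ℕ), Function.Injective (yvec (p := p) q)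
  | 0, a, a', _ => funext fun j => j.elim0
  | q + 1, a, a', h => by
      have ht : (fun j : Fin q => a j.succ) = fun j => a' j.succ := by
        apply yvec_injective q
        funext j
        exact congrFun h j.succ
      have h0 := congrFun h 0
      rw [yvec_zero, yvec_zero] at h0
      have e : ∀ b : Fin q, a b.succ = a' b.succ := fun b => congrFun ht b
      simp only [e] at h0
      have h1 := mul_right_cancel₀ (zpow_ne_zero _ p_ne_zero)
        (mul_left_cancel₀ (pow_ne_zero _ (by norm_num)) h0)
      funext j
      refine Fin.cases h1 (fun j => e j) j

/-- The conditions on all rows. -/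
def GrassCond (p : ℕ) [Fact p.Prime] {q : ℕ} (k : ℕ) (Y : ℕ → Fin q → ℚ_[p]) (m : ℕ → Fin q → ℕ)
    (c : ℕ → Fin q → ℤ) : Prop :=
  ∀ i < k, RowCond p (fun j => ∑ i' ∈ Finset.range i, m i' j) (m i) (c i) ∧
    ∃ z : Fin q → ℚ_[p], (∀ j, ‖z j‖ ≤ 1) ∧
      ycol q (fun i => rowFam p (m i) (c i)) i = Y i + z

theorem ycol_eq_iff {q : ℕ} (A : ℕ → Fin q → ℚ_[p]) (i : ℕ) (v : Fin q → ℚ_[p]) :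
    ycol q A i = v ↔ yvec q (A i) = (gMat q A i).mulVec v := by
  constructor
  · rintro rfl; exact (gMat_mulVec_ycol q A i).symm
  · intro h
    rw [ycol, h, Matrix.mulVec_mulVec, Matrix.nonsing_inv_mul _ (isLattice_gMat q A i).isUnit_det,
      Matrix.one_mulVec]

theorem isLattice_gMat_rowFam {q i : ℕ} {m : ℕ → Fin q → ℕ} {c : ℕ → Fin q → ℤ}
    (h : ∀ i' < i, ∀ j, IsCoprime (c i' j) ((p : ℤ) ^ m i' j)) :
    IsLattice (gMat q (fun i => rowFam p (m i) (c i)) i)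
      (fun j => ∑ i' ∈ Finset.range i, m i' j) := by
  have := isLattice_gMat q (fun i => rowFam p (m i) (c i)) i
  convert this using 3 with j i' hi'
  exact (mu_of_isCoprime (h i' (Finset.mem_range.mp hi') j)).symm

/-- The lattice governing row i depends only on the earlier rows, so the rows can be chosen one
after another. -/
theorem exists_grassCond {q : ℕ} (k : ℕ) (Y : ℕ → Fin q → ℚ_[p]) :
    ∃ m c, GrassCond p k Y m c := by
  induction k with
  | zero => exact ⟨fun _ _ => 0, fun _ _ => 0, fun i hi => absurd hi (Nat.not_lt_zero i)⟩
  | succ k ih =>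
    obtain ⟨m, c, h⟩ := ih
    obtain ⟨m0, c0, z, h1, h2, h3⟩ := exists_row q _ _
      (isLattice_gMat_rowFam (p := p) (i := k) (m := m) (c := c)
        (fun i' hi' j => ((h i' hi').1 j).2.2))
      ((gMat q (fun i => rowFam p (m i) (c i)) k).mulVec (Y k))
    -- Changing row k disturbs neither the conditions on the earlier rows nor the matrix G used for
    -- row k.
    refine ⟨Function.update m k m0, Function.update c k c0, fun i hi => ?_⟩
    have hm : ∀ i' < k, Function.update m k m0 i' = m i' :=
      fun i' h => Function.update_of_ne (by omega) _ _
    have hcc : ∀ i' < k, Function.update c k c0 i' = c i' :=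
      fun i' h => Function.update_of_ne (by omega) _ _
    have hG : ∀ i ≤ k, gMat q (fun i => rowFam p (Function.update m k m0 i)
        (Function.update c k c0 i)) i = gMat q (fun i => rowFam p (m i) (c i)) i := by
      intro i hi
      apply gMat_congr
      intro i' hi'
      rw [hm i' (by omega), hcc i' (by omega)]
    have hsum : ∀ i ≤ k, (fun j => ∑ i' ∈ Finset.range i, Function.update m k m0 i' j) =
        fun j => ∑ i' ∈ Finset.range i, m i' j := by
      intro i hi
      funext j
      apply Finset.sum_congr rfl
      intro i' hi'
      rw [hm i' (by have := Finset.mem_range.mp hi'; omega)]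
    rw [hsum i (by omega)]
    rcases Nat.lt_or_ge i k with hlt | hge
    · obtain ⟨g1, z', g2, g3⟩ := h i hlt
      rw [hm i hlt, hcc i hlt]
      refine ⟨g1, z', g2, ?_⟩
      rw [ycol_eq_iff] at g3 ⊢
      rw [hG i hlt.le, hm i hlt, hcc i hlt]
      exact g3
    · have hik : i = k := by omega
      subst hik
      rw [Function.update_self, Function.update_self]
      refine ⟨h1, z, h2, ?_⟩
      rw [ycol_eq_iff, hG i le_rfl, Function.update_self, Function.update_self, Matrix.mulVec_add]
      exact h3

theorem grassCond_unique {q k : ℕ} {Y : ℕ → Fin q → ℚ_[p]} {m m' : ℕ → Fin q → ℕ}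
    {c c' : ℕ → Fin q → ℤ} (h : GrassCond p k Y m c) (h' : GrassCond p k Y m' c') :
    ∀ i < k, m i = m' i ∧ c i = c' i := by
  intro i
  induction i using Nat.strong_induction_on with
  | _ i ih =>
    intro hi
    obtain ⟨g1, z, g2, g3⟩ := h i hi
    obtain ⟨g1', z', g2', g3'⟩ := h' i hi
    rw [ycol_eq_iff, Matrix.mulVec_add] at g3 g3'
    have hG : gMat q (fun i => rowFam p (m' i) (c' i)) i =
        gMat q (fun i => rowFam p (m i) (c i)) i := by
      apply gMat_congr
      intro i' hi'
      obtain ⟨a1, a2⟩ := ih i' hi' (by omega)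
      rw [a1, a2]
    have hsum : (fun j => ∑ i' ∈ Finset.range i, m' i' j) =
        fun j => ∑ i' ∈ Finset.range i, m i' j := by
      funext j
      apply Finset.sum_congr rfl
      intro i' hi'
      have := Finset.mem_range.mp hi'
      rw [(ih i' this (by omega)).1]
    rw [hG] at g3'
    rw [hsum] at g1'
    obtain ⟨u1, u2, -⟩ := row_unique q _ _
      (isLattice_gMat_rowFam (p := p) (i := i) (m := m) (c := c)
        (fun i' hi' j => ((h i' (by omega)).1 j).2.2)) _ _ _ _ _ _ _ g1 g1' g2 g2' g3 g3'
    exact ⟨u1, u2⟩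

theorem eq_of_ycol_eq {q k : ℕ} {A A' : ℕ → Fin q → ℚ_[p]}
    (h : ∀ i < k, ycol q A i = ycol q A' i) : ∀ i < k, A i = A' i := by
  intro i
  induction i using Nat.strong_induction_on with
  | _ i ih =>
    intro hi
    have h1 := h i hi
    rw [ycol_eq_iff, gMat_congr (fun i' hi' => ih i' hi' (by omega)), gMat_mulVec_ycol] at h1
    exact yvec_injective q h1

end Residues

/-! ### The right factor for two blocks -/

section TwoBlocks

variable {p : ℕ} [Fact p.Prime] {N n : ℕ}

theorem sum_eq_sum_castLE {α : Type*} [AddCommMonoid α] {q m : ℕ} (h : q ≤ m) (f : Fin m → α)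
    (hf : ∀ y : Fin m, q ≤ (y : ℕ) → f y = 0) : ∑ y, f y = ∑ l : Fin q, f (Fin.castLE h l) := by
  obtain ⟨r, rfl⟩ := Nat.exists_eq_add_of_le h
  rw [Fin.sum_univ_add, Finset.sum_eq_zero (s := (Finset.univ : Finset (Fin r))), add_zero]
  · rfl
  · intro i _; exact hf _ (by simp)

theorem wcol_pair_left {k q y : ℕ} (h : y < q) : wcol [k, q] y = k + y := by
  simp [wcol, h]

theorem wcol_pair_right {k q y : ℕ} (h : q ≤ y) : wcol [k, q] y = y - q := by
  simp [wcol, show ¬ y < q by omega]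

/-- The shape (1 *; 0 1) as a rewriting rule for entries; on the free block the rule is the
tautology R i j = R i j. -/
theorem mem_Uw_pair_iff {k q : ℕ} (hK : k + q = n + 1) {R : Mat p n} :
    R ∈ Uw p n [k, q] ↔ ∀ i j : Fin (n + 1),
      R i j = if (i : ℕ) < q ∧ q ≤ (j : ℕ) then R i j else if i = j then 1 else 0 := by
  have hs : [k, q].sum = n + 1 := by simp; omega
  rw [mem_Uw_iff hs]
  constructor
  · rintro ⟨h1, h2⟩ i j
    split_ifs with h h'
    · rfl
    · rw [h', h1.1]
    · rcases lt_or_gt_of_ne h' with h3 | h3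
      · apply h2 i j h3
        rw [Fin.lt_def] at h3
        by_cases hi : (i : ℕ) < q
        · have hj : (j : ℕ) < q := by by_contra hj; exact h ⟨hi, by omega⟩
          rw [wcol_pair_left hi, wcol_pair_left hj]; omega
        · rw [wcol_pair_right (by omega), wcol_pair_right (by omega)]; omega
      · exact h1.2 i j h3
  · intro h
    refine ⟨⟨fun i => ?_, fun i j hij => ?_⟩, fun i j hij hw => ?_⟩
    · rw [h, if_neg (by omega), if_pos rfl]
    · rw [Fin.lt_def] at hij
      rw [h, if_neg (by omega), if_neg (by rintro rfl; omega)]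
    · rw [h, if_neg, if_neg hij.ne]
      rintro ⟨hi, hj⟩
      rw [wcol_pair_left hi, wcol_pair_right hj] at hw
      have := j.2
      omega

/-- The rows of a family on the index set of two blocks. -/
def pairRows (k q : ℕ) {α : Type*} (a : ℕ × ℕ → α) : ℕ → Fin q → α :=
  fun i u => a (i + 1, k + u)

theorem bMap_pair_bottom {k q : ℕ} (hK : k + q = n + 1) (a : ℕ × ℕ → ℚ_[p]) (j : Fin q)
    (x s : Fin (n + 1)) (hx : (x : ℕ) = k + j) :
    bMap n [k, q] a x s = ∑ l : Fin q, gMat q (pairRows k q a) k j l *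
      ((if (s : ℕ) = l then 1 else 0) + ∑ i ∈ Finset.range k,
        ycol q (pairRows k q a) i l * if (s : ℕ) = q + i then 1 else 0) := by
  have h := congrFun (vecMul_ev_grassMat (N := n) q (fun i u => a (i + 1, k + u)) k (by omega) j) s
  rw [vecMul_ev _ _ (by omega) (by omega), ← bMap_pair a k q hK] at h
  rw [show x = ⟨k + 1 + (j : ℕ) - 1, by omega⟩ from Fin.ext (by simp [hx]), h,
    Finset.sum_apply]
  apply Finset.sum_congr rfl
  intro l _
  rw [Pi.smul_apply, Pi.add_apply, Finset.sum_apply, smul_eq_mul]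
  congr 2
  · simp only [ev]; congr 1; apply propext; omega
  · apply Finset.sum_congr rfl
    intro i _
    rw [Pi.smul_apply, smul_eq_mul]
    congr 1
    simp only [ev]; congr 1; apply propext; omega

theorem bMap_pair_bottom_left {k q : ℕ} (hK : k + q = n + 1) (a : ℕ × ℕ → ℚ_[p]) (j l : Fin q)
    (x s : Fin (n + 1)) (hx : (x : ℕ) = k + j) (hl : (s : ℕ) = l) :
    bMap n [k, q] a x s = gMat q (pairRows k q a) k j l := by
  rw [bMap_pair_bottom hK a j x s hx, Finset.sum_eq_single l]
  · rw [if_pos hl, Finset.sum_eq_zero, add_zero, mul_one]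
    intro i _
    rw [if_neg (by omega), mul_zero]
  · intro l' _ hl'
    rw [if_neg (by intro e; exact hl' (Fin.ext (by omega))), Finset.sum_eq_zero, add_zero, mul_zero]
    intro i _
    rw [if_neg (by omega), mul_zero]
  · intro h; exact absurd (Finset.mem_univ _) h

theorem bMap_pair_bottom_right {k q : ℕ} (hK : k + q = n + 1) (a : ℕ × ℕ → ℚ_[p]) (j : Fin q)
    {i : ℕ} (hi : i < k) (x s : Fin (n + 1)) (hx : (x : ℕ) = k + j) (hs : (s : ℕ) = q + i) :
    bMap n [k, q] a x s = (gMat q (pairRows k q a) k).mulVec (ycol q (pairRows k q a) i) j := by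
  rw [bMap_pair_bottom hK a j x s hx, Matrix.mulVec, dotProduct]
  apply Finset.sum_congr rfl
  intro l _
  rw [if_neg (by omega), zero_add, Finset.sum_eq_single i]
  · rw [if_pos hs, mul_one]
  · intro i' _ h'
    rw [if_neg (by omega), mul_zero]
  · intro h; exact absurd (Finset.mem_range.2 hi) h

/-- The bottom q rows of LCR, with R = (1 Y; 0 1), are G'(1 | Y) for the corresponding block G' of
LC. Comparison with the explicit bottom rows of b gives first G' = G and then Y, because G is
invertible. -/
theorem HasBruhat.right_apply {k q : ℕ} (hK : k + q = n + 1) {a : ℕ × ℕ → ℚ_[p]} {L R : Mat p n}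
    (h : HasBruhat n [k, q] a L R) (l : Fin q) {i : ℕ} (hi : i < k) (x s : Fin (n + 1))
    (hx : (x : ℕ) = l) (hs : (s : ℕ) = q + i) : R x s = ycol q (pairRows k q a) i l := by
  obtain ⟨hL, hR, e⟩ := h
  have hsum : [k, q].sum = n + 1 := by simp; omega
  have hR' := (mem_Uw_pair_iff hK).1 hR
  set LC := L * (Matrix.diagonal (torus p n (expoSet n [k, q] a)) * weyl p n [k, q]) with hLC
  -- C sends the last k columns to the first k rows, and L is upper triangular.
  have hz : ∀ (j : Fin q) (y : Fin (n + 1)), q ≤ (y : ℕ) → LC ⟨k + j, by omega⟩ y = 0 := by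
    intro j y hy
    rw [hLC, Matrix.mul_apply]
    apply Finset.sum_eq_zero
    intro z _
    rw [Matrix.diagonal_mul, weyl_apply hsum, wcol_pair_right hy]
    by_cases hz : (z : ℕ) = y - q
    · rw [hL.2 _ z (by rw [Fin.lt_def]; simp only; omega), zero_mul]
    · rw [if_neg hz, mul_zero, mul_zero]
  have hb : ∀ (j : Fin q) (s : Fin (n + 1)), bMap n [k, q] a ⟨k + j, by omega⟩ s =
      ∑ l : Fin q, LC ⟨k + j, by omega⟩ (Fin.castLE (by omega) l) *
        R (Fin.castLE (by omega) l) s := by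
    intro j s
    rw [e, Matrix.mul_apply]
    apply sum_eq_sum_castLE
    intro y hy
    rw [hz j y hy, zero_mul]
  have hG : ∀ j l : Fin q, LC ⟨k + j, by omega⟩ (Fin.castLE (by omega) l) =
      gMat q (pairRows k q a) k j l := by
    intro j l
    rw [← bMap_pair_bottom_left hK a j l ⟨k + j, by omega⟩ (Fin.castLE (by omega) l) rfl rfl, hb,
      Finset.sum_eq_single l]
    · rw [hR' (Fin.castLE _ l), if_neg (by simp), if_pos rfl, mul_one]
    · intro l' _ hl'
      rw [hR' (Fin.castLE _ l'), if_neg (by simp), if_neg, mul_zero]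
      intro e; exact hl' (Fin.ext (by simpa [Fin.ext_iff] using e))
    · intro h; exact absurd (Finset.mem_univ _) h
  have hvec : (gMat q (pairRows k q a) k).mulVec (fun l => R (Fin.castLE (by omega) l) s) =
      (gMat q (pairRows k q a) k).mulVec (ycol q (pairRows k q a) i) := by
    funext j
    rw [← bMap_pair_bottom_right hK a j hi ⟨k + j, by omega⟩ s rfl hs, hb, Matrix.mulVec,
      dotProduct]
    apply Finset.sum_congr rfl
    intro l _
    rw [hG]
  have hinj := Matrix.mulVec_injective_of_isUnit
    ((Matrix.isUnit_iff_isUnit_det _).2 (isLattice_gMat q (pairRows k q a) k).isUnit_det)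
  have := congrFun (hinj hvec) l
  rw [← this]
  congr 1
  exact Fin.ext hx

theorem pair_right_mul {k q : ℕ} (hK : k + q = n + 1) {R R' : Mat p n}
    (hR : R ∈ Uw p n [k, q]) (hR' : R' ∈ Uw p n [k, q]) : R * (1 + (R' - R)) = R' := by
  have h1 := (mem_Uw_pair_iff hK).1 hR
  have h2 := (mem_Uw_pair_iff hK).1 hR'
  have hD : ∀ i j, (R' - R) i j ≠ 0 → (i : ℕ) < q ∧ q ≤ (j : ℕ) := by
    intro i j h
    by_contra h'
    apply h
    rw [Matrix.sub_apply, h1, h2, if_neg h', if_neg h', sub_self]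
  have hRD : R * (R' - R) = R' - R := by
    ext i j
    rw [Matrix.mul_apply, Finset.sum_eq_single i]
    · rw [h1, if_neg (by omega), if_pos rfl, one_mul]
    · intro l _ hl
      by_cases h : (R' - R) l j = 0
      · rw [h, mul_zero]
      · have := hD l j h
        rw [h1, if_neg (by omega), if_neg hl.symm, zero_mul]
    · intro h; exact absurd (Finset.mem_univ _) h
  rw [Matrix.mul_add, Matrix.mul_one, hRD, add_sub_cancel]

theorem inv_mul_mem_Integral_pair_iff {k q : ℕ} (hK : k + q = n + 1) {R R' : Mat p n}
    (hR : R ∈ Uw p n [k, q]) (hR' : R' ∈ Uw p n [k, q]) :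
    R⁻¹ * R' ∈ Integral p n ↔ ∀ i < k, ∀ l : Fin q, ∀ x s : Fin (n + 1), (x : ℕ) = l →
      (s : ℕ) = q + i → ‖R' x s - R x s‖ ≤ 1 := by
  have h1 := (mem_Uw_pair_iff hK).1 hR
  have h2 := (mem_Uw_pair_iff hK).1 hR'
  have e : R⁻¹ * R' = 1 + (R' - R) := by
    nth_rw 1 [← pair_right_mul hK hR hR']
    rw [← Matrix.mul_assoc, inv_mul_cancel_of_mem_U hR.1, Matrix.one_mul]
  rw [e]
  constructor
  · intro h i hi l x s hx hs
    have := h x s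
    rwa [Matrix.add_apply, Matrix.one_apply_ne (by rintro rfl; omega), zero_add] at this
  · intro h x s
    rw [Matrix.add_apply]
    apply norm_add_le_one (one_mem_Integral x s)
    by_cases h' : (x : ℕ) < q ∧ q ≤ (s : ℕ)
    · have := s.2
      exact h (s - q) (by omega) ⟨x, h'.1⟩ x s rfl (by omega)
    · rw [Matrix.sub_apply, h1, h2, if_neg h', if_neg h']; simp

/-- The family with the given rows. -/
def ofRows (k q : ℕ) {α : Type*} [Zero α] (f : ℕ → Fin q → α) : ℕ × ℕ → α :=
  fun x => if h : (1 ≤ x.1 ∧ x.1 ≤ k) ∧ k ≤ x.2 ∧ x.2 < k + q then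
    f (x.1 - 1) ⟨x.2 - k, by omega⟩ else 0

theorem pairRows_ofRows {k q : ℕ} {α : Type*} [Zero α] (f : ℕ → Fin q → α) {i : ℕ} (hi : i < k) :
    pairRows k q (ofRows k q f) i = f i := by
  funext u
  have := u.2
  rw [pairRows, ofRows, dif_pos ⟨⟨by simp, by simp only; omega⟩, by simp, by simp⟩]
  simp

theorem ofRows_of_notMem {k q : ℕ} {α : Type*} [Zero α] (f : ℕ → Fin q → α) {x : ℕ × ℕ}
    (hx : x ∉ indexSet [k, q]) : ofRows k q f x = 0 := by
  rw [ofRows, dif_neg]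
  rw [mem_indexSet_pair] at hx
  omega

theorem eq_of_pairRows_eq {k q : ℕ} {α : Type*} {a a' : ℕ × ℕ → α}
    (h : ∀ i < k, pairRows k q a i = pairRows k q a' i) {x : ℕ × ℕ} (hx : x ∈ indexSet [k, q]) :
    a x = a' x := by
  rw [mem_indexSet_pair] at hx
  have := congrFun (h (x.1 - 1) (by omega)) ⟨x.2 - k, by omega⟩
  simp only [pairRows] at this
  rwa [show x.1 - 1 + 1 = x.1 by omega, show k + (x.2 - k) = x.2 by omega] at this

/-- Identifies the exponent of C_{i,j} with the bound coming from back substitution: the lattice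
diagonal, the exponent itself, and the later exponents of the row. -/
theorem cExp_pair {k q : ℕ} (m : ℕ × ℕ → ℕ) (i : ℕ) (u : Fin q) :
    cExp [k, q] m 1 (i + 1, k + u) = ∑ i' ∈ Finset.range i, pairRows k q m i' u +
      pairRows k q m i u + ∑ b ∈ Finset.Ioi u, pairRows k q m i b := by
  rw [cExp, ← Finset.sum_range_succ]
  congr 1
  · refine Finset.sum_nbij' (fun a => a - 1) (fun a => a + 1) ?_ ?_ ?_ ?_ ?_
    · intro a ha; simp only [Finset.mem_Icc, Finset.mem_range] at *; omega
    · intro a ha; simp only [Finset.mem_Icc, Finset.mem_range] at *; omega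
    · intro a ha; simp only [Finset.mem_Icc] at *; omega
    · intro a _; simp
    · intro a ha
      simp only [Finset.mem_Icc] at ha
      rw [pairRows, show a - 1 + 1 = a by omega]
  · symm
    refine Finset.sum_bij (fun b _ => k + (b : ℕ)) ?_ ?_ ?_ ?_
    · intro b hb
      simp only [Finset.mem_Ioi, Fin.lt_def] at hb
      have := b.2
      simp only [Finset.mem_Icc, kappa, List.take_succ_cons, List.take_nil, List.sum_cons,
        List.sum_nil]
      omega
    · intro b _ b' _ h; exact Fin.ext (by omega)
    · intro a ha
      simp only [Finset.mem_Icc, kappa, List.take_succ_cons, List.take_nil, List.sum_cons,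
        List.sum_nil] at ha
      exact ⟨⟨a - k, by omega⟩, by simp only [Finset.mem_Ioi, Fin.lt_def]; omega,
        by simp only; omega⟩
    · intro b _; rfl

theorem mem_CSet_pair_iff {k q : ℕ} (m : ℕ × ℕ → ℕ) (c : ℕ × ℕ → ℤ) :
    c ∈ CSet p [k, q] m ↔ (∀ x ∉ indexSet [k, q], c x = 0) ∧ ∀ i < k,
      RowCond p (fun j => ∑ i' ∈ Finset.range i, pairRows k q m i' j) (pairRows k q m i)
        (pairRows k q c i) := by
  refine and_congr Iff.rfl ⟨fun h i hi u => ?_, fun h l hl x hx => ?_⟩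
  · have := u.2
    have := h 1 (by simp) (i + 1, k + u) (by
      simp only [indexBlock, Set.mem_ofPred_eq, kappa, List.take_succ_cons, List.take_nil,
        List.take_zero, List.sum_cons, List.sum_nil]
      omega)
    rwa [cExp_pair] at this
  · have h1 : l = 1 := by simp at hl; omega
    subst h1
    simp only [indexBlock, Set.mem_ofPred_eq, kappa, List.take_succ_cons, List.take_nil,
        List.take_zero, List.sum_cons, List.sum_nil] at hx
    have := h (x.1 - 1) (by omega) ⟨x.2 - k, by omega⟩
    rw [← cExp_pair] at this
    simp only [pairRows] at this
    rwa [show x.1 - 1 + 1 = x.1 by omega, show k + (x.2 - k) = x.2 by omega] at this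

/-- The pair `(m, c)` parametrizes a right factor in the class of `R` modulo `U_w(ℤ_p)`. -/
def Param {p : ℕ} [Fact p.Prime] (N : ℕ) (bs : List ℕ) (R : Mat p N)
    (y : (ℕ × ℕ → ℕ) × (ℕ × ℕ → ℤ)) : Prop :=
  (∀ x ∉ indexSet bs, y.1 x = 0) ∧ y.2 ∈ CSet p bs y.1 ∧
    ∃ L' R', HasBruhat N bs (family p y.1 y.2) L' R' ∧ R⁻¹ * R' ∈ Integral p N

/-- U_v is abelian, so congruence of right factors is congruence of the blocks Y column by column,
and these columns are given by `ycol`. -/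
theorem param_pair_iff {k q : ℕ} (hK : k + q = n + 1) {R : Mat p n} (hR : R ∈ Uw p n [k, q])
    (y : (ℕ × ℕ → ℕ) × (ℕ × ℕ → ℤ)) :
    Param n [k, q] R y ↔ (∀ x ∉ indexSet [k, q], y.1 x = 0) ∧ (∀ x ∉ indexSet [k, q], y.2 x = 0) ∧
      GrassCond p k (fun i l => if h : i < k then R ⟨l, by omega⟩ ⟨q + i, by omega⟩ else 0)
        (pairRows k q y.1) (pairRows k q y.2) := by
  obtain ⟨L', R', hb⟩ := hasBruhat_pair hK (family p y.1 y.2)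
  have key : ∀ L' R', HasBruhat n [k, q] (family p y.1 y.2) L' R' → (R⁻¹ * R' ∈ Integral p n ↔
      ∀ i < k, ∃ z : Fin q → ℚ_[p], (∀ j, ‖z j‖ ≤ 1) ∧
      ycol q (fun i => rowFam p (pairRows k q y.1 i) (pairRows k q y.2 i)) i =
        (fun l : Fin q => if h : i < k then R ⟨l, by omega⟩ ⟨q + i, by omega⟩ else 0) + z) := by
    intro L' R' hb
    rw [inv_mul_mem_Integral_pair_iff hK hR hb.2.1]
    refine forall_congr' fun i => forall_congr' fun hi => ⟨fun h => ?_, ?_⟩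
    · refine ⟨fun l => R' ⟨l, by omega⟩ ⟨q + i, by omega⟩ - R ⟨l, by omega⟩ ⟨q + i, by omega⟩,
        fun l => h l _ _ rfl rfl, ?_⟩
      funext l
      rw [Pi.add_apply, dif_pos hi, add_sub_cancel, hb.right_apply hK l hi _ _ rfl rfl]
      rfl
    · rintro ⟨z, hz, e⟩ l x s hx hs
      have hx' : x = ⟨l, by omega⟩ := Fin.ext hx
      have hs' : s = ⟨q + i, by omega⟩ := Fin.ext hs
      rw [hx', hs']
      have e1 := congrFun e l
      rw [Pi.add_apply, dif_pos hi] at e1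
      rw [hb.right_apply hK l hi _ _ rfl rfl]
      refine le_trans (le_of_eq ?_) (hz l)
      rw [show z l = _ from eq_sub_of_add_eq' e1.symm]
      rfl
  rw [Param, mem_CSet_pair_iff]
  constructor
  · rintro ⟨h1, ⟨h2, h3⟩, L', R', hb, h4⟩
    exact ⟨h1, h2, fun i hi => ⟨h3 i hi, (key L' R' hb).1 h4 i hi⟩⟩
  · rintro ⟨h1, h2, h3⟩
    exact ⟨h1, ⟨h2, fun i hi => (h3 i hi).1⟩, L', R', hb, (key L' R' hb).2 fun i hi => (h3 i hi).2⟩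

theorem existsUnique_param_pair {k q : ℕ} (hK : k + q = n + 1) {R : Mat p n}
    (hR : R ∈ Uw p n [k, q]) : ∃! y, Param n [k, q] R y := by
  obtain ⟨m, c, h⟩ := exists_grassCond k (fun i (l : Fin q) =>
    if h : i < k then R ⟨l, by omega⟩ ⟨q + i, by omega⟩ else 0)
  refine ⟨(ofRows k q m, ofRows k q c), ?_, ?_⟩
  · refine (param_pair_iff hK hR _).2 ⟨fun x => ofRows_of_notMem m, fun x => ofRows_of_notMem c,
      fun i hi => ?_⟩
    have hm : ∀ i' < k, pairRows k q (ofRows k q m) i' = m i' := fun i' h => pairRows_ofRows m h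
    have hc : ∀ i' < k, pairRows k q (ofRows k q c) i' = c i' := fun i' h => pairRows_ofRows c h
    obtain ⟨h1, z, hz, e⟩ := h i hi
    refine ⟨?_, z, hz, ?_⟩
    · simp only [hm i hi, hc i hi]
      convert h1 using 3 with j i' hi'
      rw [hm i' (by simp at hi'; omega)]
    · rw [← e, ycol_eq_iff]
      simp only [hm i hi, hc i hi]
      rw [gMat_congr (A' := fun i => rowFam p (m i) (c i)), gMat_mulVec_ycol]
      intro i' hi'
      simp only [hm i' (by omega), hc i' (by omega)]
  · rintro ⟨m', c'⟩ h'
    obtain ⟨h1, h2, h3⟩ := (param_pair_iff hK hR _).1 h'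
    have hu := grassCond_unique h3 h
    have hm : m' = ofRows k q m := by
      funext x
      by_cases hx : x ∈ indexSet [k, q]
      · refine eq_of_pairRows_eq (fun i hi => ?_) hx
        rw [pairRows_ofRows m hi]; exact (hu i hi).1
      · rw [ofRows_of_notMem m hx]; exact h1 x hx
    have hc : c' = ofRows k q c := by
      funext x
      by_cases hx : x ∈ indexSet [k, q]
      · refine eq_of_pairRows_eq (fun i hi => ?_) hx
        rw [pairRows_ofRows c hi]; exact (hu i hi).2
      · rw [ofRows_of_notMem c hx]; exact h2 x hx
    rw [hm, hc]

theorem HasBruhat.eq_of_right_eq_pair {k q : ℕ} (hK : k + q = n + 1) {a a' : ℕ × ℕ → ℚ_[p]}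
    {L L' R : Mat p n} (h : HasBruhat n [k, q] a L R) (h' : HasBruhat n [k, q] a' L' R)
    {x : ℕ × ℕ} (hx : x ∈ indexSet [k, q]) : a x = a' x := by
  refine eq_of_pairRows_eq (eq_of_ycol_eq fun i hi => ?_) hx
  funext l
  rw [← h.right_apply hK l hi ⟨l, by omega⟩ ⟨q + i, by omega⟩ rfl rfl,
    ← h'.right_apply hK l hi ⟨l, by omega⟩ ⟨q + i, by omega⟩ rfl rfl]

/-! ### Explicit entries -/

theorem yvec_last {q : ℕ} (a : Fin (q + 1) → ℚ_[p]) :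
    yvec (q + 1) a (Fin.last q) = a (Fin.last q) := by
  induction q with
  | zero => simp [yvec_zero]
  | succ q ih => rw [← Fin.succ_last, yvec_succ, ih]

/-- The last row of G has only its diagonal entry, so this coordinate is obtained without inverting
G. -/
theorem ycol_last {q : ℕ} (A : ℕ → Fin (q + 1) → ℚ_[p]) (i : ℕ) :
    ycol (q + 1) A i (Fin.last q) =
      A i (Fin.last q) * (p : ℚ_[p]) ^ (-(∑ i' ∈ Finset.range i, (mu (A i' (Fin.last q)) : ℤ))) := by
  have h := congrFun (gMat_mulVec_ycol (q + 1) A i) (Fin.last q)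
  have hG := isLattice_gMat (q + 1) A i
  rw [yvec_last, Matrix.mulVec, dotProduct, Finset.sum_eq_single (Fin.last q), hG.diag] at h
  · rw [← h, mul_right_comm, zpow_neg, ← Nat.cast_sum, zpow_natCast, mul_inv_cancel₀
      (pow_ne_zero _ p_ne_zero), one_mul]
  · intro l _ hl
    rw [hG.upper _ _ (Fin.lt_last_iff_ne_last.2 hl), zero_mul]
  · intro h; exact absurd (Finset.mem_univ _) h

theorem HasBruhat.right_last {k q : ℕ} (hq : 1 ≤ q) (hK : k + q = n + 1) {a : ℕ × ℕ → ℚ_[p]}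
    {L R : Mat p n} (h : HasBruhat n [k, q] a L R) {i : ℕ} (hi : i < k) (x s : Fin (n + 1))
    (hx : (x : ℕ) + 1 = q) (hs : (s : ℕ) = q + i) :
    R x s = a (i + 1, n) *
      (p : ℚ_[p]) ^ (-(∑ i' ∈ Finset.range i, (mu (a (i' + 1, n)) : ℤ))) := by
  obtain ⟨q, rfl⟩ := Nat.exists_eq_add_of_le' hq
  rw [h.right_apply hK (Fin.last q) hi x s (by simp; omega) hs, ycol_last]
  simp only [pairRows, Fin.val_last, show k + q = n by omega]

/-- Each new row of letters fixes all basis vectors reached so far except the topmost, e_{k+1},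
which its first letter splits into e_{k+1} and e_{k+2}. -/
theorem grassMat_mulVec_ev_one (q : ℕ) (hq : 1 ≤ q) (A : ℕ → ℕ → ℚ_[p]) (k : ℕ)
    (h2 : k + q ≤ N + 1) :
    (grassMat N q A k).mulVec (ev p N 1) =
      ∑ j ∈ Finset.range k, (dPart (A j 0) * (p : ℚ_[p]) ^ (∑ l ∈ Finset.range j, mu (A l 0))) •
        ev p N (j + 1) + (p : ℚ_[p]) ^ (∑ l ∈ Finset.range k, mu (A l 0)) • ev p N (k + 1) := by
  induction k with
  | zero => simp [grassMat]
  | succ k ih =>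
    obtain ⟨q, rfl⟩ := Nat.exists_eq_add_of_le' hq
    rw [grassMat, ← Matrix.mulVec_mulVec, ih (by omega), Matrix.mulVec_add, Matrix.mulVec_smul,
      Matrix.mulVec_sum, Finset.sum_range_succ, add_assoc]
    congr 1
    · apply Finset.sum_congr rfl
      intro j hj
      rw [Finset.mem_range] at hj
      rw [Matrix.mulVec_smul, rowMat_mulVec_of_lt _ _ _ (by omega) (by omega) _ (by omega)
        (by omega) (Or.inl (by omega))]
    · rw [rowMat, ← Matrix.mulVec_mulVec, rowMat_mulVec_of_lt _ _ _ (by omega) (by omega) _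
        (by omega) (by omega) (Or.inl (by omega)), bSimple_mulVec_self (by omega) (by omega),
        smul_add, smul_smul, smul_smul, Finset.sum_range_succ, pow_add, mul_comm (dPart _)]

theorem bMap_pair_first_column {k q : ℕ} (hq : 1 ≤ q) (hK : k + q = n + 1) (a : ℕ × ℕ → ℚ_[p])
    (x s : Fin (n + 1)) (hs : (s : ℕ) = 0) :
    bMap n [k, q] a x s = if (x : ℕ) ≤ k then (if (x : ℕ) = k then 1 else dPart (a (x + 1, k))) *
      (p : ℚ_[p]) ^ (∑ l ∈ Finset.range x, mu (a (l + 1, k))) else 0 := by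
  have h := congrFun (grassMat_mulVec_ev_one (N := n) q hq (fun i u => a (i + 1, k + u)) k
    (by omega)) x
  rw [mulVec_ev _ _ (by omega) (by omega), ← bMap_pair a k q hK] at h
  rw [show s = ⟨1 - 1, by omega⟩ from Fin.ext hs, h, Pi.add_apply, Finset.sum_apply]
  simp only [Pi.smul_apply, ev, smul_eq_mul, add_zero, Nat.add_right_cancel_iff]
  rcases lt_trichotomy (x : ℕ) k with hx | hx | hx
  · rw [Finset.sum_eq_single (x : ℕ), if_pos rfl, if_neg hx.ne, if_pos hx.le, if_neg hx.ne]
    · ring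
    · intro j _ hj; rw [if_neg hj.symm, mul_zero]
    · intro h; exact absurd (Finset.mem_range.2 hx) h
  · rw [Finset.sum_eq_zero, if_pos hx, if_pos hx.le, if_pos hx, hx]
    · ring
    · intro j hj; rw [Finset.mem_range] at hj; rw [if_neg (by omega), mul_zero]
  · rw [Finset.sum_eq_zero, if_neg hx.ne', if_neg (by omega)]
    · ring
    · intro j hj; rw [Finset.mem_range] at hj; rw [if_neg (by omega), mul_zero]

end TwoBlocks

/-! ### Parametrization of the right factors -/

section Param

variable {p : ℕ} [Fact p.Prime] {N n : ℕ}

theorem HasBruhat.unique {bs : List ℕ} (hs : bs.sum = N + 1) {a : ℕ × ℕ → ℚ_[p]}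
    {L L' R R' : Mat p N} (h : HasBruhat N bs a L R) (h' : HasBruhat N bs a L' R') :
    L = L' ∧ R = R' := by
  have := bruhat_unique (isUnit_det_weyl hs) h.1 h'.1 h.2.1 h'.2.1 (torus_ne_zero _)
    (h.2.2.symm.trans h'.2.2)
  exact ⟨this.1, this.2.2⟩

theorem HasBruhat.congr {K : ℕ} {rest : List ℕ} (hK : 1 ≤ K) (hs : (K :: rest).sum = N + 1)
    {a a' : ℕ × ℕ → ℚ_[p]} (haa : ∀ x ∈ indexSet (K :: rest), a x = a' x)
    {L R : Mat p N} (h : HasBruhat N (K :: rest) a L R) : HasBruhat N (K :: rest) a' L R := by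
  refine ⟨h.1, h.2.1, ?_⟩
  have : expoSet N (K :: rest) a' = expoSet N (K :: rest) a :=
    funext fun l => expoSet_congr (fun x hx => by rw [haa x hx]) l
  rw [this, ← bMap_congr rest K hK hs haa, h.2.2]

/-- By uniqueness, the factors constructed in `bruhat_merge` are the factors of any given
decomposition of the merged product. -/
theorem HasBruhat.merge {k q : ℕ} {rest : List ℕ} (hK : k + q = n + 1)
    (hs : (k :: q :: rest).sum = N + 1) (h : n ≤ N) {a : ℕ × ℕ → ℚ_[p]} {L' R' LL RR : Mat p N}
    {L R : Mat p n} (hb' : HasBruhat N ((k + q) :: rest) a L' R')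
    (hb : HasBruhat n [k, q] a L R) (hbb : HasBruhat N (k :: q :: rest) a LL RR) :
    LL = L' * ((Matrix.diagonal (torus p N (expoSet N ((k + q) :: rest) a)) *
      weyl p N ((k + q) :: rest)) * idSum N L *
      (Matrix.diagonal (torus p N (expoSet N ((k + q) :: rest) a)) *
      weyl p N ((k + q) :: rest))⁻¹) ∧
    (∀ A B, toB h R' = Matrix.fromBlocks A B 0 1 → toB h RR =
      Matrix.fromBlocks A (B * bMap n [k, q] a) 0 R) ∧
    (Matrix.diagonal (torus p N (expoSet N ((k + q) :: rest) a)) * weyl p N ((k + q) :: rest)) *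
      idSum N (Matrix.diagonal (torus p n (expoSet n [k, q] a)) * weyl p n [k, q]) =
      Matrix.diagonal (torus p N (expoSet N (k :: q :: rest) a)) * weyl p N (k :: q :: rest) := by
  obtain ⟨RR', h1, h2, h3, h4, h5⟩ := bruhat_merge hK hs h
    (torus_ne_zero (expoSet N ((k + q) :: rest) a)) (torus_ne_zero (expoSet n [k, q] a)) hb'.1 hb.1 hb'.2.1 hb.2.1
  have e0 := bMap_merge a k q rest hK hs
  rw [hb'.2.2, hb.2.2, h5, torus_merge hK h] at e0
  obtain ⟨e1, e2⟩ := hbb.unique hs ⟨h2, h1, e0⟩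
  rw [torus_merge hK h] at h4
  refine ⟨e1, ?_, h4⟩
  rw [e2, hb.2.2]
  exact h3

/-- A matrix with entries in `ℤ_p`. -/
def IntMat {m n : Type*} (A : Matrix m n ℚ_[p]) : Prop := ∀ i j, ‖A i j‖ ≤ 1

theorem IntMat.mul {l m n : Type*} [Fintype m] {A : Matrix l m ℚ_[p]} {B : Matrix m n ℚ_[p]}
    (hA : IntMat A) (hB : IntMat B) : IntMat (A * B) := by
  intro i j
  rw [Matrix.mul_apply]
  exact norm_sum_le_one _ _ fun l _ => norm_mul_le_one (hA i l) (hB l j)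

theorem mem_Integral_iff_blocks (h : n ≤ N) {u : Mat p N}
    {A : Matrix (Fin (N - n)) (Fin (N - n)) ℚ_[p]} {B : Matrix (Fin (N - n)) (Fin (n + 1)) ℚ_[p]}
    {D : Mat p n} (hu : toB h u = Matrix.fromBlocks A B 0 D) :
    u ∈ Integral p N ↔ IntMat A ∧ IntMat B ∧ D ∈ Integral p n := by
  have key : ∀ x y, u (blockEquiv h x) (blockEquiv h y) = Matrix.fromBlocks A B 0 D x y :=
    fun x y => congrFun (congrFun hu x) y
  constructor
  · intro hi
    refine ⟨fun i j => ?_, fun i j => ?_, fun i j => ?_⟩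
    · exact (congrArg norm (key (Sum.inl i) (Sum.inl j))).symm.trans_le (hi _ _)
    · exact (congrArg norm (key (Sum.inl i) (Sum.inr j))).symm.trans_le (hi _ _)
    · exact (congrArg norm (key (Sum.inr i) (Sum.inr j))).symm.trans_le (hi _ _)
  · rintro ⟨hA, hB, hD⟩ i j
    obtain ⟨i, rfl⟩ := (blockEquiv h).surjective i
    obtain ⟨j, rfl⟩ := (blockEquiv h).surjective j
    rw [key]
    rcases i with i | i <;> rcases j with j | j
    · exact hA i j
    · exact hB i j
    · simp
    · exact hD i j

theorem toB_surjective (h : n ≤ N) : Function.Surjective (toB (p := p) h) := by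
  intro M
  refine ⟨M.submatrix (blockEquiv h).symm (blockEquiv h).symm, ?_⟩
  simp [toB]

theorem toB_inv (h : n ≤ N) {u : Mat p N} {A : Matrix (Fin (N - n)) (Fin (N - n)) ℚ_[p]}
    {B : Matrix (Fin (N - n)) (Fin (n + 1)) ℚ_[p]} {D : Mat p n}
    (hu : toB h u = Matrix.fromBlocks A B 0 D) (hA : IsUnit A.det) (hD : IsUnit D.det) :
    toB h u⁻¹ = Matrix.fromBlocks A⁻¹ (-(A⁻¹ * B * D⁻¹)) 0 D⁻¹ := by
  rw [← Matrix.inv_fromBlocks_zero₂₁_of_isUnit_iff, ← hu, toB, toB, Matrix.inv_submatrix_equiv]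
  rw [Matrix.isUnit_iff_isUnit_det, Matrix.isUnit_iff_isUnit_det]
  exact iff_of_true hA hD

theorem isUnit_det_of_unipotent {m : ℕ} {A : Matrix (Fin m) (Fin m) ℚ_[p]}
    (hA : (∀ i, A i i = 1) ∧ ∀ i j, j < i → A i j = 0) : IsUnit A.det := by
  rw [Matrix.det_of_isUpperTriangular (fun i j h => hA.2 i j h)]
  simp [hA.1]

/-- The upper right blocks of the two quotients are Xg and X with the same X, and g is invertible
over ℤ_p. `Ra` is chosen to make this happen. -/
theorem inv_mul_mem_Integral_merge_iff (h : n ≤ N) {R RR Ra R' : Mat p N}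
    {A A' : Matrix (Fin (N - n)) (Fin (N - n)) ℚ_[p]}
    {B B' : Matrix (Fin (N - n)) (Fin (n + 1)) ℚ_[p]} {D D' g : Mat p n}
    (hA : IsUnit A.det) (hD : IsUnit D.det) (hg : IsIntUnit g)
    (hR : toB h R = Matrix.fromBlocks A B 0 D)
    (hRR : toB h RR = Matrix.fromBlocks A' (B' * g) 0 D')
    (hRa : toB h Ra = Matrix.fromBlocks A (B * (D⁻¹ * D' * g⁻¹)) 0 1)
    (hR' : toB h R' = Matrix.fromBlocks A' B' 0 1) :
    R⁻¹ * RR ∈ Integral p N ↔ D⁻¹ * D' ∈ Integral p n ∧ Ra⁻¹ * R' ∈ Integral p N := by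
  set X := A⁻¹ * B' + -(A⁻¹ * (B * (D⁻¹ * D' * g⁻¹))) with hX
  have e1 : toB h (R⁻¹ * RR) = Matrix.fromBlocks (A⁻¹ * A') (X * g) 0 (D⁻¹ * D') := by
    rw [toB_mul, toB_inv h hR hA hD, hRR, Matrix.fromBlocks_multiply, hX]
    simp only [Matrix.mul_zero, Matrix.zero_mul, add_zero, zero_add, Matrix.add_mul,
      Matrix.neg_mul, Matrix.mul_assoc, Matrix.nonsing_inv_mul _ hg.isUnit_det, Matrix.mul_one]
  have e2 : toB h (Ra⁻¹ * R') = Matrix.fromBlocks (A⁻¹ * A') X 0 1 := by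
    rw [toB_mul, toB_inv h hRa hA (by simp), hR', Matrix.fromBlocks_multiply, hX]
    simp only [Matrix.mul_zero, Matrix.zero_mul, add_zero, zero_add, inv_one, Matrix.mul_one]
  rw [mem_Integral_iff_blocks h e1, mem_Integral_iff_blocks h e2]
  have hXg : IntMat (X * g) ↔ IntMat X := by
    refine ⟨fun h => ?_, fun h => h.mul hg.integral⟩
    have := h.mul (show IntMat g⁻¹ from hg.inv_integral)
    rwa [Matrix.mul_assoc, Matrix.mul_nonsing_inv _ hg.isUnit_det, Matrix.mul_one] at this
  rw [hXg]
  have := one_mem_Integral (p := p) (N := n)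
  tauto

/-- The lower right block determines a on I_v, hence also g = b_v(a). Cancelling g from Bg recovers
the right factor for w', to which induction applies. -/
theorem HasBruhat.eq_of_right_eq : ∀ (rest : List ℕ) {K N : ℕ}, 1 ≤ K → (K :: rest).sum = N + 1 →
    ∀ {a a' : ℕ × ℕ → ℚ_[p]} {L L' R : Mat p N}, HasBruhat N (K :: rest) a L R →
    HasBruhat N (K :: rest) a' L' R → ∀ x ∈ indexSet (K :: rest), a x = a' x
  | [], K, N, _, _, a, a', L, L', R, _, _, x, hx => by
      rw [indexSet_singleton] at hx; exact absurd hx (Set.notMem_empty x)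
  | q :: rest, K, N, hK, hs, a, a', L, L', R, hb, hb', x, hx => by
      have hs' : ((K + q) :: rest).sum = N + 1 := by simp at hs ⊢; omega
      have hn : K + q = (K + q - 1) + 1 := by omega
      have h : K + q - 1 ≤ N := by simp at hs; omega
      obtain ⟨L1, R1, h1⟩ := exists_hasBruhat rest (K + q) (by omega) hs' a
      obtain ⟨L2, R2, h2⟩ := hasBruhat_pair hn a
      obtain ⟨L1', R1', h1'⟩ := exists_hasBruhat rest (K + q) (by omega) hs' a'
      obtain ⟨L2', R2', h2'⟩ := hasBruhat_pair hn a'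
      obtain ⟨A, B, D, e⟩ := exists_toB_of_mem_U h h1.2.1.1
      obtain ⟨-, -, rfl⟩ := (mem_Uw_merged_iff hn hs' h e).1 h1.2.1
      obtain ⟨A', B', D', e'⟩ := exists_toB_of_mem_U h h1'.2.1.1
      obtain ⟨-, -, rfl⟩ := (mem_Uw_merged_iff hn hs' h e').1 h1'.2.1
      have e1 := (h1.merge hn hs h h2 hb).2.1 A B e
      have e2 := (h1'.merge hn hs h h2' hb').2.1 A' B' e'
      rw [e1, Matrix.fromBlocks_inj] at e2
      obtain ⟨rfl, e3, -, rfl⟩ := e2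
      have hv : ∀ x ∈ indexSet [K, q], a x = a' x := fun x => h2.eq_of_right_eq_pair hn h2'
      have hg := (isIntUnit_bMap (p := p) (N := K + q - 1) (bs := [K, q])
        (by simp; omega) a).isUnit_det
      rw [← bMap_pair_congr hn hv] at e3
      have hBB : B = B' := by
        have := congrArg (fun M : Matrix _ _ ℚ_[p] => M * (bMap (K + q - 1) [K, q] a)⁻¹) e3
        simpa only [Matrix.mul_assoc, Matrix.mul_nonsing_inv _ hg, Matrix.mul_one] using this
      subst hBB
      have hRR : R1 = R1' := toB_injective h (e.trans e'.symm)
      subst hRR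
      rw [indexSet_merge] at hx
      rcases hx with hx | hx
      · exact HasBruhat.eq_of_right_eq rest (by omega) hs' h1 h1' x hx
      · exact hv x hx

/-! ### Restricting parameters to the two parts of the index set. -/

theorem indexBlock_subset {bs : List ℕ} {l : ℕ} (hl : l ∈ Set.Ico 1 bs.length) :
    indexBlock bs l ⊆ indexSet bs := fun _ hx => mem_indexSet.2 ⟨l, hl, hx⟩

/-- All m_{a,j} and m_{i,a} entering the exponent at a point of I_l lie in I_l as well. This
locality makes C_w(m) a product. -/
theorem cExp_indicator {bs : List ℕ} {l : ℕ} (hl : l ∈ Set.Ico 1 bs.length) (m : ℕ × ℕ → ℕ)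
    {x : ℕ × ℕ} (hx : x ∈ indexBlock bs l) :
    cExp bs ((indexSet bs).indicator m) l x = cExp bs m l x := by
  have hm : ∀ y ∈ indexBlock bs l, (indexSet bs).indicator m y = m y :=
    fun y hy => Set.indicator_of_mem (indexBlock_subset hl hy) m
  simp only [indexBlock, Set.mem_ofPred_eq] at hx hm
  rw [cExp, cExp]
  congr 1
  · apply Finset.sum_congr rfl
    intro a ha
    rw [Finset.mem_Icc] at ha
    exact hm _ ⟨ha.1, by simp only; omega, hx.2.2.1, hx.2.2.2⟩
  · apply Finset.sum_congr rfl
    intro a ha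
    rw [Finset.mem_Icc] at ha
    exact hm _ ⟨hx.1, hx.2.1, by simp only; omega, by simp only; omega⟩

theorem mem_CSet_indicator_iff (bs : List ℕ) (m : ℕ × ℕ → ℕ) (c : ℕ × ℕ → ℤ) :
    (indexSet bs).indicator c ∈ CSet p bs ((indexSet bs).indicator m) ↔
      ∀ l ∈ Set.Ico 1 bs.length, ∀ x ∈ indexBlock bs l,
        0 ≤ c x ∧ c x < (p : ℤ) ^ cExp bs m l x ∧ IsCoprime (c x) ((p : ℤ) ^ m x) := by
  have h0 : ∀ x ∉ indexSet bs, (indexSet bs).indicator c x = 0 :=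
    fun x hx => Set.indicator_of_notMem hx c
  rw [CSet, Set.mem_ofPred_eq, and_iff_right h0]
  refine forall_congr' fun l => forall_congr' fun hl => forall_congr' fun x =>
    forall_congr' fun hx => ?_
  rw [cExp_indicator hl m hx, Set.indicator_of_mem (indexBlock_subset hl hx),
    Set.indicator_of_mem (indexBlock_subset hl hx)]

theorem mem_CSet_merge_iff (k q : ℕ) (rest : List ℕ) (m : ℕ × ℕ → ℕ) (c : ℕ × ℕ → ℤ) :
    c ∈ CSet p (k :: q :: rest) m ↔ (∀ x ∉ indexSet (k :: q :: rest), c x = 0) ∧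
      (indexSet ((k + q) :: rest)).indicator c ∈
        CSet p ((k + q) :: rest) ((indexSet ((k + q) :: rest)).indicator m) ∧
      (indexSet [k, q]).indicator c ∈ CSet p [k, q] ((indexSet [k, q]).indicator m) := by
  rw [mem_CSet_indicator_iff, mem_CSet_indicator_iff]
  have e1 : indexBlock [k, q] 1 = indexBlock (k :: q :: rest) 1 := by
    rw [indexBlock_one, indexBlock_one]
  have e2 : ∀ x, cExp [k, q] m 1 x = cExp (k :: q :: rest) m 1 x := by
    intro x; simp [cExp, kappa]
  have e3 : ∀ l x, 1 ≤ l → cExp (k :: q :: rest) m (l + 1) x = cExp ((k + q) :: rest) m l x := by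
    intro l x hl; rw [cExp, cExp, kappa_merge _ _ _ _ (by omega)]
  refine and_congr Iff.rfl ⟨fun h => ⟨fun l hl x hx => ?_, fun l hl x hx => ?_⟩, ?_⟩
  · rw [← e3 l x hl.1]
    refine h (l + 1) ?_ x ?_
    · simp only [Set.mem_Ico, List.length_cons] at hl ⊢; omega
    · rwa [indexBlock_merge _ _ _ _ hl.1]
  · obtain rfl : l = 1 := by simp at hl; omega
    rw [e2]
    rw [e1] at hx
    exact h 1 (by simp) x hx
  · rintro ⟨h1, h2⟩ l hl x hx
    rcases Nat.eq_or_lt_of_le hl.1 with rfl | hl2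
    · rw [← e2]
      rw [← e1] at hx
      exact h2 1 (by simp) x hx
    · obtain ⟨l, rfl⟩ := Nat.exists_eq_add_of_le' hl.1
      rw [e3 l x (by omega)]
      rw [indexBlock_merge _ _ _ _ (by omega)] at hx
      refine h1 l ?_ x hx
      simp only [Set.mem_Ico, List.length_cons] at hl ⊢; omega

theorem family_indicator {I : Set (ℕ × ℕ)} (m : ℕ × ℕ → ℕ) (c : ℕ × ℕ → ℤ) {x : ℕ × ℕ}
    (hx : x ∈ I) : family p (I.indicator m) (I.indicator c) x = family p m c x := by
  rw [family, family, Set.indicator_of_mem hx, Set.indicator_of_mem hx]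

/-- The target `Ra` for w' depends on the I_v-part of y, through R2 and g. Thus the two conditions
have to be solved in order, the one for v first. -/
theorem param_merge_iff {k q : ℕ} {rest : List ℕ} (hk : 1 ≤ k) (hK : k + q = n + 1)
    (hs : (k :: q :: rest).sum = N + 1) (h : n ≤ N) {R : Mat p N}
    {A : Matrix (Fin (N - n)) (Fin (N - n)) ℚ_[p]} {B : Matrix (Fin (N - n)) (Fin (n + 1)) ℚ_[p]}
    {D : Mat p n} (hRU : R ∈ U p N) (hR : toB h R = Matrix.fromBlocks A B 0 D)
    {y : (ℕ × ℕ → ℕ) × (ℕ × ℕ → ℤ)} {L2 R2 : Mat p n}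
    (hb2 : HasBruhat n [k, q] (family p y.1 y.2) L2 R2) {Ra : Mat p N}
    (hRa : toB h Ra = Matrix.fromBlocks A
      (B * (D⁻¹ * R2 * (bMap n [k, q] (family p y.1 y.2))⁻¹)) 0 1) :
    Param N (k :: q :: rest) R y ↔ (∀ x ∉ indexSet (k :: q :: rest), y.1 x = 0) ∧
      (∀ x ∉ indexSet (k :: q :: rest), y.2 x = 0) ∧
      Param n [k, q] D ((indexSet [k, q]).indicator y.1, (indexSet [k, q]).indicator y.2) ∧
      Param N ((k + q) :: rest) Ra ((indexSet ((k + q) :: rest)).indicator y.1,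
        (indexSet ((k + q) :: rest)).indicator y.2) := by
  have hs' : ((k + q) :: rest).sum = N + 1 := by simp at hs ⊢; omega
  have hv : [k, q].sum = n + 1 := by simp; omega
  obtain ⟨L1, R1, hb1⟩ := exists_hasBruhat rest (k + q) (by omega) hs' (family p y.1 y.2)
  obtain ⟨LL, RR, hbb⟩ := exists_hasBruhat (q :: rest) k hk hs (family p y.1 y.2)
  obtain ⟨A', B', D', e⟩ := exists_toB_of_mem_U h hb1.2.1.1
  obtain ⟨-, -, rfl⟩ := (mem_Uw_merged_iff hK hs' h e).1 hb1.2.1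
  have eRR := (hb1.merge hK hs h hb2 hbb).2.1 A' B' e
  obtain ⟨hA, hD⟩ := (mem_U_of_toB h hR).1 hRU
  have key := inv_mul_mem_Integral_merge_iff h (isUnit_det_of_unipotent hA)
    (isUnit_det_of_mem_U hD) (isIntUnit_bMap hv _) hR eRR hRa e
  have c1 := hb1.congr (by omega) hs'
    (fun x hx => (family_indicator (I := indexSet ((k + q) :: rest)) y.1 y.2 hx).symm)
  have c2 := hb2.congr hk hv
    (fun x hx => (family_indicator (I := indexSet [k, q]) y.1 y.2 hx).symm)
  have sw : ∀ L' R', HasBruhat N (k :: q :: rest) (family p y.1 y.2) L' R' → R' = RR :=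
    fun L' R' hb => (hb.unique hs hbb).2
  have i0 : ∀ {α : Type} [Zero α] (bs : List ℕ) (f : ℕ × ℕ → α), ∀ x ∉ indexSet bs,
    (indexSet bs).indicator f x = 0 := fun bs f x hx => Set.indicator_of_notMem hx f
  rw [Param, mem_CSet_merge_iff]
  constructor
  · rintro ⟨h1, ⟨h2, h3, h4⟩, L', R', hb, h5⟩
    rw [sw L' R' hb, key] at h5
    exact ⟨h1, h2, ⟨i0 _ _, h4, L2, R2, c2, h5.1⟩, ⟨i0 _ _, h3, L1, R1, c1, h5.2⟩⟩
  · rintro ⟨h1, h2, ⟨-, h4, L', R', hb, h5⟩, ⟨-, h3, L'', R'', hb', h6⟩⟩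
    refine ⟨h1, ⟨h2, h3, h4⟩, LL, RR, hbb, key.2 ⟨?_, ?_⟩⟩
    · rwa [(hb.unique hv c2).2] at h5
    · rwa [(hb'.unique hs' c1).2] at h6

/-- The block D alone determines the I_v-part of the parameters. This fixes the target for the
merged list, where induction gives the rest. -/
theorem existsUnique_param : ∀ (rest : List ℕ) {K N : ℕ}, 1 ≤ K → (K :: rest).sum = N + 1 →
    ∀ {R : Mat p N}, R ∈ Uw p N (K :: rest) → ∃! y, Param N (K :: rest) R y
  | [], K, N, hK, hs, R, hR => by
      obtain rfl : K = N + 1 := by simpa using hs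
      have hone : ∀ R' ∈ Uw p N [N + 1], R' = 1 := by
        intro R' hR'
        rw [mem_Uw_iff hs] at hR'
        ext i j
        rcases lt_trichotomy i j with hij | rfl | hij
        · rw [Matrix.one_apply_ne hij.ne]
          refine hR'.2 i j hij ?_
          simpa [wcol] using hij
        · rw [hR'.1.1, Matrix.one_apply_eq]
        · rw [hR'.1.2 _ _ hij, Matrix.one_apply_ne hij.ne']
      obtain ⟨L', R', hb⟩ := exists_hasBruhat [] (N + 1) hK hs (family p 0 0)
      refine ⟨(0, 0), ⟨fun _ _ => rfl, ⟨fun _ _ => rfl, fun l hl => ?_⟩, L', R', hb, ?_⟩, ?_⟩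
      · simp at hl
      · rw [hone R hR, hone R' hb.2.1]; simpa using one_mem_Integral
      · rintro ⟨m, c⟩ ⟨h1, h2, -⟩
        have hn : ∀ x, x ∉ indexSet [N + 1] := by rw [indexSet_singleton]; exact Set.notMem_empty
        exact Prod.ext (funext fun x => h1 x (hn x)) (funext fun x => h2.1 x (hn x))
  | q :: rest, K, N, hK, hs, R, hR => by
      have hs' : ((K + q) :: rest).sum = N + 1 := by simp at hs ⊢; omega
      have hn : K + q = (K + q - 1) + 1 := by omega
      have hv : [K, q].sum = K + q - 1 + 1 := by simp; omega
      have h : K + q - 1 ≤ N := by simp at hs; omega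
      obtain ⟨A, B, D, e⟩ := exists_toB_of_mem_U h hR.1
      obtain ⟨hA, hT, hD⟩ := (mem_Uw_split_iff hn hs h e).1 hR
      obtain ⟨y2, hy2, hu2⟩ := existsUnique_param_pair hn hD
      obtain ⟨L2, R2, hb2⟩ := hasBruhat_pair hn (family p y2.1 y2.2)
      obtain ⟨Ra, hRa⟩ := toB_surjective h (Matrix.fromBlocks A
        (B * (D⁻¹ * R2 * (bMap (K + q - 1) [K, q] (family p y2.1 y2.2))⁻¹)) 0 1)
      obtain ⟨y1, hy1, hu1⟩ := existsUnique_param rest (by omega) hs'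
        ((mem_Uw_merged_iff hn hs' h hRa).2 ⟨hA, hT, rfl⟩)
      have hdis := Set.disjoint_left.1 (disjoint_indexSet K q rest)
      have key : ∀ y : (ℕ × ℕ → ℕ) × (ℕ × ℕ → ℤ), (indexSet [K, q]).indicator y.1 = y2.1 →
          (indexSet [K, q]).indicator y.2 = y2.2 → (Param N (K :: q :: rest) R y ↔
          (∀ x ∉ indexSet (K :: q :: rest), y.1 x = 0) ∧
          (∀ x ∉ indexSet (K :: q :: rest), y.2 x = 0) ∧
          Param (K + q - 1) [K, q] D
            ((indexSet [K, q]).indicator y.1, (indexSet [K, q]).indicator y.2) ∧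
          Param N ((K + q) :: rest) Ra ((indexSet ((K + q) :: rest)).indicator y.1,
            (indexSet ((K + q) :: rest)).indicator y.2)) := by
        intro y e1 e2
        have hf : ∀ x ∈ indexSet [K, q], family p y2.1 y2.2 x = family p y.1 y.2 x := by
          rw [← e1, ← e2]; exact fun x hx => family_indicator _ _ hx
        rw [bMap_pair_congr hn hf] at hRa
        exact param_merge_iff hK hn hs h hR.1 e (hb2.congr hK hv hf) hRa
      have glue2 : ∀ {α : Type} [AddZeroClass α] (f g : ℕ × ℕ → α),
          (∀ x ∉ indexSet ((K + q) :: rest), f x = 0) → (∀ x ∉ indexSet [K, q], g x = 0) →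
          (indexSet [K, q]).indicator (f + g) = g ∧
          (indexSet ((K + q) :: rest)).indicator (f + g) = f := by
        intro α _ f g hf hg
        constructor
        · funext x
          by_cases hx : x ∈ indexSet [K, q]
          · rw [Set.indicator_of_mem hx, Pi.add_apply, hf x fun h => hdis h hx, zero_add]
          · rw [Set.indicator_of_notMem hx, hg x hx]
        · funext x
          by_cases hx : x ∈ indexSet ((K + q) :: rest)
          · rw [Set.indicator_of_mem hx, Pi.add_apply, hg x (hdis hx), add_zero]
          · rw [Set.indicator_of_notMem hx, hf x hx]
      have g1 := glue2 y1.1 y2.1 hy1.1 hy2.1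
      have g2 := glue2 y1.2 y2.2 hy1.2.1.1 hy2.2.1.1
      -- The supports are disjoint, so adding the families glues them.
      refine ⟨(y1.1 + y2.1, y1.2 + y2.2), ?_, ?_⟩
      · refine (key _ g1.1 g2.1).2 ⟨fun x hx => ?_, fun x hx => ?_, ?_, ?_⟩
        · rw [indexSet_merge, Set.mem_union, not_or] at hx
          simp only [Pi.add_apply]; rw [hy1.1 x hx.1, hy2.1 x hx.2]
        · rw [indexSet_merge, Set.mem_union, not_or] at hx
          simp only [Pi.add_apply]; rw [hy1.2.1.1 x hx.1, hy2.2.1.1 x hx.2]; rfl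
        · simp only [g1.1, g2.1]; exact hy2
        · simp only [g1.2, g2.2]; exact hy1
      · intro y hy
        -- A competing y first has to be tested against its own target `Ra'`. Once its I_v-part is
        -- known to be `y2`, the fixed target `Ra` may be used.
        obtain ⟨L2', R2', hb2'⟩ := hasBruhat_pair hn (family p y.1 y.2)
        obtain ⟨Ra', hRa'⟩ := toB_surjective h (Matrix.fromBlocks A
          (B * (D⁻¹ * R2' * (bMap (K + q - 1) [K, q] (family p y.1 y.2))⁻¹)) 0 1)
        have hp := (param_merge_iff hK hn hs h hR.1 e hb2' hRa').1 hy
        have h2 := hu2 _ hp.2.2.1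
        have hp' := (key y (congrArg Prod.fst h2) (congrArg Prod.snd h2)).1 hy
        have h1 := hu1 _ hp'.2.2.2
        have fin : ∀ {α : Type} [AddZeroClass α] (f f1 f2 : ℕ × ℕ → α),
            (∀ x ∉ indexSet (K :: q :: rest), f x = 0) → (indexSet [K, q]).indicator f = f2 →
            (indexSet ((K + q) :: rest)).indicator f = f1 → f = f1 + f2 := by
          rintro α _ f f1 f2 h0 rfl rfl
          funext x
          rw [Pi.add_apply]
          by_cases hx : x ∈ indexSet ((K + q) :: rest)
          · rw [Set.indicator_of_mem hx, Set.indicator_of_notMem (hdis hx), add_zero]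
          · rw [Set.indicator_of_notMem hx, zero_add]
            by_cases hx' : x ∈ indexSet [K, q]
            · rw [Set.indicator_of_mem hx']
            · rw [Set.indicator_of_notMem hx']
              apply h0; rw [indexSet_merge, Set.mem_union, not_or]; exact ⟨hx, hx'⟩
        exact Prod.ext (fin _ _ _ hp.1 (congrArg Prod.fst h2) (congrArg Prod.fst h1))
          (fin _ _ _ hp.2.1 (congrArg Prod.snd h2) (congrArg Prod.snd h1))

end Param

/-! ### The right action of integral unipotent matrices -/

section Action

variable {p : ℕ} [Fact p.Prime] {N n : ℕ}

/-- An integral translation leaves μ and ε unchanged and sends c to c + p^μ z. The compensating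
unipotent factor on the left is again integral, because d is. -/
theorem bTwo_mul_unipotent (a z : ℚ_[p]) (hz : ‖z‖ ≤ 1) :
    bTwo a * !![1, z; 0, 1] = !![1, z * dPart a * dPart (a + z); 0, 1] * bTwo (a + z) := by
  have hm := mu_add (a := a) hz
  have hc : cPart (a + z) = cPart a + (p : ℚ_[p]) ^ mu a * z := by
    rw [cPart_eq, cPart_eq, hm]; ring
  have he : epsPart (a + z) = epsPart a := by rw [epsPart, epsPart, hm]
  have h1 := dPart_mul_cPart a
  have h2 := dPart_mul_cPart (a + z)
  have h3 : dPart a * epsPart a = 0 := by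
    rw [dPart, epsPart]; split_ifs <;> simp
  have h4 : dPart (a + z) * epsPart a = 0 := by
    rw [dPart, epsPart, hm]; split_ifs <;> simp
  rw [he, hc] at h2
  rw [bTwo, bTwo, Matrix.mul_fin_two, Matrix.mul_fin_two, he, hm, hc]
  congr 1
  simp only [Matrix.vecCons_inj, and_true]
  refine ⟨⟨?_, ?_⟩, ?_, ?_⟩
  · linear_combination h4 - h3 + dPart (a + z) * h1 - dPart a * h2
  · linear_combination -z * h3 - z * dPart a * h2
  · ring
  · ring

theorem bSimple_mul_unipotent {i : ℕ} (h1 : 1 ≤ i) (h2 : i ≤ N) (a : ℚ_[p]) {u : Mat p N}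
    (hu : u ∈ U p N ∩ Integral p N) : ∃ u' ∈ U p N ∩ Integral p N, ∃ a', ‖a' - a‖ ≤ 1 ∧
      bSimple N i a * u = u' * bSimple N i a' := by
  set z := u ⟨i - 1, by omega⟩ ⟨i, by omega⟩ with hz
  have hz1 : ‖z‖ ≤ 1 := hu.2 _ _
  have hinv : phi N i (bTwoInv (a + z)) = (bSimple N i (a + z))⁻¹ := by
    rw [Matrix.inv_eq_right_inv]
    rw [bSimple_eq, phi_mul_phi h1 h2, bTwo_mul_inv, phi_one]
  have hB := isIntUnit_bSimple h1 h2 (a + z)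
  have hU := (phi_mul_mul_phi_mem_U h1 h2 (A := bTwo a) (B := bTwoInv (a + z)) hu.1 (by
    rw [← hz, bTwo_mul_unipotent a z hz1, Matrix.mul_assoc, bTwo_mul_inv, Matrix.mul_one])).1
  rw [hinv, ← bSimple_eq] at hU
  refine ⟨_, ⟨hU, mul_mem_Integral (mul_mem_Integral (isIntUnit_bSimple h1 h2 a).integral hu.2)
    hB.inv_integral⟩, a + z, by simpa using hz1, ?_⟩
  rw [Matrix.mul_assoc _ _ (bSimple N i (a + z)), hB.inv_mul, Matrix.mul_one]

theorem rowMat_mul_unipotent (q i : ℕ) (a : ℕ → ℚ_[p]) (h1 : 1 ≤ i) (h2 : i + q ≤ N + 1)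
    {u : Mat p N} (hu : u ∈ U p N ∩ Integral p N) : ∃ u' ∈ U p N ∩ Integral p N, ∃ a',
      (∀ x, ‖a' x - a x‖ ≤ 1) ∧ rowMat N i q a * u = u' * rowMat N i q a' := by
  induction q generalizing i a with
  | zero => exact ⟨u, hu, a, by simp, by simp [rowMat]⟩
  | succ q ih =>
    obtain ⟨u1, hu1, a1, ha1, e1⟩ := ih (i + 1) (fun u => a (u + 1)) (by omega) (by omega)
    obtain ⟨u2, hu2, a0, ha0, e2⟩ := bSimple_mul_unipotent h1 (by omega) (a 0) hu1
    refine ⟨u2, hu2, fun x => Nat.casesOn x a0 a1, ?_, ?_⟩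
    · rintro (_ | x)
      · exact ha0
      · exact ha1 x
    · rw [rowMat, Matrix.mul_assoc, e1, ← Matrix.mul_assoc, e2, Matrix.mul_assoc]
      rfl

theorem grassMat_mul_unipotent (q k : ℕ) (A : ℕ → ℕ → ℚ_[p]) (h : k + q ≤ N + 1)
    {u : Mat p N} (hu : u ∈ U p N ∩ Integral p N) : ∃ u' ∈ U p N ∩ Integral p N, ∃ A',
      (∀ i x, ‖A' i x - A i x‖ ≤ 1) ∧ grassMat N q A k * u = u' * grassMat N q A' k := by
  induction k with
  | zero => exact ⟨u, hu, A, by simp, by simp [grassMat]⟩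
  | succ k ih =>
    obtain ⟨u1, hu1, A1, hA1, e1⟩ := ih (by omega)
    obtain ⟨u2, hu2, a, ha, e2⟩ := rowMat_mul_unipotent q (k + 1) (A k) (by omega) (by omega) hu1
    refine ⟨u2, hu2, Function.update A1 k a, fun i x => ?_, ?_⟩
    · by_cases hi : i = k
      · rw [hi, Function.update_self]; exact ha x
      · rw [Function.update_of_ne hi]; exact hA1 i x
    · rw [grassMat, Matrix.mul_assoc, e1, ← Matrix.mul_assoc, e2, Matrix.mul_assoc, grassMat,
        Function.update_self]
      congr 2
      apply grassMat_congr
      intro i hi x _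
      rw [Function.update_of_ne (by omega)]

theorem bMap_pair_mul_unipotent {k q : ℕ} (hK : k + q = n + 1) (a : ℕ × ℕ → ℚ_[p]) {u : Mat p n}
    (hu : u ∈ U p n ∩ Integral p n) : ∃ u' ∈ U p n ∩ Integral p n, ∃ a',
      (∀ x, ‖a' x - a x‖ ≤ 1) ∧ bMap n [k, q] a * u = u' * bMap n [k, q] a' := by
  obtain ⟨u', hu', A', hA', e⟩ := grassMat_mul_unipotent q k (fun i u => a (i + 1, k + u))
    (by omega) hu
  refine ⟨u', hu', fun x => a x + (A' (x.1 - 1) (x.2 - k) - a (x.1 - 1 + 1, k + (x.2 - k))),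
    fun x => ?_, ?_⟩
  · simpa using hA' (x.1 - 1) (x.2 - k)
  · rw [bMap_pair _ _ _ hK, e, bMap_pair _ _ _ hK]
    simp

/-- An integral unipotent matrix can be passed through b from right to left at the cost of integral
changes of the parameters, so μ is preserved entrywise. -/
theorem bMap_mul_unipotent : ∀ (rest : List ℕ) {K N : ℕ}, 1 ≤ K → (K :: rest).sum = N + 1 →
    ∀ (a : ℕ × ℕ → ℚ_[p]) {u : Mat p N}, u ∈ U p N ∩ Integral p N →
    ∃ u' ∈ U p N ∩ Integral p N, ∃ a', (∀ x, ‖a' x - a x‖ ≤ 1) ∧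
      bMap N (K :: rest) a * u = u' * bMap N (K :: rest) a'
  | [], K, N, _, _, a, u, hu => ⟨u, hu, a, by simp, by simp [bMap_singleton]⟩
  | q :: rest, K, N, hK, hs, a, u, hu => by
      have hs' : ((K + q) :: rest).sum = N + 1 := by simp at hs ⊢; omega
      have hn : K + q = (K + q - 1) + 1 := by omega
      have hv : [K, q].sum = K + q - 1 + 1 := by simp; omega
      have h : K + q - 1 ≤ N := by simp at hs; omega
      obtain ⟨A, B, D, e⟩ := exists_toB_of_mem_U h hu.1
      obtain ⟨hA, hD⟩ := (mem_U_of_toB h e).1 hu.1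
      obtain ⟨iA, iB, iD⟩ := (mem_Integral_iff_blocks h e).1 hu.2
      obtain ⟨D', hD', a2, ha2, e2⟩ := bMap_pair_mul_unipotent hn a ⟨hD, iD⟩
      have hg := isIntUnit_bMap (p := p) hv a2
      -- The matrix left over after passing I ⊕ b_v; its upper right block stays integral because
      -- b_v lies in GL(ℤ_p).
      obtain ⟨u1, hu1⟩ := toB_surjective h
        (Matrix.fromBlocks A (B * (bMap (K + q - 1) [K, q] a2)⁻¹) 0 D')
      have hu1' : u1 ∈ U p N ∩ Integral p N := ⟨(mem_U_of_toB h hu1).2 ⟨hA, hD'.1⟩,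
        (mem_Integral_iff_blocks h hu1).2 ⟨iA, iB.mul hg.inv_integral, hD'.2⟩⟩
      have e3 : idSum N (bMap (K + q - 1) [K, q] a) * u =
          u1 * idSum N (bMap (K + q - 1) [K, q] a2) := by
        apply toB_injective h
        rw [toB_mul, toB_mul, toB_idSum, toB_idSum, hu1, e, Matrix.fromBlocks_multiply,
          Matrix.fromBlocks_multiply, e2]
        simp [Matrix.mul_assoc, hg.inv_mul]
      obtain ⟨u2, hu2, a1, ha1, e4⟩ := bMap_mul_unipotent rest (by omega) hs' a hu1'
      classical
      have hdis := Set.disjoint_left.1 (disjoint_indexSet K q rest)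
      -- The two factors read disjoint parts of the family, so the changed parameters can be glued.
      refine ⟨u2, hu2, fun x => if x ∈ indexSet [K, q] then a2 x else a1 x, fun x => ?_, ?_⟩
      · simp only
        split_ifs
        · exact ha2 x
        · exact ha1 x
      · rw [bMap_merge _ K q rest hn hs, bMap_merge _ K q rest hn hs, Matrix.mul_assoc, e3,
          ← Matrix.mul_assoc, e4, Matrix.mul_assoc]
        congr 2
        · exact bMap_congr rest (K + q) (by omega) hs'
            (fun x hx => (if_neg (fun hx' => hdis hx hx')).symm)
        · rw [bMap_pair_congr hn (a := a2)]
          exact fun x hx => (if_pos hx).symm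

end Action

/-! ### Elements with congruent right factors -/

section Representatives

variable {p : ℕ} [Fact p.Prime] {N : ℕ}

theorem torus_of_norm_eq {E E' : ℕ → ℤ} (h0 : E 0 = E' 0)
    (h : ∀ i : Fin (N + 1), ‖torus p N E i‖ = ‖torus p N E' i‖) :
    ∀ l ≤ N + 1, E l = E' l := by
  intro l
  induction l with
  | zero => intro _; exact h0
  | succ l ih =>
    intro hl
    have h1 := h ⟨l, by omega⟩
    rw [torus, torus, Padic.norm_p_zpow, Padic.norm_p_zpow] at h1
    have := zpow_right_injective₀ (by linarith [one_lt_p_real (p := p)] : (0 : ℝ) < p)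
      (ne_of_gt one_lt_p_real) h1
    have := ih (by omega)
    simp only at *
    omega

/-- Two elements of `GL(ℤ_p)` with right factors congruent modulo `U_w(ℤ_p)` differ by
integral unipotent matrices, and have the same torus part. -/
theorem sameOrbit_of_right {bs : List ℕ} (hs : bs.sum = N + 1) {g g' L L' R R' : Mat p N}
    {E E' : ℕ → ℤ} (h0 : E 0 = E' 0) (hg : IsIntUnit g) (hg' : IsIntUnit g')
    (hL : L ∈ U p N) (hL' : L' ∈ U p N) (hR : R ∈ Uw p N bs) (hR' : R' ∈ Uw p N bs)
    (e : g = L * (Matrix.diagonal (torus p N E) * weyl p N bs) * R)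
    (e' : g' = L' * (Matrix.diagonal (torus p N E') * weyl p N bs) * R')
    (hi : R⁻¹ * R' ∈ Integral p N) :
    (∀ l ≤ N + 1, E l = E' l) ∧ ∃ v ∈ U p N ∩ Integral p N, ∃ u ∈ Uw p N bs ∩ Integral p N,
      g' = v * g * u := by
  have hw := isUnit_det_weyl (p := p) hs
  have hu : R⁻¹ * R' ∈ Uw p N bs := mul_mem_Uw hw (inv_mem_Uw hw hR) hR'
  have hRu : R' = R * (R⁻¹ * R') := by
    rw [← Matrix.mul_assoc, mul_inv_cancel_of_mem_U hR.1, Matrix.one_mul]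
  set u := R⁻¹ * R' with hudef
  have hgu : IsIntUnit (g * u) := hg.mul (IsIntUnit.of_mem_U hu.1 hi)
  have hβ : IsIntUnit (g' * (g * u)⁻¹) := hg'.mul hgu.inv
  have hD' : IsUnit (Matrix.diagonal (torus p N E')).det := isUnit_det_diagonal (torus_ne_zero _)
  set δ : Fin (N + 1) → ℚ_[p] := fun i => torus p N E' i * (torus p N E i)⁻¹ with hδ
  have hδD : Matrix.diagonal δ * Matrix.diagonal (torus p N E) =
      Matrix.diagonal (torus p N E') := by
    rw [Matrix.diagonal_mul_diagonal]
    congr 1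
    funext i
    rw [hδ]
    simp only
    rw [inv_mul_cancel_right₀ (torus_ne_zero _ _)]
  -- After the right factors are matched by u they cancel, and an upper triangular element of
  -- GL(ℤ_p) with diagonal δ remains.
  have hβe : g' * (g * u)⁻¹ = L' * Matrix.diagonal δ * L⁻¹ := by
    have : g' = (L' * Matrix.diagonal δ * L⁻¹) * (g * u) := by
      calc g' = L' * (Matrix.diagonal δ * Matrix.diagonal (torus p N E) * weyl p N bs) * R' := by
            rw [hδD, e']
        _ = L' * Matrix.diagonal δ * (L⁻¹ * L) *
              (Matrix.diagonal (torus p N E) * weyl p N bs) * R * u := by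
            rw [inv_mul_cancel_of_mem_U hL, Matrix.mul_one, Matrix.mul_assoc _ R u, ← hRu]
            simp only [Matrix.mul_assoc]
        _ = _ := by rw [e]; simp only [Matrix.mul_assoc]
    rw [this, Matrix.mul_assoc, hgu.mul_inv, Matrix.mul_one]
  have hupd : ∀ i j, j < i → (L' * Matrix.diagonal δ) i j = 0 := by
    intro i j hij
    rw [Matrix.mul_diagonal, hL'.2 i j hij, zero_mul]
  have hLi := inv_mem_U hL
  have hup : ∀ i j, j < i → (g' * (g * u)⁻¹) i j = 0 := by
    intro i j hij
    rw [hβe]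
    exact mul_apply_of_lt hupd hLi.2 hij
  have hdiag : ∀ i, (g' * (g * u)⁻¹) i i = δ i := by
    intro i
    rw [hβe, mul_apply_diag hupd hLi.2, Matrix.mul_diagonal, hL'.1, hLi.1, one_mul, mul_one]
  -- The diagonal entries δ are units, but also powers of p, so they equal 1.
  have hnorm : ∀ i, ‖torus p N E i‖ = ‖torus p N E' i‖ := by
    intro i
    have h1 := hβ.of_upper hup i
    rw [hdiag, hδ] at h1
    simp only at h1
    rw [norm_mul, norm_inv, ← div_eq_mul_inv,
      div_eq_one_iff_eq (norm_ne_zero_iff.2 (torus_ne_zero _ _))] at h1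
    exact h1.symm
  have hE := torus_of_norm_eq h0 hnorm
  have hone : ∀ i, δ i = 1 := by
    intro i
    rw [hδ]
    simp only [torus]
    rw [hE i (by omega), hE (i + 1) (by omega)]
    exact mul_inv_cancel₀ (zpow_ne_zero _ p_ne_zero)
  refine ⟨hE, g' * (g * u)⁻¹, ⟨⟨fun i => by rw [hdiag, hone], hup⟩, hβ.integral⟩, u, ⟨hu, hi⟩, ?_⟩
  rw [Matrix.mul_assoc, Matrix.mul_assoc, hgu.inv_mul, Matrix.mul_one]

end Representatives

/-! ### Systems of representatives -/

section Orbits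

variable {p : ℕ} [Fact p.Prime] {N : ℕ}

theorem SameOrbit.symm {bs : List ℕ} (hs : bs.sum = N + 1) {g h : Mat p N}
    (hgh : SameOrbit bs g h) : SameOrbit bs h g := by
  obtain ⟨v, hv, u, hu, rfl⟩ := hgh
  refine ⟨v⁻¹, ⟨inv_mem_U hv.1, (IsIntUnit.of_mem_U hv.1 hv.2).inv_integral⟩, u⁻¹,
    ⟨inv_mem_Uw (isUnit_det_weyl hs) hu.1, (IsIntUnit.of_mem_U hu.1.1 hu.2).inv_integral⟩, ?_⟩
  calc g = (v⁻¹ * v) * g * (u * u⁻¹) := by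
        rw [inv_mul_cancel_of_mem_U hv.1, mul_inv_cancel_of_mem_U hu.1.1, Matrix.one_mul,
          Matrix.mul_one]
    _ = _ := by simp only [Matrix.mul_assoc]

theorem inv_mul_mem_Integral_of_sameOrbit {bs : List ℕ} (hs : bs.sum = N + 1)
    {g g' L L' R R' : Mat p N} {t t' : Fin (N + 1) → ℚ_[p]} (ht : ∀ i, t i ≠ 0)
    (hL : L ∈ U p N) (hL' : L' ∈ U p N) (hR : R ∈ Uw p N bs) (hR' : R' ∈ Uw p N bs)
    (e : g = L * (Matrix.diagonal t * weyl p N bs) * R)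
    (e' : g' = L' * (Matrix.diagonal t' * weyl p N bs) * R') (h : SameOrbit bs g' g) :
    R⁻¹ * R' ∈ Integral p N := by
  have hw := isUnit_det_weyl (p := p) hs
  obtain ⟨v, hv, u, hu, hg⟩ := h
  rw [e, e'] at hg
  have hg' : L * (Matrix.diagonal t * weyl p N bs) * R =
      (v * L') * (Matrix.diagonal t' * weyl p N bs) * (R' * u) := by
    rw [hg]; simp only [Matrix.mul_assoc]
  obtain ⟨-, -, rfl⟩ := bruhat_unique hw hL (mul_mem_U hv.1 hL') hR (mul_mem_Uw hw hR' hu.1) ht hg'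
  rw [Matrix.mul_inv_rev, Matrix.mul_assoc, inv_mul_cancel_of_mem_U hR'.1, Matrix.mul_one]
  exact (IsIntUnit.of_mem_U hu.1.1 hu.2).inv_integral

theorem mu_family {bs : List ℕ} {m : ℕ × ℕ → ℕ} {c : ℕ × ℕ → ℤ} (hc : c ∈ CSet p bs m)
    {x : ℕ × ℕ} (hx : x ∈ indexSet bs) : mu (family p m c x) = m x := by
  obtain ⟨l, hl, hx⟩ := mem_indexSet.1 hx
  exact mu_of_isCoprime (hc.2 l hl x hx).2.2

theorem family_mem_YSet {bs : List ℕ} {m : ℕ × ℕ → ℕ} {c : ℕ × ℕ → ℤ} (hc : c ∈ CSet p bs m) :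
    family p m c ∈ YSet p bs m := by
  refine ⟨fun x hx => ?_, fun x hx => mu_family hc hx⟩
  rw [family, hc.1 x hx, Int.cast_zero, zero_mul]

theorem param_of_sameOrbit {K : ℕ} {rest : List ℕ} (hK : 1 ≤ K) (hs : (K :: rest).sum = N + 1)
    {g L R : Mat p N} {t : Fin (N + 1) → ℚ_[p]} (ht : ∀ i, t i ≠ 0) (hL : L ∈ U p N)
    (hR : R ∈ Uw p N (K :: rest)) (e : g = L * (Matrix.diagonal t * weyl p N (K :: rest)) * R)
    {y : (ℕ × ℕ → ℕ) × (ℕ × ℕ → ℤ)} (hm : ∀ x ∉ indexSet (K :: rest), y.1 x = 0)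
    (hc : y.2 ∈ CSet p (K :: rest) y.1)
    (h : SameOrbit (K :: rest) (bMap N (K :: rest) (family p y.1 y.2)) g) :
    Param N (K :: rest) R y := by
  obtain ⟨L', R', hb⟩ := exists_hasBruhat rest K hK hs (family p y.1 y.2)
  exact ⟨hm, hc, L', R', hb,
    inv_mul_mem_Integral_of_sameOrbit hs ht hL hb.1 hR hb.2.1 e hb.2.2 h⟩

/-- The parametrization of right factors supplies some pair (m', c'). The remaining point is m' = m,
which follows by moving the integral unipotent through b. -/
theorem existsUnique_representative {K : ℕ} {rest : List ℕ} (hK : 1 ≤ K)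
    (hs : (K :: rest).sum = N + 1) {m : ℕ × ℕ → ℕ} (hm : ∀ x ∉ indexSet (K :: rest), m x = 0)
    {a : ℕ × ℕ → ℚ_[p]} (ha : a ∈ YSet p (K :: rest) m) :
    ∃! c : ℕ × ℕ → ℤ, c ∈ CSet p (K :: rest) m ∧
      SameOrbit (K :: rest) (bMap N (K :: rest) (family p m c)) (bMap N (K :: rest) a) := by
  obtain ⟨L, R, hb⟩ := exists_hasBruhat rest K hK hs a
  obtain ⟨⟨m', c'⟩, ⟨h1, h2, L', R', hb', h3⟩, hu⟩ := existsUnique_param rest hK hs hb.2.1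
  simp only at h1 h2 hb'
  have h0 : expoSet N (K :: rest) a 0 = expoSet N (K :: rest) (family p m' c') 0 := by
    rw [expoSet_zero, expoSet_zero]
  obtain ⟨-, v, hv, u, hu', e⟩ := sameOrbit_of_right hs h0 (isIntUnit_bMap hs a)
    (isIntUnit_bMap hs (family p m' c')) hb.1 hb'.1 hb.2.1 hb'.2.1 hb.2.2 hb'.2.2 h3
  obtain ⟨u1, hu1, a', ha', e1⟩ := bMap_mul_unipotent rest hK hs a ⟨hu'.1.1, hu'.2⟩
  obtain ⟨L'', R'', hb''⟩ := exists_hasBruhat rest K hK hs a'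
  have e2 : L' * (Matrix.diagonal (torus p N (expoSet N (K :: rest) (family p m' c'))) *
      weyl p N (K :: rest)) * R' = (v * u1 * L'') *
      (Matrix.diagonal (torus p N (expoSet N (K :: rest) a')) * weyl p N (K :: rest)) * R'' := by
    rw [← hb'.2.2, e, Matrix.mul_assoc, e1, hb''.2.2]
    simp only [Matrix.mul_assoc]
  -- The family c'p^{-m'} and the translated family a' now have the same right factor and hence
  -- coincide on I_w; a' has the same μ as a.
  obtain ⟨-, -, rfl⟩ := bruhat_unique (isUnit_det_weyl hs) hb'.1
    (mul_mem_U (mul_mem_U hv.1 hu1.1) hb''.1) hb'.2.1 hb''.2.1 (torus_ne_zero _) e2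
  have hmm : m' = m := by
    funext x
    by_cases hx : x ∈ indexSet (K :: rest)
    · rw [← mu_family h2 hx, hb'.eq_of_right_eq rest hK hs hb'' x hx, ← ha.2 x hx,
        ← mu_add (a := a x) (ha' x), add_sub_cancel]
    · rw [h1 x hx, hm x hx]
  subst hmm
  refine ⟨c', ⟨h2, SameOrbit.symm hs ⟨v, hv, u, hu', e⟩⟩, ?_⟩
  rintro c ⟨hc1, hc2⟩
  have := hu (m', c) (param_of_sameOrbit hK hs (torus_ne_zero _) hb.1 hb.2.1 hb.2.2 h1 hc1 hc2)
  exact congrArg Prod.snd this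

theorem expoSet_eq_sum {K : ℕ} {rest : List ℕ} (hs : (K :: rest).sum = N + 1) {m : ℕ × ℕ → ℕ}
    (hm : ∀ x ∉ indexSet (K :: rest), m x = 0) {a : ℕ × ℕ → ℚ_[p]}
    (ha : ∀ x ∈ indexSet (K :: rest), mu (a x) = m x) (l : ℕ) (hl : l ≤ N) :
    expoSet N (K :: rest) a l =
      ((∑ i ∈ Finset.Icc 1 l, ∑ j ∈ Finset.Icc l N, m (i, j) : ℕ) : ℤ) := by
  classical
  rw [← Finset.sum_product', Nat.cast_sum, expoSet]
  refine (Finset.sum_congr rfl (g := fun x => ((m x : ℕ) : ℤ)) fun x hx => ?_).trans ?_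
  · rw [Finset.mem_filter] at hx
    rw [ha x hx.2.1]
  apply Finset.sum_subset
  · intro x hx
    simp only [Finset.mem_filter, Finset.mem_product, Finset.mem_range, Finset.mem_Icc] at hx ⊢
    have := bounds_of_mem_indexSet hx.2.1
    omega
  · intro x hx hx'
    simp only [Finset.mem_filter, Finset.mem_product, Finset.mem_range, Finset.mem_Icc] at hx hx'
    by_cases hI : x ∈ indexSet (K :: rest)
    · exact absurd ⟨⟨by omega, by omega⟩, hI, by omega, by omega⟩ hx'
    · rw [hm x hI]; rfl

/-- At l = 0 and l = N+1 both exponents vanish, so the comparison of tori amounts to the N equations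
that define ℳ_w(r). -/
theorem expo_eq_expoSet_iff {K : ℕ} {rest : List ℕ} (hs : (K :: rest).sum = N + 1)
    {m : ℕ × ℕ → ℕ} (hm : ∀ x ∉ indexSet (K :: rest), m x = 0) {a : ℕ × ℕ → ℚ_[p]}
    (ha : ∀ x ∈ indexSet (K :: rest), mu (a x) = m x) (r : ℕ → ℕ) :
    (∀ l ≤ N + 1, expo N r l = expoSet N (K :: rest) a l) ↔ m ∈ MSet N (K :: rest) r := by
  constructor
  · intro h
    refine ⟨hm, fun l h1 h2 => ?_⟩
    have := h l (by omega)
    rw [expo, if_pos ⟨h1, h2⟩, expoSet_eq_sum hs hm ha l h2] at this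
    exact_mod_cast this.symm
  · rintro ⟨-, h⟩ l hl
    rw [expo]
    split_ifs with h1
    · rw [expoSet_eq_sum hs hm ha l h1.2, h l h1.1 h1.2]
    · rcases Nat.eq_zero_or_pos l with rfl | h2
      · rw [expoSet_zero]
      · rw [expoSet_eq_zero _ (by omega)]

theorem modulus_eq (r : ℕ → ℕ) : modulus p N r = Matrix.diagonal (torus p N (expo N r)) := rfl

theorem torus_congr {E E' : ℕ → ℤ} (h : ∀ l ≤ N + 1, E l = E' l) : torus p N E = torus p N E' := by
  funext x
  rw [torus, torus, h x (by omega), h (x + 1) (by omega)]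

theorem bMap_family_mem_cell {K : ℕ} {rest : List ℕ} (hK : 1 ≤ K) (hs : (K :: rest).sum = N + 1)
    {r : ℕ → ℕ} {m : ℕ × ℕ → ℕ} {c : ℕ × ℕ → ℤ} (hm : m ∈ MSet N (K :: rest) r)
    (hc : c ∈ CSet p (K :: rest) m) :
    bMap N (K :: rest) (family p m c) ∈ cell p N (K :: rest) r := by
  obtain ⟨L, R, hb⟩ := exists_hasBruhat rest K hK hs (family p m c)
  refine ⟨⟨L, hb.1, R, hb.2.1.1, ?_⟩, mem_GLZp_iff.2 (isIntUnit_bMap hs _)⟩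
  rw [hb.2.2, modulus_eq, torus_congr
    ((expo_eq_expoSet_iff hs hm.1 (fun x => mu_family hc) r).2 hm)]

theorem existsUnique_representative_cell {K : ℕ} {rest : List ℕ} (hK : 1 ≤ K)
    (hs : (K :: rest).sum = N + 1) {r : ℕ → ℕ} {g : Mat p N} (hg : g ∈ cell p N (K :: rest) r) :
    ∃! y : (ℕ × ℕ → ℕ) × (ℕ × ℕ → ℤ), y.1 ∈ MSet N (K :: rest) r ∧ y.2 ∈ CSet p (K :: rest) y.1 ∧
      SameOrbit (K :: rest) (bMap N (K :: rest) (family p y.1 y.2)) g := by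
  obtain ⟨⟨u, hu, u', hu', e⟩, hG⟩ := hg
  rw [mem_GLZp_iff] at hG
  -- The cell allows any right factor in U; this normalizes it to U_w, so that the parametrization
  -- applies.
  obtain ⟨A, R, rfl, hA, hR, hA0⟩ := exists_factor_Uw hs hu'
  rw [modulus_eq] at e
  have ht := torus_ne_zero (p := p) (N := N) (expo N r)
  have hC := cell_conj_mem_U hs ht hA hA0
  have hCu := Matrix.nonsing_inv_mul _ (isUnit_det_cell hs ht)
  set C := Matrix.diagonal (torus p N (expo N r)) * weyl p N (K :: rest) with hCdef
  have e' : g = (u * (C * A * C⁻¹)) * C * R := by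
    calc g = u * (C * A * (C⁻¹ * C)) * R := by
          rw [e, hCu]; simp only [Matrix.mul_assoc, Matrix.one_mul]
      _ = _ := by simp only [Matrix.mul_assoc]
  have hL := mul_mem_U hu hC
  obtain ⟨y, ⟨h1, h2, L', R', hb', h3⟩, huy⟩ := existsUnique_param rest hK hs hR
  have h0 : expo N r 0 = expoSet N (K :: rest) (family p y.1 y.2) 0 := by
    rw [expoSet_zero]; simp [expo]
  obtain ⟨hE, v, hv, w, hw, eg⟩ := sameOrbit_of_right hs h0 hG (isIntUnit_bMap hs _) hL hb'.1 hR
    hb'.2.1 e' hb'.2.2 h3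
  refine ⟨y, ⟨(expo_eq_expoSet_iff hs h1 (fun x => mu_family h2) r).1 hE, h2,
    SameOrbit.symm hs ⟨v, hv, w, hw, eg⟩⟩, ?_⟩
  rintro y' ⟨hm, hc, ho⟩
  exact huy y' (param_of_sameOrbit hK hs ht hL hR e' hm.1 hc ho)

theorem bijOn_CSet (k q : ℕ) (rest : List ℕ) (m : ℕ × ℕ → ℕ) : Set.BijOn
      (fun c : ℕ × ℕ → ℤ =>
        ((indexSet ((k + q) :: rest)).indicator c, (indexSet [k, q]).indicator c))
      (CSet p (k :: q :: rest) m)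
      (CSet p ((k + q) :: rest) ((indexSet ((k + q) :: rest)).indicator m) ×ˢ
        CSet p [k, q] ((indexSet [k, q]).indicator m)) := by
  have hdis := Set.disjoint_left.1 (disjoint_indexSet k q rest)
  refine ⟨fun c hc => ((mem_CSet_merge_iff k q rest m c).1 hc).2, fun c hc c' hc' h => ?_, ?_⟩
  · rw [Prod.mk.injEq] at h
    funext x
    by_cases hx : x ∈ indexSet (k :: q :: rest)
    · rw [indexSet_merge] at hx
      rcases hx with hx | hx
      · have := congrFun h.1 x
        rwa [Set.indicator_of_mem hx, Set.indicator_of_mem hx] at this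
      · have := congrFun h.2 x
        rwa [Set.indicator_of_mem hx, Set.indicator_of_mem hx] at this
    · rw [hc.1 x hx, hc'.1 x hx]
  · rintro ⟨c1, c2⟩ ⟨h1, h2⟩
    simp only at h1 h2
    have e1 : (indexSet ((k + q) :: rest)).indicator (c1 + c2) = c1 := by
      funext x
      by_cases hx : x ∈ indexSet ((k + q) :: rest)
      · rw [Set.indicator_of_mem hx, Pi.add_apply, h2.1 x (hdis hx), add_zero]
      · rw [Set.indicator_of_notMem hx, h1.1 x hx]
    have e2 : (indexSet [k, q]).indicator (c1 + c2) = c2 := by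
      funext x
      by_cases hx : x ∈ indexSet [k, q]
      · rw [Set.indicator_of_mem hx, Pi.add_apply, h1.1 x (fun h => hdis h hx), zero_add]
      · rw [Set.indicator_of_notMem hx, h2.1 x hx]
    refine ⟨c1 + c2, (mem_CSet_merge_iff k q rest m _).2 ⟨fun x hx => ?_, ?_, ?_⟩, ?_⟩
    · rw [indexSet_merge, Set.mem_union, not_or] at hx
      rw [Pi.add_apply, h1.1 x hx.1, h2.1 x hx.2, add_zero]
    · rw [e1]; exact h1
    · rw [e2]; exact h2
    · exact Prod.ext e1 e2

end Orbits

/-! ### Entries of the Bruhat decomposition -/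

section Entries

variable {p : ℕ} [Fact p.Prime] {N n : ℕ}

theorem HasBruhat.isBruhat {bs : List ℕ} {a : ℕ × ℕ → ℚ_[p]} {L R : Mat p N}
    (h : HasBruhat N bs a L R) : IsBruhat bs (bMap N bs a) L
      (Matrix.diagonal (torus p N (expoSet N bs a)) * weyl p N bs) R :=
  ⟨h.1, ⟨_, torus_ne_zero _, rfl⟩, h.2.1, h.2.2⟩

theorem IsBruhat.hasBruhat {K : ℕ} {rest : List ℕ} (hK : 1 ≤ K) (hs : (K :: rest).sum = N + 1)
    {a : ℕ × ℕ → ℚ_[p]} {L C R : Mat p N} (h : IsBruhat (K :: rest) (bMap N (K :: rest) a) L C R) :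
    HasBruhat N (K :: rest) a L R ∧
      C = Matrix.diagonal (torus p N (expoSet N (K :: rest) a)) * weyl p N (K :: rest) := by
  obtain ⟨L', R', hb⟩ := exists_hasBruhat rest K hK hs a
  obtain ⟨hL, ⟨t, ht, rfl⟩, hR, e⟩ := h
  obtain ⟨rfl, rfl, rfl⟩ := bruhat_unique (isUnit_det_weyl hs) hL hb.1 hR hb.2.1 ht
    (e.symm.trans hb.2.2)
  exact ⟨hb, rfl⟩

/-- Only the summands with middle index i or i+1 survive, which makes superdiagonal entries
additive. -/
theorem mul_apply_succ {A B : Mat p N} (hA : A ∈ U p N) (hB : B ∈ U p N) {i j : Fin (N + 1)}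
    (hij : (j : ℕ) = i + 1) : (A * B) i j = A i j + B i j := by
  have hne : i ≠ j := by rintro rfl; omega
  rw [Matrix.mul_apply, Finset.sum_eq_add i j hne, hA.1, hB.1, one_mul, mul_one, add_comm]
  · rintro l - ⟨h1, h2⟩
    rcases lt_or_gt_of_ne h1 with h | h
    · rw [hA.2 i l h, zero_mul]
    · rw [hB.2 l j, mul_zero]
      rw [Fin.lt_def] at *
      have : (l : ℕ) ≠ j := fun e => h2 (Fin.ext e)
      omega
  · intro h; exact absurd (Finset.mem_univ _) h
  · intro h; exact absurd (Finset.mem_univ _) h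

theorem entry_eq (A : Mat p N) {i j : ℕ} (x y : Fin (N + 1)) (hx : (x : ℕ) + 1 = i)
    (hy : (y : ℕ) + 1 = j) : entry A i j = A x y := by
  subst hx hy; exact entry_succ A x y

/-- For l ≤ n+1 the condition l ≤ j is automatic, and the first n+1 rows of I_{w'} are complete. -/
theorem expoSet_merged {rest : List ℕ} (hs : ((n + 1) :: rest).sum = N + 1)
    (a : ℕ × ℕ → ℚ_[p]) {l : ℕ} (hl : l ≤ n + 1) : expoSet N ((n + 1) :: rest) a l =
      ∑ i ∈ Finset.Icc 1 l, ∑ j ∈ Finset.Icc (n + 1) N, (mu (a (i, j)) : ℤ) := by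
  rw [← Finset.sum_product', expoSet]
  apply Finset.sum_congr _ fun _ _ => rfl
  ext x
  simp only [Finset.mem_filter, Finset.mem_product, Finset.mem_range, Finset.mem_Icc]
  constructor
  · rintro ⟨h1, h2, h3⟩
    have := bounds_of_mem_indexSet h2
    omega
  · rintro ⟨h1, h2⟩
    exact ⟨by omega, mem_indexSet_of_le rest (n + 1) h1.1 (by omega) h2.1 (by omega), by omega⟩

theorem wfin_merged_right {rest : List ℕ} (hs : ((n + 1) :: rest).sum = N + 1) (h : n ≤ N)
    (x : Fin (n + 1)) : (wfin hs (blockEquiv h (Sum.inr x)) : ℕ) = x := by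
  have hM : rest.sum = N - n := by simp at hs; omega
  simp only [wfin]
  rw [wcol_merged_right _ _ (by rw [blockEquiv_inr, hM]; omega), blockEquiv_inr, hM]
  omega

/-- The first n+1 entries of the torus part of C' are p^{-s_i} with s_i the sum of μ(a_{i,j}) over j
> n, so conjugation contributes p^{s_{i+1}-s_i}. The signs cancel because both columns lie in one
block. Here i counts from 0. -/
theorem conj_idSum_apply {rest : List ℕ} (hs : ((n + 1) :: rest).sum = N + 1) (h : n ≤ N)
    (a : ℕ × ℕ → ℚ_[p]) (L : Mat p n) {i : ℕ} {x y : Fin (N + 1)} {x' y' : Fin (n + 1)}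
    (hx : (x : ℕ) = i) (hy : (y : ℕ) = i + 1) (hi : (x' : ℕ) = i) (hi' : (y' : ℕ) = i + 1) :
    ((Matrix.diagonal (torus p N (expoSet N ((n + 1) :: rest) a)) * weyl p N ((n + 1) :: rest)) *
      idSum N L * (Matrix.diagonal (torus p N (expoSet N ((n + 1) :: rest) a)) *
        weyl p N ((n + 1) :: rest))⁻¹) x y = L x' y' *
      (p : ℚ_[p]) ^ (∑ j ∈ Finset.Icc (n + 1) N,
        ((mu (a (i + 2, j)) : ℤ) - (mu (a (i + 1, j)) : ℤ))) := by
  have hM : rest.sum = N - n := by simp at hs; omega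
  have hx' : x = wfin hs (blockEquiv h (Sum.inr x')) :=
    Fin.ext (by rw [wfin_merged_right, hx, hi])
  have hy' : y = wfin hs (blockEquiv h (Sum.inr y')) :=
    Fin.ext (by rw [wfin_merged_right, hy, hi'])
  rw [hx', hy', cell_conj_apply hs (torus_ne_zero _), ← hx', ← hy', idSum_apply_inr,
    wsgn_merged_right _ _ (by rw [blockEquiv_inr, hM]; omega),
    wsgn_merged_right _ _ (by rw [blockEquiv_inr, hM]; omega), torus, torus, hx, hy,
    expoSet_merged hs a (by omega), expoSet_merged hs a (by omega),
    expoSet_merged hs a (by omega), Finset.sum_Icc_succ_top (by omega) (b := i),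
    Finset.sum_Icc_succ_top (by omega) (b := i + 1), Finset.sum_Icc_succ_top (by omega) (b := i)]
  have h1 : (((-1 : ℤ) ^ rest.sum : ℤ) : ℚ_[p]) * (((-1 : ℤ) ^ rest.sum : ℤ) : ℚ_[p]) = 1 := by
    rw [← Int.cast_mul, ← mul_pow]; simp
  rw [Finset.sum_sub_distrib, ← zpow_neg]
  set S := ∑ i ∈ Finset.Icc 1 i, ∑ j ∈ Finset.Icc (n + 1) N, (mu (a (i, j)) : ℤ)
  set s1 := ∑ j ∈ Finset.Icc (n + 1) N, (mu (a (i + 1, j)) : ℤ)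
  set s2 := ∑ j ∈ Finset.Icc (n + 1) N, (mu (a (i + 1 + 1, j)) : ℤ)
  have h2 : (p : ℚ_[p]) ^ (s2 - s1) =
      (p : ℚ_[p]) ^ (S - (S + s1)) * (p : ℚ_[p]) ^ (-(S + s1 - (S + s1 + s2))) := by
    rw [← zpow_add₀ p_ne_zero]; congr 1; ring
  rw [h2]
  linear_combination (L x' y' * (p : ℚ_[p]) ^ (S - (S + s1)) *
    (p : ℚ_[p]) ^ (-(S + s1 - (S + s1 + s2)))) * h1

theorem conj_idSum_apply_of_le {rest : List ℕ} (hs : ((n + 1) :: rest).sum = N + 1)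
    {t : Fin (N + 1) → ℚ_[p]} (ht : ∀ i, t i ≠ 0) (L : Mat p n) {x y : Fin (N + 1)}
    (hxy : x ≠ y) (hy : n < (y : ℕ)) :
    ((Matrix.diagonal t * weyl p N ((n + 1) :: rest)) * idSum N L *
      (Matrix.diagonal t * weyl p N ((n + 1) :: rest))⁻¹) x y = 0 := by
  have hM : rest.sum = N - n := by simp at hs; omega
  obtain ⟨x, rfl⟩ := (wfin_bijective hs).2 x
  obtain ⟨y, rfl⟩ := (wfin_bijective hs).2 y
  have hy' : (y : ℕ) < N - n := by
    by_contra h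
    simp only [wfin] at hy
    rw [wcol_merged_right _ _ (by omega)] at hy
    omega
  rw [cell_conj_apply hs ht, idSum_apply_inl_right _ hy', if_neg (fun e => hxy (by rw [e]))]
  ring

theorem HasBruhat.toB_eq {rest : List ℕ} {K : ℕ} (hK : K = n + 1)
    (hs : (K :: rest).sum = N + 1) (h : n ≤ N) {a : ℕ × ℕ → ℚ_[p]} {L R : Mat p N}
    (hb : HasBruhat N (K :: rest) a L R) : ∃ A B, toB h R = Matrix.fromBlocks A B 0 1 := by
  obtain ⟨A, B, D, e⟩ := exists_toB_of_mem_U h hb.2.1.1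
  obtain ⟨-, -, rfl⟩ := (mem_Uw_merged_iff hK hs h e).1 hb.2.1
  exact ⟨A, B, e⟩

theorem HasBruhat.right_apply_inl {k q : ℕ} {rest : List ℕ} (hK : k + q = n + 1)
    (hs : (k :: q :: rest).sum = N + 1) (h : n ≤ N) {a : ℕ × ℕ → ℚ_[p]} {L' R' LL RR : Mat p N}
    {L R : Mat p n} (hb' : HasBruhat N ((k + q) :: rest) a L' R')
    (hb : HasBruhat n [k, q] a L R) (hbb : HasBruhat N (k :: q :: rest) a LL RR)
    {x y : Fin (N + 1)} (hx : (x : ℕ) < N - n) (hy : (y : ℕ) < N - n) : RR x y = R' x y := by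
  have hs' : ((k + q) :: rest).sum = N + 1 := by simp at hs ⊢; omega
  obtain ⟨A, B, e⟩ := hb'.toB_eq hK hs' h
  have e' := (hb'.merge hK hs h hb hbb).2.1 A B e
  rw [show x = blockEquiv h (Sum.inl ⟨x, hx⟩) from Fin.ext (by rw [blockEquiv_inl]),
    show y = blockEquiv h (Sum.inl ⟨y, hy⟩) from Fin.ext (by rw [blockEquiv_inl])]
  exact (congrFun₂ e' _ _).trans (congrFun₂ e (Sum.inl ⟨x, hx⟩) (Sum.inl ⟨y, hy⟩)).symm

theorem HasBruhat.right_apply_inr {k q : ℕ} {rest : List ℕ} (hk : 1 ≤ k) (hK : k + q = n + 1)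
    (hs : (k :: q :: rest).sum = N + 1) (h : n ≤ N) {a : ℕ × ℕ → ℚ_[p]} {LL RR : Mat p N}
    {L R : Mat p n} (hb : HasBruhat n [k, q] a L R) (hbb : HasBruhat N (k :: q :: rest) a LL RR)
    (x y : Fin (n + 1)) :
    RR (blockEquiv h (Sum.inr x)) (blockEquiv h (Sum.inr y)) = R x y := by
  have hs' : ((k + q) :: rest).sum = N + 1 := by simp at hs ⊢; omega
  obtain ⟨L', R', hb'⟩ := exists_hasBruhat rest (k + q) (by omega) hs' a
  obtain ⟨A, B, e⟩ := hb'.toB_eq hK hs' h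
  exact congrFun₂ ((hb'.merge hK hs h hb hbb).2.1 A B e) (Sum.inr x) (Sum.inr y)

theorem HasBruhat.right_apply_inl_inr {k q : ℕ} {rest : List ℕ} (hK : k + q = n + 1)
    (hs : (k :: q :: rest).sum = N + 1) (h : n ≤ N) {a : ℕ × ℕ → ℚ_[p]} {L' R' LL RR : Mat p N}
    {L R : Mat p n} (hb' : HasBruhat N ((k + q) :: rest) a L' R')
    (hb : HasBruhat n [k, q] a L R) (hbb : HasBruhat N (k :: q :: rest) a LL RR)
    {x : Fin (N + 1)} (hx : (x : ℕ) < N - n) (y : Fin (n + 1)) :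
    RR x (blockEquiv h (Sum.inr y)) =
      ∑ j, R' x (blockEquiv h (Sum.inr j)) * bMap n [k, q] a j y := by
  have hs' : ((k + q) :: rest).sum = N + 1 := by simp at hs ⊢; omega
  obtain ⟨A, B, e⟩ := hb'.toB_eq hK hs' h
  have e' := (hb'.merge hK hs h hb hbb).2.1 A B e
  rw [show x = blockEquiv h (Sum.inl ⟨x, hx⟩) from Fin.ext (by rw [blockEquiv_inl])]
  refine (congrFun₂ e' (Sum.inl ⟨x, hx⟩) (Sum.inr y)).trans ?_
  rw [Matrix.fromBlocks_apply₁₂, Matrix.mul_apply]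
  exact Finset.sum_congr rfl fun j _ =>
    congrArg (· * _) (congrFun₂ e (Sum.inl ⟨x, hx⟩) (Sum.inr j)).symm

/-- The last row above the top block, in the right factor for three or more blocks. -/
theorem HasBruhat.right_apply_third {f : ℕ} {rest : List ℕ} (hf : 1 ≤ f)
    (hs : ((n + 1) :: f :: rest).sum = N + 1) {a : ℕ × ℕ → ℚ_[p]} {L R : Mat p N}
    (hb : HasBruhat N ((n + 1) :: f :: rest) a L R) {x y : Fin (N + 1)} {j : ℕ} (hj : j ≤ n)
    (hx : (x : ℕ) + 1 = N - n) (hy : (y : ℕ) = N - n + j) :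
    R x y = a (j + 1, n + f) *
      (p : ℚ_[p]) ^ (-(∑ l ∈ Finset.range j, (mu (a (l + 1, n + f)) : ℤ))) := by
  have hnf : n + f ≤ N := by simp at hs; omega
  have hK : n + 1 + f = n + f + 1 := by omega
  obtain ⟨L2, R2, hb2⟩ := hasBruhat_pair hK a
  rw [show x = blockEquiv hnf (Sum.inr ⟨f - 1, by omega⟩) from
      Fin.ext (by rw [blockEquiv_inr]; simp only; omega),
    show y = blockEquiv hnf (Sum.inr ⟨f + j, by omega⟩) from
      Fin.ext (by rw [blockEquiv_inr]; simp only; omega),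
    HasBruhat.right_apply_inr (by omega) hK hs hnf hb2 hb,
    hb2.right_last hf hK (i := j) (by omega) _ _ (by simp only; omega) rfl]

theorem eq_cPart_mul (a : ℚ_[p]) : a = cPart a * (p : ℚ_[p]) ^ (-(mu a : ℤ)) := by
  rw [cPart_eq, zpow_neg, zpow_natCast, mul_assoc, mul_inv_cancel₀ (pow_ne_zero _ p_ne_zero),
    mul_one]

theorem sum_range_succ_eq_sum_Icc {α : Type*} [AddCommMonoid α] (F : ℕ → α) (m : ℕ) :
    ∑ i ∈ Finset.range m, F (i + 1) = ∑ i ∈ Finset.Icc 1 m, F i := by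
  rw [Finset.range_eq_Ico, Finset.sum_Ico_add' F 0 m 1]
  congr 1

/-- Row M of R' has entries a_{j,n+f} with a power of p, and the first column of b_v has entries
d_{j,k} with a power of p, followed by a pure power at j = k+1 and zeros. Multiplying them gives the
sum. -/
theorem HasBruhat.right_apply_corner {k q f : ℕ} {rest : List ℕ} (hq : 1 ≤ q) (hf : 1 ≤ f)
    (hK : k + q = n + 1) (hs : (k :: q :: f :: rest).sum = N + 1) {a : ℕ × ℕ → ℚ_[p]}
    {LL RR : Mat p N} (hbb : HasBruhat N (k :: q :: f :: rest) a LL RR) {x y : Fin (N + 1)}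
    (hx : (x : ℕ) + 1 = N - n) (hy : (y : ℕ) = N - n) :
    RR x y = ∑ j ∈ Finset.Icc 1 (k + 1),
      cPart (a (j, n + f)) * (if j = k + 1 then 1 else dPart (a (j, k))) *
        (p : ℚ_[p]) ^ (∑ l ∈ Finset.Icc 1 (j - 1),
          ((mu (a (l, k)) : ℤ) - (mu (a (l, n + f)) : ℤ)) - (mu (a (j, n + f)) : ℤ)) := by
  have h : n ≤ N := by simp at hs; omega
  have hs' : ((n + 1) :: f :: rest).sum = N + 1 := by simp at hs ⊢; omega
  obtain ⟨L', R', hb'⟩ := exists_hasBruhat (f :: rest) (n + 1) (by omega) hs' a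
  obtain ⟨L, R, hb⟩ := hasBruhat_pair hK a
  rw [show y = blockEquiv h (Sum.inr 0) from Fin.ext (by rw [blockEquiv_inr, hy]; simp),
    HasBruhat.right_apply_inl_inr hK hs h (L' := L') (R' := R') (by rw [hK]; exact hb') hb hbb
      (by omega) 0, sum_eq_sum_castLE (show k + 1 ≤ n + 1 by omega)]
  · rw [← sum_range_succ_eq_sum_Icc, ← Fin.sum_univ_eq_sum_range (fun i =>
      cPart (a (i + 1, n + f)) * (if i + 1 = k + 1 then 1 else dPart (a (i + 1, k))) *
        (p : ℚ_[p]) ^ (∑ l ∈ Finset.Icc 1 (i + 1 - 1),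
          ((mu (a (l, k)) : ℤ) - (mu (a (l, n + f)) : ℤ)) - (mu (a (i + 1, n + f)) : ℤ)))]
    apply Finset.sum_congr rfl
    intro j _
    have hj := j.2
    rw [hb'.right_apply_third hf hs' (j := j) (by omega) hx (by rw [blockEquiv_inr]; rfl),
      bMap_pair_first_column hq hK a _ _ rfl, Fin.val_castLE, if_pos (by omega),
      Nat.add_sub_cancel, ← sum_range_succ_eq_sum_Icc, Finset.sum_sub_distrib, sub_eq_add_neg,
      sub_eq_add_neg, zpow_add₀ p_ne_zero, zpow_add₀ p_ne_zero]
    nth_rw 1 [eq_cPart_mul (a ((j : ℕ) + 1, n + f))]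
    simp only [Nat.add_right_cancel_iff]
    rw [← Nat.cast_sum (Finset.range j) (fun x => mu (a (x + 1, k))), zpow_natCast]
    ring
  · intro j hj
    rw [bMap_pair_first_column hq hK a _ _ rfl, if_neg (by omega), mul_zero]

end Entries

end Kloosterman

end

open Kloosterman
theorem theorem3p4 (p : ℕ) [Fact p.Prime] (N n k f : ℕ) (rest : List ℕ)
    (hk : 1 ≤ k) (hkn : k ≤ n) (hf : 1 ≤ f) (hrest : ∀ x ∈ rest, 1 ≤ x)
    (hN : (k :: (n + 1 - k) :: f :: rest).sum = N + 1)
    (w w' v : List ℕ)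
    (hw : w = k :: (n + 1 - k) :: f :: rest)
    (hw' : w' = (n + 1) :: f :: rest)
    (hv : v = [k, n + 1 - k]) :
    -- the factorization of `w`
    weyl p N w = weyl p N w' * idSum N (weyl p n v) ∧
    -- the Bruhat decompositions, for every family `a`
    (∀ a : ℕ × ℕ → ℚ_[p],
      (∃ L' C' R', IsBruhat w' (bMap N w' a) L' C' R') ∧
      (∃ L C R, IsBruhat v (bMap n v a) L C R) ∧
      (∃ LL CC RR, IsBruhat w (bMap N w a) LL CC RR) ∧
      ∀ (L' C' R' : Mat p N) (L C R : Mat p n) (LL CC RR : Mat p N),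
        IsBruhat w' (bMap N w' a) L' C' R' →
        IsBruhat v (bMap n v a) L C R →
        IsBruhat w (bMap N w a) LL CC RR →
        -- the left factor
        (∀ i, 1 ≤ i → i ≤ n →
          entry LL i (i + 1) = entry L' i (i + 1) + entry L i (i + 1) *
            (p : ℚ_[p]) ^ (∑ j ∈ Finset.Icc (n + 1) N,
              ((mu (a (i + 1, j)) : ℤ) - (mu (a (i, j)) : ℤ)))) ∧
        (∀ i, n + 1 ≤ i → i ≤ N → entry LL i (i + 1) = entry L' i (i + 1)) ∧
        -- the central factor
        CC = C' * idSum N C ∧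
        -- the right factor
        (∀ i, 1 ≤ i → i < N - n → entry RR i (i + 1) = entry R' i (i + 1)) ∧
        entry RR (N - n) (N - n + 1) =
          ∑ j ∈ Finset.Icc 1 (k + 1),
            cPart (a (j, n + f)) * (if j = k + 1 then 1 else dPart (a (j, k))) *
              (p : ℚ_[p]) ^ (∑ l ∈ Finset.Icc 1 (j - 1),
                ((mu (a (l, k)) : ℤ) - (mu (a (l, n + f)) : ℤ)) - (mu (a (j, n + f)) : ℤ)) ∧
        (∀ d e, 1 ≤ d → d ≤ n + 1 → 1 ≤ e → e ≤ n + 1 →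
          entry RR (N - n + d) (N - n + e) = entry R d e)) ∧
    -- the index set splits, and `C_w(m) = C_{w'}(m_1) × C_v(m_2)`
    indexSet w = indexSet w' ∪ indexSet v ∧
    Disjoint (indexSet w') (indexSet v) ∧
    (∀ m : ℕ × ℕ → ℕ, Set.BijOn
      (fun c : ℕ × ℕ → ℤ => ((indexSet w').indicator c, (indexSet v).indicator c))
      (CSet p w m)
      (CSet p w' ((indexSet w').indicator m) ×ˢ CSet p v ((indexSet v).indicator m))) ∧
    -- `C_w(m)` parametrizes a system of representatives of `Y(m)` modulo `U_w(ℤ_p)`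
    (∀ r : ℕ → ℕ, ∀ m ∈ MSet N w r,
      (∀ c ∈ CSet p w m, family p m c ∈ YSet p w m) ∧
      ∀ a ∈ YSet p w m, ∃! c : ℕ × ℕ → ℤ,
        c ∈ CSet p w m ∧ SameOrbit w (bMap N w (family p m c)) (bMap N w a)) ∧
    -- together they parametrize a system of representatives of `U(ℤ_p) \ C(𝔫)` modulo `U_w(ℤ_p)`
    (∀ r : ℕ → ℕ,
      (∀ m ∈ MSet N w r, ∀ c ∈ CSet p w m, bMap N w (family p m c) ∈ cell p N w r) ∧
      ∀ g ∈ cell p N w r, ∃! y : (ℕ × ℕ → ℕ) × (ℕ × ℕ → ℤ),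
        y.1 ∈ MSet N w r ∧ y.2 ∈ CSet p w y.1 ∧
          SameOrbit w (bMap N w (family p y.1 y.2)) g) := by
  -- Naming the size of the second block replaces the truncated subtraction by the equation k + q =
  -- n + 1.
  obtain ⟨q, hq⟩ : ∃ q, n + 1 - k = q := ⟨_, rfl⟩
  rw [hq] at hN hw hv
  subst hw hw' hv
  have hK : k + q = n + 1 := by omega
  have hnN : n ≤ N := by simp at hN; omega
  have hn : n + 1 + f ≤ N + 1 := by simp at hN; omega
  have hs' : ((n + 1) :: f :: rest).sum = N + 1 := by simp at hN ⊢; omega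
  have hs2 : [k, q].sum = n + 1 := by simp; omega
  have hI := indexSet_merge k q (f :: rest)
  have hD := disjoint_indexSet k q (f :: rest)
  have hB := bijOn_CSet (p := p) k q (f :: rest)
  have hW := weyl_merge (p := p) k q (f :: rest) hK hN
  rw [hK] at hI hD hB hW
  refine ⟨hW, fun a => ?_, hI, hD, hB, fun r m hm => ⟨fun c hc => family_mem_YSet hc, fun a ha =>
    existsUnique_representative hk hN hm.1 ha⟩, fun r => ⟨fun m hm c hc =>
      bMap_family_mem_cell hk hN hm hc, fun g hg => existsUnique_representative_cell hk hN hg⟩⟩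
  refine ⟨?_, ?_, ?_, ?_⟩
  · obtain ⟨L, R, h⟩ := exists_hasBruhat (f :: rest) (n + 1) (by omega) hs' a
    exact ⟨_, _, _, h.isBruhat⟩
  · obtain ⟨L, R, h⟩ := hasBruhat_pair hK a
    exact ⟨_, _, _, h.isBruhat⟩
  · obtain ⟨L, R, h⟩ := exists_hasBruhat (q :: f :: rest) k hk hN a
    exact ⟨_, _, _, h.isBruhat⟩
  intro L' C' R' L C R LL CC RR b1 b2 b3
  -- Uniqueness identifies the given central factors with the explicit ones, so the three arbitrary
  -- decompositions can be compared through the merge.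
  obtain ⟨h1, rfl⟩ := b1.hasBruhat (by omega) hs'
  obtain ⟨h2, rfl⟩ := b2.hasBruhat hk hs2
  obtain ⟨h3, rfl⟩ := b3.hasBruhat hk hN
  have h1' : HasBruhat N ((k + q) :: f :: rest) a L' R' := by rw [hK]; exact h1
  obtain ⟨hLL, -, hCC⟩ := h1'.merge hK hN hnN h2 h3
  rw [hK] at hLL hCC
  have hX := conj_idSum_mem_U rfl hs' hnN
    (torus_ne_zero (p := p) (N := N) (expoSet N ((n + 1) :: f :: rest) a)) h2.1
  refine ⟨fun i hi hin => ?_, fun i hi hiN => ?_, hCC.symm, fun i hi hiM => ?_, ?_,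
    fun d e hd hdn he hen => ?_⟩
  · obtain ⟨i, rfl⟩ := Nat.exists_eq_add_of_le' hi
    rw [entry_eq LL ⟨i, by omega⟩ ⟨i + 1, by omega⟩ rfl rfl,
      entry_eq L' ⟨i, by omega⟩ ⟨i + 1, by omega⟩ rfl rfl,
      entry_eq L ⟨i, by omega⟩ ⟨i + 1, by omega⟩ rfl rfl, hLL, mul_apply_succ h1.1 hX rfl,
      conj_idSum_apply hs' hnN a L (i := i) (x' := ⟨i, by omega⟩) (y' := ⟨i + 1, by omega⟩)
        rfl rfl rfl rfl]
  · obtain ⟨i, rfl⟩ := Nat.exists_eq_add_of_le' (show 1 ≤ i by omega)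
    rw [entry_eq LL ⟨i, by omega⟩ ⟨i + 1, by omega⟩ rfl rfl,
      entry_eq L' ⟨i, by omega⟩ ⟨i + 1, by omega⟩ rfl rfl, hLL, mul_apply_succ h1.1 hX rfl,
      conj_idSum_apply_of_le hs' (torus_ne_zero _) L (by simp) (by simp only; omega), add_zero]
  · obtain ⟨i, rfl⟩ := Nat.exists_eq_add_of_le' hi
    rw [entry_eq RR ⟨i, by omega⟩ ⟨i + 1, by omega⟩ rfl rfl,
      entry_eq R' ⟨i, by omega⟩ ⟨i + 1, by omega⟩ rfl rfl,
      HasBruhat.right_apply_inl hK hN hnN h1' h2 h3 (by simp only; omega) hiM]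
  · rw [entry_eq RR ⟨N - n - 1, by omega⟩ ⟨N - n, by omega⟩ (by simp only; omega) rfl]
    exact h3.right_apply_corner (by omega) hf hK hN (by simp only; omega) rfl
  · rw [entry_eq RR (blockEquiv hnN (Sum.inr ⟨d - 1, by omega⟩))
        (blockEquiv hnN (Sum.inr ⟨e - 1, by omega⟩))
        (by rw [blockEquiv_inr]; simp only; omega) (by rw [blockEquiv_inr]; simp only; omega),
      entry_eq R ⟨d - 1, by omega⟩ ⟨e - 1, by omega⟩ (by simp only; omega) (by simp only; omega)]
    exact HasBruhat.right_apply_inr hk hK hN hnN h2 h3 _ _
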